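/- Let $n \ge 2$, let $I=[a,b]\subset\mathbb{R}$ with $a<b$, and let $\gamma : I \to \mathbb{R}^n$ be a smooth curve which is non-degenerate: there is $c_0>0$ with $|\det(\gamma'(s),\dots,\gamma^{(n)}(s))| \ge c_0$ for all $s\in I$. Let $\chi\in C^\infty(\mathbb{R})$ be real-valued and supported in the interior of $I$, and for $t>0$ define the measure $\mu_t$ by $\langle \mu_t, g\rangle = \int_{\mathbb{R}} g(t\gamma(s))\,\chi(s)\,\mathrm{d}s$. Assume that $\mu_1$ is not the zero measure, i.e. $\langle\mu_1,g\rangle\neq 0$ for some continuous $g:\mathbb{R}^n\to\mathbb{C}$ (this holds for instance if $\chi\ge 0$ and $\chi\not\equiv 0$). Put $$A_t f(x) := \mu_t * f(x) = \int_{\mathbb{R}} f(x-t\gamma(s))\,\chi(s)\,\mathrm{d}s .$$ For $\lambda>0$ let $\mathcal{Z}_\lambda$ be the set of complex-valued Schwartz functions $f$ on $\mathbb{R}^n$ such that $\widehat f(\xi)=\int_{\mathbb{R}^n} e^{-i\langle x,\xi\rangle}f(x)\,\mathrm{d}x$ is supported in $\{\xi : \lambda/2\le|\xi|\le 2\lambda\}$.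 Let $2\le p\le\infty$ (with $2/\infty=0$). Then for every $\varepsilon>0$ there is a constant $C>0$, depending only on $n$, $p$, $\gamma$, $\chi$ and $\varepsilon$, such that for all $\lambda\ge 1$ $$\sup\big\{\|A_tf\|_{L^p(\mathbb{R}^n\times[1,2])} : f\in\mathcal{Z}_\lambda,\ \|f\|_{L^p(\mathbb{R}^n)}=1\big\}\ \ge\ C\,\lambda^{-\frac1n\left(\frac12+\frac2p\right)-\varepsilon},$$ where the norm on the left is the $L^p$ norm in $(x,t)\in\mathbb{R}^n\times[1,2]$. -/

import Mathlib

open MeasureTheory Set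
open scoped ContDiff ENNReal SchwartzMap FourierTransform

noncomputable section

/-- Fourier transform in the angular-frequency normalisation
`f̂(ξ) = ∫ exp(-i⟨x, ξ⟩) f(x) dx`. -/
def angularFourier {n : ℕ} (f : EuclideanSpace ℝ (Fin n) → ℂ)
    (ξ : EuclideanSpace ℝ (Fin n)) : ℂ :=
  ∫ x, Complex.exp (-Complex.I * ((inner ℝ x ξ : ℝ) : ℂ)) * f x

/-- Relation with Mathlib's normalisation of the Fourier transform. -/
theorem angularFourier_eq {n : ℕ} (f : EuclideanSpace ℝ (Fin n) → ℂ)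
    (ξ : EuclideanSpace ℝ (Fin n)) :
    angularFourier f ξ = 𝓕 f ((2 * Real.pi)⁻¹ • ξ) := by
  rw [Real.fourier_eq', angularFourier]
  refine integral_congr_ae (Filter.Eventually.of_forall fun x => ?_)
  have h : (-2 * Real.pi * inner ℝ x ((2 * Real.pi)⁻¹ • ξ) : ℝ) = -inner ℝ x ξ := by
    rw [inner_smul_right]
    have := Real.pi_ne_zero
    field_simp
  simp only [h, smul_eq_mul]
  congr 2
  push_cast
  ring

/-- `𝒵_λ`: the complex-valued Schwartz functions on `ℝⁿ` whose Fourier transform is supported in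
the annulus `λ/2 ≤ |ξ| ≤ 2λ`. -/
def bandLimited (n : ℕ) (lam : ℝ) : Set 𝓢(EuclideanSpace ℝ (Fin n), ℂ) :=
  {f | tsupport (angularFourier (f : EuclideanSpace ℝ (Fin n) → ℂ)) ⊆
    {ξ | lam / 2 ≤ ‖ξ‖ ∧ ‖ξ‖ ≤ 2 * lam}}

/-- `γ` is a smooth non-degenerate curve on `[a, b]`: it is `C^∞` up to the end points (where
derivatives are one-sided), and `|det(γ'(s), …, γ⁽ⁿ⁾(s))|` is bounded below by a positive constant
on `[a, b]`. The values of `γ` outside `[a, b]` play no role. -/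
structure IsNondegenerateCurve {n : ℕ} (a b : ℝ) (γ : ℝ → EuclideanSpace ℝ (Fin n)) : Prop where
  smooth : ContDiffOn ℝ ∞ γ (Icc a b)
  nondegenerate : ∃ c₀ : ℝ, 0 < c₀ ∧ ∀ s ∈ Icc a b,
    c₀ ≤ |(Matrix.of fun i j : Fin n => iteratedDerivWithin ((j : ℕ) + 1) γ (Icc a b) s i).det|

/-- The pairing `⟨μ_t, g⟩ = ∫ g(t γ(s)) χ(s) ds`. -/
def curvePairing {n : ℕ} (γ : ℝ → EuclideanSpace ℝ (Fin n)) (χ : ℝ → ℝ) (t : ℝ)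
    (g : EuclideanSpace ℝ (Fin n) → ℂ) : ℂ :=
  ∫ s, g (t • γ s) * (χ s : ℂ)

/-- The averaging operator `A_t f(x) = μ_t ∗ f(x) = ∫ f(x - t γ(s)) χ(s) ds`. -/
def curveAverage {n : ℕ} (γ : ℝ → EuclideanSpace ℝ (Fin n)) (χ : ℝ → ℝ) (t : ℝ)
    (f : EuclideanSpace ℝ (Fin n) → ℂ) (x : EuclideanSpace ℝ (Fin n)) : ℂ :=
  curvePairing γ χ t fun y => f (x - y)

/-- An admissible cut-off for the curve `γ` on `[a, b]`: a smooth function supported in the interior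
of `[a, b]` for which the measure `μ = μ_1` carried by the curve is not the zero measure. (The last
condition holds as soon as `χ ≥ 0` is not identically zero.) -/
structure IsCurveCutoff {n : ℕ} (a b : ℝ) (γ : ℝ → EuclideanSpace ℝ (Fin n)) (χ : ℝ → ℝ) :
    Prop where
  smooth : ContDiff ℝ ∞ χ
  support : tsupport χ ⊆ interior (Icc a b)
  measure_ne_zero : ∃ g : EuclideanSpace ℝ (Fin n) → ℂ, Continuous g ∧ curvePairing γ χ 1 g ≠ 0

/-- The norm `‖A_t f‖_{L^p(ℝⁿ × [1,2])}`, as an extended non-negative real. -/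
def spaceTimeNorm {n : ℕ} (γ : ℝ → EuclideanSpace ℝ (Fin n)) (χ : ℝ → ℝ) (p : ℝ≥0∞)
    (f : EuclideanSpace ℝ (Fin n) → ℂ) : ℝ≥0∞ :=
  eLpNorm (fun z : EuclideanSpace ℝ (Fin n) × ℝ => curveAverage γ χ z.2 f z.1) p
    (volume.restrict (univ ×ˢ Icc (1 : ℝ) 2))

end

/-!
The lower bound is witnessed by a superposition of wave packets which all focus at the space-time
point `x = 0`, `t = 1`.

**A single packet.** By non-degeneracy there is for each parameter `s` a unit vector `e s`
orthogonal to `γ'(s), …, γ⁽ⁿ⁻¹⁾(s)` (`exists_conormal`), so the phase `lam ⟨γ(σ) - γ(s), e s⟩` is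
`O(lam |σ - s| ^ n)`. Take `N` slightly larger than `lam ^ (1 / n)` and let
`f_s(x) = exp(i lam ⟨x, e s⟩) η(N (x + γ(s)))`, where `η ≥ 0` is a Schwartz window whose Fourier
transform has compact support (`exists_window`). On the region `|x| ≤ 1 / N`, `1 ≤ t ≤ 1 + 1 / N`
the integrand of `A_t f_s(x)` lives on `|σ - s| ≲ 1 / N`, where it does not oscillate; one therefore
expects `|A_t f_s| ≈ 1 / N` there.

**No cancellation.** The curve may meet itself at `γ(s)`, and different strands might cancel. To
rule this out the averages, with the trivial phase removed, are tested against a density `θ(s)` over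
the packets of an arc. After exchanging the integrals the result is the integral of `testedKernel`
along the curve. As `N → ∞` with `lam / N ^ n → 0` this kernel
converges boundedly to a positive multiple of `θ` on the arc and to zero off it
(`tendsto_testedKernel`). If all these limits vanished, for all arcs and all `θ`, then the
measure `μ_1` would integrate to zero against `g M` for every continuous `g`, with a fixed `M > 0`,
so that `μ_1 = 0`. Hence some arc and some `θ` have a non-zero limit
(`exists_arc_tendsto_ne_zero`), which bounds below the mean square of `|A_t f_s|` over `s` in that arc.

**Superposition.** Choose `N` equally spaced parameters on which this mean is attained and signs
for which the square of the sum dominates the sum of the squares. Hölder's inequality on the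
focusing region, whose measure is `≈ N ^ (-n - 1)`, gives
`‖A_t f‖_p ≳ N ^ (-1 / 2 - (n + 1) / p)`, while the packets are essentially disjoint, so that
`‖f‖_p ≲ N ^ ((1 - n) / p)` (`eLpNorm_packet_sum_le`). The quotient is `N ^ (-1 / 2 - 2 / p)`
(`exists_le_sSup_of_le_norm_integral`), which is the claim for large `lam`.

**Bounded frequencies.** For `lam` in a compact set it is enough that the supremum is locally bounded
below by a positive number. This holds since the Fourier transform of `μ_1` is real-analytic and
non-zero, hence does not vanish identically on any annulus (`exists_le_sSup_of_frequency_le`).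
-/

/-! ### Wave packets -/

theorem hasTemperateGrowth_character {n : ℕ} (ξ : EuclideanSpace ℝ (Fin n)) :
    Function.HasTemperateGrowth
      (fun x : EuclideanSpace ℝ (Fin n) => Complex.exp (Complex.I * ((inner ℝ x ξ : ℝ) : ℂ))) := by
  have h1 : Function.HasTemperateGrowth (fun t : ℝ => Complex.exp (Complex.I * (t : ℂ))) := by
    refine ⟨(contDiff_const.mul Complex.ofRealCLM.contDiff).cexp, fun k => ⟨0, 1, fun t => ?_⟩⟩
    have key : iteratedDeriv k (fun t : ℝ => Complex.exp (Complex.I * (t : ℂ)))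
        = fun t : ℝ => Complex.I ^ k * Complex.exp (Complex.I * (t : ℂ)) := by
      induction k with
      | zero => simp
      | succ k ih =>
        rw [iteratedDeriv_succ, ih]
        funext t
        have : HasDerivAt (fun t : ℝ => Complex.exp (Complex.I * (t : ℂ)))
            (Complex.exp (Complex.I * (t : ℂ)) * (Complex.I * 1)) t :=
          ((Complex.ofRealCLM.hasDerivAt (x := t)).const_mul Complex.I).cexp
        rw [(this.const_mul (Complex.I ^ k)).deriv]
        ring
    rw [norm_iteratedFDeriv_eq_norm_iteratedDeriv, key]
    simp [mul_comm Complex.I, Complex.norm_exp_ofReal_mul_I]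
  exact h1.comp (Function.hasTemperateGrowth_inner_left ξ)

/-- The wave packet `x ↦ exp(i⟨x, ξ⟩) η(N(x + v))`: frequency close to `ξ`, position close to `-v`
at scale `1 / N`. -/
noncomputable def wavePacket {n : ℕ} (η : EuclideanSpace ℝ (Fin n) → ℂ) (N : ℝ)
    (v ξ x : EuclideanSpace ℝ (Fin n)) : ℂ :=
  Complex.exp (Complex.I * ((inner ℝ x ξ : ℝ) : ℂ)) * η (N • (x + v))

theorem exists_schwartz_eq_wavePacket {n : ℕ} (η : 𝓢(EuclideanSpace ℝ (Fin n), ℂ)) {N : ℝ}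
    (hN : 0 < N) (v ξ : EuclideanSpace ℝ (Fin n)) :
    ∃ f : 𝓢(EuclideanSpace ℝ (Fin n), ℂ), ⇑f = wavePacket η N v ξ := by
  let L : EuclideanSpace ℝ (Fin n) ≃L[ℝ] EuclideanSpace ℝ (Fin n) :=
    ContinuousLinearEquiv.smulLeft (Units.mk0 N hN.ne')
  refine ⟨SchwartzMap.smulLeftCLM ℂ
    (fun x => Complex.exp (Complex.I * ((inner ℝ x ξ : ℝ) : ℂ)))
    (SchwartzMap.compSubConstCLM ℂ (-v) (SchwartzMap.compCLMOfContinuousLinearEquiv ℂ L η)), ?_⟩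
  ext x
  rw [SchwartzMap.smulLeftCLM_apply_apply (hasTemperateGrowth_character ξ)]
  simp [wavePacket, L, Units.smul_def]

theorem angularFourier_wavePacket {n : ℕ} (η : EuclideanSpace ℝ (Fin n) → ℂ) {N : ℝ}
    (hN : 0 < N) (v ξ ζ : EuclideanSpace ℝ (Fin n)) :
    angularFourier (wavePacket η N v ξ) ζ =
      ((N ^ n)⁻¹ : ℝ) • (Complex.exp (Complex.I * ((inner ℝ v (ζ - ξ) : ℝ) : ℂ)) *
        angularFourier η (N⁻¹ • (ζ - ξ))) := by
  unfold angularFourier wavePacket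
  have h1 := integral_add_right_eq_self (μ := (volume : Measure (EuclideanSpace ℝ (Fin n))))
    (fun x => Complex.exp (-Complex.I * ((inner ℝ (x - v) ζ : ℝ) : ℂ)) *
      (Complex.exp (Complex.I * ((inner ℝ (x - v) ξ : ℝ) : ℂ)) * η (N • x))) v
  simp only [add_sub_cancel_right] at h1
  rw [h1]
  have h2 := Measure.integral_comp_smul (volume : Measure (EuclideanSpace ℝ (Fin n)))
    (fun x => Complex.exp (Complex.I * ((inner ℝ v (ζ - ξ) : ℝ) : ℂ)) *
      (Complex.exp (-Complex.I * ((inner ℝ x (N⁻¹ • (ζ - ξ)) : ℝ) : ℂ)) * η x)) N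
  rw [integral_const_mul _ (fun x => Complex.exp (-Complex.I * ((inner ℝ x (N⁻¹ • (ζ - ξ)) : ℝ) : ℂ)) * η x),
    finrank_euclideanSpace_fin, abs_of_pos (by positivity)] at h2
  rw [← h2]
  refine integral_congr_ae (Filter.Eventually.of_forall fun x => ?_)
  simp only
  rw [← mul_assoc, ← mul_assoc, ← Complex.exp_add, ← Complex.exp_add]
  congr 2
  rw [real_inner_smul_left, real_inner_smul_right]
  simp only [inner_sub_left, inner_sub_right]
  rw [← mul_assoc, mul_inv_cancel₀ hN.ne']
  push_cast
  ring

theorem mem_bandLimited {n : ℕ} {lam : ℝ} {f : 𝓢(EuclideanSpace ℝ (Fin n), ℂ)}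
    (h : ∀ ζ, ¬ (lam / 2 ≤ ‖ζ‖ ∧ ‖ζ‖ ≤ 2 * lam) →
      angularFourier (f : EuclideanSpace ℝ (Fin n) → ℂ) ζ = 0) : f ∈ bandLimited n lam := by
  refine closure_minimal (fun ζ hζ => ?_) ?_
  · by_contra hc
    exact hζ (h ζ hc)
  · exact (isClosed_le continuous_const continuous_norm).inter
      (isClosed_le continuous_norm continuous_const)

theorem integrable_angularFourier {n : ℕ} (f : 𝓢(EuclideanSpace ℝ (Fin n), ℂ))
    (ζ : EuclideanSpace ℝ (Fin n)) :
    Integrable (fun x => Complex.exp (-Complex.I * ((inner ℝ x ζ : ℝ) : ℂ)) * f x) := by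
  refine f.integrable.bdd_mul (c := 1) (by fun_prop) (Filter.Eventually.of_forall fun x => ?_)
  rw [show -Complex.I * ((inner ℝ x ζ : ℝ) : ℂ) = ((-inner ℝ x ζ : ℝ) : ℂ) * Complex.I by
    push_cast; ring, Complex.norm_exp_ofReal_mul_I]

theorem angularFourier_sum {n : ℕ} {ι : Type*} (s : Finset ι) (c : ι → ℂ)
    (f : ι → 𝓢(EuclideanSpace ℝ (Fin n), ℂ)) (ζ : EuclideanSpace ℝ (Fin n)) :
    angularFourier (⇑(∑ i ∈ s, c i • f i)) ζ = ∑ i ∈ s, c i * angularFourier (⇑(f i)) ζ := by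
  unfold angularFourier
  simp_rw [← integral_const_mul]
  rw [← integral_finsetSum _ fun i _ => (integrable_angularFourier (f i) ζ).const_mul (c i)]
  refine integral_congr_ae (Filter.Eventually.of_forall fun x => ?_)
  simp only [sum_apply, smul_apply, smul_eq_mul, Finset.mul_sum]
  refine Finset.sum_congr rfl fun i _ => by ring

/-- A non-negative band-limited window, obtained as `|𝓕 φ|²` for a smooth bump `φ`: its Fourier
transform is the autocorrelation of `φ`, which has compact support. -/
theorem exists_window (n : ℕ) :
    ∃ (ψ η : 𝓢(EuclideanSpace ℝ (Fin n), ℂ)) (r : ℝ), 0 < r ∧ ψ 0 ≠ 0 ∧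
      (∀ x, η x = ((‖ψ x‖ ^ 2 : ℝ) : ℂ)) ∧
      ∀ ζ, r < ‖ζ‖ → angularFourier (η : EuclideanSpace ℝ (Fin n) → ℂ) ζ = 0 := by
  let b : ContDiffBump (0 : EuclideanSpace ℝ (Fin n)) := ⟨1, 2, by norm_num, by norm_num⟩
  have hbs : HasCompactSupport (fun x => ((b x : ℝ) : ℂ)) :=
    b.hasCompactSupport.comp_left (g := fun t : ℝ => (t : ℂ)) (by simp)
  have hbd : ContDiff ℝ ∞ (fun x => ((b x : ℝ) : ℂ)) :=
    Complex.ofRealCLM.contDiff.comp b.contDiff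
  let φ : 𝓢(EuclideanSpace ℝ (Fin n), ℂ) := hbs.toSchwartzMap hbd
  have hφ : ∀ x, φ x = ((b x : ℝ) : ℂ) := fun x => rfl
  let ψ : 𝓢(EuclideanSpace ℝ (Fin n), ℂ) := 𝓕 φ
  have hconj : Function.HasTemperateGrowth (fun x => Complex.conjCLE (ψ x)) :=
    (Complex.conjCLE.toContinuousLinearMap.hasTemperateGrowth).comp ψ.hasTemperateGrowth
  let η : 𝓢(EuclideanSpace ℝ (Fin n), ℂ) :=
    SchwartzMap.smulLeftCLM ℂ (fun x => Complex.conjCLE (ψ x)) ψ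
  have hη : ∀ x, η x = ((‖ψ x‖ ^ 2 : ℝ) : ℂ) := fun x => by
    rw [SchwartzMap.smulLeftCLM_apply_apply hconj]
    simp only [Complex.conjCLE_apply, smul_eq_mul]
    rw [mul_comm, Complex.mul_conj, Complex.normSq_eq_norm_sq]
  refine ⟨ψ, η, 2 * Real.pi * 4, by positivity, ?_, hη, fun ζ hζ => ?_⟩
  · have h0 : ψ 0 = ((∫ x, b x : ℝ) : ℂ) := by
      change 𝓕 (φ : EuclideanSpace ℝ (Fin n) → ℂ) 0 = _
      rw [Real.fourier_eq', ← integral_complex_ofReal]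
      simp [hφ]
    rw [h0]
    exact_mod_cast b.integral_pos.ne'
  · rw [angularFourier_eq]
    set ξ := (2 * Real.pi)⁻¹ • ζ with hξ
    have hξn : 4 < ‖ξ‖ := by
      rw [hξ, norm_smul, Real.norm_of_nonneg (by positivity), inv_mul_eq_div,
        lt_div_iff₀ (by positivity)]
      linarith
    let φ' : 𝓢(EuclideanSpace ℝ (Fin n), ℂ) := SchwartzMap.compSubConstCLM ℂ ξ φ
    have hφ' : ∀ x, 𝓕 φ' x = Complex.exp (↑(-2 * Real.pi * inner ℝ x ξ) * Complex.I) * ψ x := by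
      intro x
      change 𝓕 (φ' : EuclideanSpace ℝ (Fin n) → ℂ) x
        = _ * 𝓕 (φ : EuclideanSpace ℝ (Fin n) → ℂ) x
      rw [Real.fourier_eq', Real.fourier_eq', ← integral_const_mul]
      rw [← integral_add_right_eq_self _ ξ]
      refine integral_congr_ae (Filter.Eventually.of_forall fun y => ?_)
      simp only [smul_eq_mul, φ', SchwartzMap.compSubConstCLM_apply, add_sub_cancel_right]
      rw [← mul_assoc, ← Complex.exp_add, inner_add_left, real_inner_comm x ξ]
      congr 2
      push_cast
      ring
    rw [Real.fourier_eq']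
    have key := SchwartzMap.integral_inner_fourier_fourier φ φ'
    have hz : ∫ x, inner ℂ (φ x) (φ' x) = 0 := by
      rw [← integral_zero (EuclideanSpace ℝ (Fin n)) ℂ]
      refine integral_congr_ae (Filter.Eventually.of_forall fun x => ?_)
      simp only [φ', SchwartzMap.compSubConstCLM_apply, hφ]
      by_cases hx : ‖x‖ < 2
      · have : b (x - ξ) = 0 := b.zero_of_le_dist (by
          change 2 ≤ _
          rw [dist_zero_right]
          have := norm_sub_norm_le ξ x
          rw [norm_sub_rev] at this
          linarith)
        simp [this]
      · have : b x = 0 := b.zero_of_le_dist (by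
          change 2 ≤ _
          rw [dist_zero_right]
          linarith)
        simp [this]
    rw [hz] at key
    rw [← key]
    refine integral_congr_ae (Filter.Eventually.of_forall fun x => ?_)
    simp only [hφ', hη, smul_eq_mul, RCLike.inner_apply]
    change _ = _ * _ * (starRingEnd ℂ) (ψ x)
    rw [mul_assoc (Complex.exp _) (ψ x), Complex.mul_conj, Complex.normSq_eq_norm_sq]

/-! ### Geometry of non-degenerate curves -/

theorem hasDerivWithinAt_iteratedDerivWithin {n : ℕ} {a b : ℝ} (hab : a < b)
    {γ : ℝ → EuclideanSpace ℝ (Fin n)} (hγ : ContDiffOn ℝ ∞ γ (Icc a b)) (k : ℕ) {s : ℝ}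
    (hs : s ∈ Icc a b) :
    HasDerivWithinAt (iteratedDerivWithin k γ (Icc a b))
      (iteratedDerivWithin (k + 1) γ (Icc a b) s) (Icc a b) s := by
  rw [iteratedDerivWithin_succ]
  exact ((hγ.differentiableOn_iteratedDerivWithin (by exact_mod_cast ENat.natCast_lt_top k)
    (uniqueDiffOn_Icc hab)) s hs).hasDerivWithinAt

theorem continuousOn_iteratedDerivWithin_Icc {n : ℕ} {a b : ℝ} (hab : a < b)
    {γ : ℝ → EuclideanSpace ℝ (Fin n)} (hγ : ContDiffOn ℝ ∞ γ (Icc a b)) (k : ℕ) :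
    ContinuousOn (iteratedDerivWithin k γ (Icc a b)) (Icc a b) :=
  fun _ hs => (hasDerivWithinAt_iteratedDerivWithin hab hγ k hs).continuousWithinAt

/-- One integration step: the increment of `g` is controlled by a power-type bound on `g'`. -/
theorem abs_sub_le_of_abs_deriv_le_pow {a b B s σ : ℝ} {i : ℕ} {g g' : ℝ → ℝ}
    (hs : s ∈ Icc a b) (hσ : σ ∈ Icc a b) (hB : 0 ≤ B)
    (hg : ∀ x ∈ Icc a b, HasDerivWithinAt g (g' x) (Icc a b) x)
    (hb : ∀ x ∈ Icc a b, |g' x| ≤ B * |x - s| ^ i) :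
    |g σ - g s| ≤ B * |σ - s| ^ (i + 1) := by
  have hsub : uIcc s σ ⊆ Icc a b := uIcc_subset_Icc hs hσ
  have h := (convex_uIcc s σ).norm_image_sub_le_of_norm_hasDerivWithin_le
    (f := g) (f' := g') (C := B * |σ - s| ^ i)
    (fun x hx => (hg x (hsub hx)).mono hsub) (fun x hx => by
      refine (hb x (hsub hx)).trans ?_
      exact mul_le_mul_of_nonneg_left
        (pow_le_pow_left₀ (abs_nonneg _) (abs_sub_left_of_mem_uIcc hx) i) hB) left_mem_uIcc right_mem_uIcc
  rw [Real.norm_eq_abs, Real.norm_eq_abs] at h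
  rw [pow_succ, ← mul_assoc]
  exact h

/-- If `v` is orthogonal to the first `n - 1` derivatives of `γ` at `s`, then `γ` leaves the
hyperplane through `γ s` orthogonal to `v` only to order `n`. -/
theorem abs_inner_sub_le_pow {n m : ℕ} {a b : ℝ} (hab : a < b)
    {γ : ℝ → EuclideanSpace ℝ (Fin n)} (hγ : ContDiffOn ℝ ∞ γ (Icc a b)) {B : ℝ} (hB : 0 ≤ B)
    (hbd : ∀ x ∈ Icc a b, ‖iteratedDerivWithin (m + 1) γ (Icc a b) x‖ ≤ B)
    {v : EuclideanSpace ℝ (Fin n)} (hv : ‖v‖ = 1) {s σ : ℝ} (hs : s ∈ Icc a b)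
    (hσ : σ ∈ Icc a b)
    (horth : ∀ j < m, inner ℝ (iteratedDerivWithin (j + 1) γ (Icc a b) s) v = 0) :
    |inner ℝ (γ σ - γ s) v| ≤ B * |σ - s| ^ (m + 1) := by
  have hder : ∀ k, ∀ x ∈ Icc a b, HasDerivWithinAt
      (fun x => inner ℝ (iteratedDerivWithin k γ (Icc a b) x) v)
      (inner ℝ (iteratedDerivWithin (k + 1) γ (Icc a b) x) v) (Icc a b) x := by
    intro k x hx
    have := (hasDerivWithinAt_iteratedDerivWithin hab hγ k hx).inner ℝ
      (hasDerivWithinAt_const x (Icc a b) v)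
    simpa using this
  -- integrate downwards from the bounded derivative of order `m + 1`
  have key : ∀ i ≤ m, ∀ x ∈ Icc a b,
      |inner ℝ (iteratedDerivWithin (m - i + 1) γ (Icc a b) x) v| ≤ B * |x - s| ^ i := by
    intro i
    induction i with
    | zero =>
      intro _ x hx
      rw [pow_zero, mul_one, Nat.sub_zero]
      refine (abs_real_inner_le_norm _ _).trans ?_
      rw [hv, mul_one]
      exact hbd x hx
    | succ i ih =>
      intro hi x hx
      have h1 := abs_sub_le_of_abs_deriv_le_pow (i := i) hs hx hB
        (hder (m - (i + 1) + 1)) (fun y hy => by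
          have := ih (by omega) y hy
          rwa [show m - i = m - (i + 1) + 1 by omega] at this)
      rwa [horth (m - (i + 1)) (by omega), sub_zero] at h1
  have h2 := abs_sub_le_of_abs_deriv_le_pow (i := m) hs hσ hB (hder 0) (fun y hy => by
    have := key m le_rfl y hy
    rwa [Nat.sub_self] at this)
  simpa [inner_sub_left] using h2

/-- A continuous unit conormal field along a non-degenerate curve: the vector orthogonal to the
first `n - 1` derivatives, which is the last row of the adjugate of the derivative matrix. -/
theorem exists_conormal {n : ℕ} (hn : 2 ≤ n) {a b : ℝ} (hab : a < b)
    {γ : ℝ → EuclideanSpace ℝ (Fin n)} (hγ : IsNondegenerateCurve a b γ) :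
    ∃ (e : ℝ → EuclideanSpace ℝ (Fin n)) (B : ℝ), Continuous e ∧ (∀ s, ‖e s‖ = 1) ∧ 0 ≤ B ∧
      ∀ s ∈ Icc a b, ∀ σ ∈ Icc a b, |inner ℝ (γ σ - γ s) (e s)| ≤ B * |σ - s| ^ n := by
  obtain ⟨c₀, hc₀, hdet⟩ := hγ.nondegenerate
  obtain ⟨m, rfl⟩ : ∃ m, n = m + 1 := ⟨n - 1, by omega⟩
  obtain ⟨B, hB⟩ := isCompact_Icc.exists_bound_of_continuousOn
    (continuousOn_iteratedDerivWithin_Icc hab hγ.smooth (m + 1))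
  let A : ℝ → Matrix (Fin (m + 1)) (Fin (m + 1)) ℝ := fun s =>
    Matrix.of fun i j => iteratedDerivWithin ((j : ℕ) + 1) γ (Icc a b) s i
  have hA : ContinuousOn A (Icc a b) := by
    refine continuousOn_pi.2 fun i => continuousOn_pi.2 fun j => ?_
    exact (EuclideanSpace.proj i).continuous.comp_continuousOn
      (continuousOn_iteratedDerivWithin_Icc hab hγ.smooth ((j : ℕ) + 1))
  let v : ℝ → EuclideanSpace ℝ (Fin (m + 1)) := fun s =>
    WithLp.toLp 2 ((A s).adjugate (Fin.last m))
  have hinner : ∀ s, ∀ j : Fin (m + 1), inner ℝ (iteratedDerivWithin ((j : ℕ) + 1) γ (Icc a b) s)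
      (v s) = if Fin.last m = j then (A s).det else 0 := by
    intro s j
    have h := congrFun (congrFun (Matrix.adjugate_mul (A s)) (Fin.last m)) j
    rw [Matrix.mul_apply, Matrix.smul_apply, Matrix.one_apply] at h
    simp only [smul_eq_mul, mul_ite, mul_one, mul_zero] at h
    rw [← h, PiLp.inner_apply]
    rfl
  have hv0 : ∀ s ∈ Icc a b, v s ≠ 0 := by
    intro s hs h0
    have h := hinner s (Fin.last m)
    rw [h0, inner_zero_right, if_pos rfl] at h
    have h2 := hdet s hs
    change c₀ ≤ |(A s).det| at h2
    rw [← h, abs_zero] at h2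
    linarith
  have hvc : ContinuousOn v (Icc a b) := by
    refine (PiLp.continuous_toLp 2 _).comp_continuousOn ?_
    have : Continuous fun M : Matrix (Fin (m + 1)) (Fin (m + 1)) ℝ => M.adjugate (Fin.last m) :=
      (continuous_apply _).comp (continuous_id.matrix_adjugate)
    exact this.comp_continuousOn hA
  have hu : ContinuousOn (fun s => ‖v s‖⁻¹ • v s) (Icc a b) :=
    (hvc.norm.inv₀ fun s hs => norm_ne_zero_iff.2 (hv0 s hs)).smul hvc
  have hun : ∀ s ∈ Icc a b, ‖‖v s‖⁻¹ • v s‖ = 1 := fun s hs => by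
    rw [norm_smul, norm_inv, norm_norm, inv_mul_cancel₀ (norm_ne_zero_iff.2 (hv0 s hs))]
  refine ⟨Set.IccExtend hab.le ((Icc a b).domRestrict fun s => ‖v s‖⁻¹ • v s), B,
    hu.domRestrict.Icc_extend', fun s => ?_, ?_, fun s hs σ hσ => ?_⟩
  · exact hun _ (projIcc a b hab.le s).2
  · exact (norm_nonneg _).trans (hB a (left_mem_Icc.2 hab.le))
  · rw [Set.IccExtend_of_mem hab.le _ hs]
    refine abs_inner_sub_le_pow hab hγ.smooth ((norm_nonneg _).trans (hB a
      (left_mem_Icc.2 hab.le))) hB (hun s hs) hs hσ fun j hj => ?_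
    have h := hinner s ⟨j, by omega⟩
    rw [if_neg (by simp [Fin.ext_iff]; omega)] at h
    simp only [inner_smul_right, h, mul_zero]

/-- Since `γ'` does not vanish, a non-degenerate curve expands distances, up to a constant, on short
parameter intervals. -/
theorem exists_local_expansion {n : ℕ} (hn : 2 ≤ n) {a b : ℝ} (hab : a < b)
    {γ : ℝ → EuclideanSpace ℝ (Fin n)} (hγ : IsNondegenerateCurve a b γ) :
    ∃ c r : ℝ, 0 < c ∧ 0 < r ∧ ∀ s ∈ Icc a b, ∀ s' ∈ Icc a b, |s - s'| ≤ r →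
      c * |s - s'| ≤ ‖γ s - γ s'‖ := by
  obtain ⟨c₀, hc₀, hdet⟩ := hγ.nondegenerate
  set γ' := iteratedDerivWithin 1 γ (Icc a b) with hγ'
  have hcont : ContinuousOn γ' (Icc a b) := continuousOn_iteratedDerivWithin_Icc hab hγ.smooth 1
  have hder : ∀ x ∈ Icc a b, HasDerivWithinAt γ (γ' x) (Icc a b) x := fun x hx => by
    have := hasDerivWithinAt_iteratedDerivWithin hab hγ.smooth 0 hx
    rwa [iteratedDerivWithin_zero] at this
  have hne : ∀ s ∈ Icc a b, γ' s ≠ 0 := by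
    intro s hs h0
    have h := hdet s hs
    rw [Matrix.det_eq_zero_of_column_eq_zero ⟨0, by omega⟩ (fun i => ?_), abs_zero] at h
    · linarith
    · simp only [Matrix.of_apply, zero_add]
      rw [← hγ', h0]
      rfl
  obtain ⟨s₀, hs₀, hmin⟩ := isCompact_Icc.exists_isMinOn (nonempty_Icc.2 hab.le) hcont.norm
  set c := ‖γ' s₀‖ with hc
  have hcpos : 0 < c := norm_pos_iff.2 (hne s₀ hs₀)
  have huc := isCompact_Icc.uniformContinuousOn_of_continuous hcont
  rw [Metric.uniformContinuousOn_iff_le] at huc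
  obtain ⟨r, hr, hru⟩ := huc (c / 2) (by positivity)
  refine ⟨c / 2, r, by positivity, hr, fun s hs s' hs' hss => ?_⟩
  have hsub : uIcc s' s ⊆ Icc a b := uIcc_subset_Icc hs' hs
  have h := (convex_uIcc s' s).norm_image_sub_le_of_norm_hasDerivWithin_le
    (f := fun x => γ x - x • γ' s') (f' := fun x => γ' x - γ' s') (C := c / 2)
    (fun x hx => by
      have := ((hder x (hsub hx)).mono hsub).sub
        (((hasDerivWithinAt_id x (uIcc s' s)).smul_const (γ' s')))
      rw [one_smul] at this
      exact this)
    (fun x hx => by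
      rw [← dist_eq_norm]
      refine hru x (hsub hx) s' hs' ?_
      rw [Real.dist_eq]
      exact (abs_sub_left_of_mem_uIcc hx).trans hss) left_mem_uIcc right_mem_uIcc
  have h3 : ‖(s - s') • γ' s'‖ ≤ ‖γ s - γ s'‖ + c / 2 * |s - s'| := by
    have e1 : (s - s') • γ' s' = (γ s - γ s') - ((γ s - s • γ' s') - (γ s' - s' • γ' s')) := by
      rw [sub_smul]; abel
    rw [e1]
    exact (norm_sub_le _ _).trans (add_le_add le_rfl (by simpa using h))
  rw [norm_smul, Real.norm_eq_abs] at h3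
  have h4 : c ≤ ‖γ' s'‖ := hmin hs'
  nlinarith [abs_nonneg (s - s')]

theorem exists_hasDerivAt_of_isNondegenerateCurve {n : ℕ} {a b : ℝ}
    {γ : ℝ → EuclideanSpace ℝ (Fin n)} (hγ : IsNondegenerateCurve a b γ) {s : ℝ}
    (hs : s ∈ Ioo a b) : HasDerivAt γ (deriv γ s) s :=
  ((hγ.smooth.contDiffAt (Icc_mem_nhds hs.1 hs.2)).differentiableAt (by simp)).hasDerivAt

/-! ### The localised kernel and its limit -/

/-- A parametrised arc `γ` on `[α, β]` with a unit field `e` along it: `γ` is differentiable and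
expands distances on `[α, β]`, and leaves each hyperplane through `γ s` orthogonal to `e s` only to
order `n`. -/
structure IsConormalArc {n : ℕ} (γ e : ℝ → EuclideanSpace ℝ (Fin n)) (B c α β : ℝ) : Prop where
  continuous_curve : Continuous γ
  continuous_field : Continuous e
  norm_field : ∀ s, ‖e s‖ = 1
  lt : α < β
  expansion_pos : 0 < c
  expansion : ∀ s ∈ Icc α β, ∀ s' ∈ Icc α β, c * |s - s'| ≤ ‖γ s - γ s'‖
  hasDerivAt : ∀ σ ∈ Icc α β, HasDerivAt γ (deriv γ σ) σ
  contact_nonneg : 0 ≤ B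
  contact : ∀ σ ∈ Icc α β, ∀ᶠ s in nhds σ, |inner ℝ (γ σ - γ s) (e s)| ≤ B * |σ - s| ^ n

/-- The rescaled space-time region `{(y, τ) : |y| ≤ 1, 0 ≤ τ ≤ 1}`. -/
def unitBox (n : ℕ) : Set (EuclideanSpace ℝ (Fin n) × ℝ) :=
  Metric.closedBall 0 1 ×ˢ Icc 0 1

theorem isCompact_unitBox (n : ℕ) : IsCompact (unitBox n) :=
  (isCompact_closedBall _ _).prod isCompact_Icc

theorem volume_unitBox_ne_top (n : ℕ) : volume (unitBox n) ≠ ⊤ :=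
  (isCompact_unitBox n).measure_ne_top

instance isFiniteMeasure_restrict_unitBox (n : ℕ) :
    IsFiniteMeasure ((volume : Measure (EuclideanSpace ℝ (Fin n) × ℝ)).restrict (unitBox n)) :=
  ⟨by rw [Measure.restrict_apply_univ]; exact (volume_unitBox_ne_top n).lt_top⟩

/-- The contribution of the point `w` of the curve to the average of the packet based at `s`, at
the rescaled space-time point `z = (y, τ)`, with a unimodular factor independent of `w` removed. -/
noncomputable def packetKernel {n : ℕ} (γ e : ℝ → EuclideanSpace ℝ (Fin n))
    (η : EuclideanSpace ℝ (Fin n) → ℂ) (N lam : ℝ) (w : EuclideanSpace ℝ (Fin n)) (s : ℝ)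
    (z : EuclideanSpace ℝ (Fin n) × ℝ) : ℂ :=
  Complex.exp (((-(lam * (1 + z.2 / N) * inner ℝ (w - γ s) (e s)) : ℝ) : ℂ) * Complex.I) *
    η (N • (γ s - w) + z.1 - z.2 • w)

/-- `packetKernel` tested against a weight `θ(s)`. -/
noncomputable def testedKernel {n : ℕ} (γ e : ℝ → EuclideanSpace ℝ (Fin n))
    (η : EuclideanSpace ℝ (Fin n) → ℂ) (θ : ℝ → ℝ) (N lam : ℝ)
    (w : EuclideanSpace ℝ (Fin n)) : ℂ :=
  N * ∫ s, (θ s : ℂ) * ∫ z in unitBox n, packetKernel γ e η N lam w s z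

/-- The integral of the window along the tangent direction of `γ` at `σ`, accumulated over the
rescaled space-time region. It is the limit of the kernels tested against a weight equal to `1`
at `σ`. -/
noncomputable def tangentMass {n : ℕ} (γ : ℝ → EuclideanSpace ℝ (Fin n))
    (η : EuclideanSpace ℝ (Fin n) → ℂ) (σ : ℝ) : ℂ :=
  ∫ u : ℝ, ∫ z in unitBox n, η (u • deriv γ σ + z.1 - z.2 • γ σ)

section

variable {n : ℕ} {γ e : ℝ → EuclideanSpace ℝ (Fin n)} {η : EuclideanSpace ℝ (Fin n) → ℂ}
  {D : ℝ} {N lam : ℝ}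

theorem norm_packetKernel (w : EuclideanSpace ℝ (Fin n)) (s : ℝ)
    (z : EuclideanSpace ℝ (Fin n) × ℝ) :
    ‖packetKernel γ e η N lam w s z‖ = ‖η (N • (γ s - w) + z.1 - z.2 • w)‖ := by
  rw [packetKernel, norm_mul, Complex.norm_exp_ofReal_mul_I, one_mul]

theorem continuous_packetKernel {X : Type*} [TopologicalSpace X] (hγ : Continuous γ)
    (he : Continuous e) (hη : Continuous η) (N lam : ℝ) {w : X → EuclideanSpace ℝ (Fin n)}
    {s : X → ℝ} {z : X → EuclideanSpace ℝ (Fin n) × ℝ} (hw : Continuous w) (hs : Continuous s)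
    (hz : Continuous z) :
    Continuous fun x => packetKernel γ e η N lam (w x) (s x) (z x) := by
  unfold packetKernel
  fun_prop

theorem window_const_nonneg (hD : ∀ v, ‖η v‖ ≤ D * ((1 + ‖v‖) ^ 2)⁻¹) : 0 ≤ D := by
  have := (norm_nonneg _).trans (hD 0)
  simpa using this

theorem norm_window_le (hD : ∀ v, ‖η v‖ ≤ D * ((1 + ‖v‖) ^ 2)⁻¹)
    (v : EuclideanSpace ℝ (Fin n)) : ‖η v‖ ≤ D := by
  refine (hD v).trans (mul_le_of_le_one_right (window_const_nonneg hD) (inv_le_one_of_one_le₀ ?_))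
  exact one_le_pow₀ (by linarith [norm_nonneg v])

/-- A bounded displacement costs only a constant in the decay of the window. -/
theorem norm_window_shift_le (hD : ∀ v, ‖η v‖ ≤ D * ((1 + ‖v‖) ^ 2)⁻¹) {W : ℝ}
    {w : EuclideanSpace ℝ (Fin n)} (hw : ‖w‖ ≤ W) (x : EuclideanSpace ℝ (Fin n))
    {z : EuclideanSpace ℝ (Fin n) × ℝ} (hz : z ∈ unitBox n) :
    ‖η (x + z.1 - z.2 • w)‖ ≤ D * (2 + W) ^ 2 * ((1 + ‖x‖) ^ 2)⁻¹ := by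
  refine (hD _).trans ?_
  rw [mul_assoc]
  refine mul_le_mul_of_nonneg_left ?_ (window_const_nonneg hD)
  set v := x + z.1 - z.2 • w with hv
  have hz1 : ‖z.1‖ ≤ 1 := by simpa using hz.1
  have hz2 : ‖z.2 • w‖ ≤ W := by
    rw [norm_smul, Real.norm_eq_abs, abs_of_nonneg hz.2.1]
    exact (mul_le_of_le_one_left (norm_nonneg _) hz.2.2).trans hw
  have h1 : ‖x‖ ≤ ‖v‖ + (1 + W) := by
    have : x = v - (z.1 - z.2 • w) := by rw [hv]; abel
    calc ‖x‖ ≤ ‖v‖ + ‖z.1 - z.2 • w‖ := by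
          conv_lhs => rw [this]
          exact norm_sub_le _ _
      _ ≤ ‖v‖ + (‖z.1‖ + ‖z.2 • w‖) := by gcongr; exact norm_sub_le _ _
      _ ≤ _ := by gcongr
  have hW : 0 ≤ W := (norm_nonneg _).trans hw
  have h2 : 1 + ‖x‖ ≤ (2 + W) * (1 + ‖v‖) := by nlinarith [norm_nonneg v]
  have h3 : 0 < 1 + ‖x‖ := by positivity
  rw [inv_le_iff_one_le_mul₀ (by positivity), mul_comm ((2 + W) ^ 2), mul_assoc, ← mul_pow,
    inv_mul_eq_div, one_le_div (by positivity)]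
  exact pow_le_pow_left₀ h3.le h2 2

theorem norm_packetKernel_le (hD : ∀ v, ‖η v‖ ≤ D * ((1 + ‖v‖) ^ 2)⁻¹) (hN : 0 ≤ N) {W : ℝ}
    {w : EuclideanSpace ℝ (Fin n)} (hw : ‖w‖ ≤ W) (s : ℝ)
    {z : EuclideanSpace ℝ (Fin n) × ℝ} (hz : z ∈ unitBox n) :
    ‖packetKernel γ e η N lam w s z‖ ≤ D * (2 + W) ^ 2 * ((1 + N * ‖γ s - w‖) ^ 2)⁻¹ := by
  rw [norm_packetKernel]
  have := norm_window_shift_le hD hw (N • (γ s - w)) hz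
  rwa [norm_smul, Real.norm_of_nonneg hN] at this

theorem norm_integral_packetKernel_le (hD : ∀ v, ‖η v‖ ≤ D * ((1 + ‖v‖) ^ 2)⁻¹) (hN : 0 ≤ N)
    {W : ℝ} {w : EuclideanSpace ℝ (Fin n)} (hw : ‖w‖ ≤ W) (s : ℝ) :
    ‖∫ z in unitBox n, packetKernel γ e η N lam w s z‖ ≤
      D * (2 + W) ^ 2 * volume.real (unitBox n) * ((1 + N * ‖γ s - w‖) ^ 2)⁻¹ := by
  have := norm_setIntegral_le_of_norm_le_const (volume_unitBox_ne_top n).lt_top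
    (fun z hz => norm_packetKernel_le (γ := γ) (e := e) (lam := lam) hD hN hw s hz)
  exact this.trans (le_of_eq (by ring))

theorem inv_one_add_sq_le {x y : ℝ} (hxy : |x| ≤ y) : ((1 + y) ^ 2)⁻¹ ≤ (1 + x ^ 2)⁻¹ := by
  have : x ^ 2 ≤ y ^ 2 := sq_le_sq' (abs_le.1 hxy).1 (abs_le.1 hxy).2
  have hy : 0 ≤ y := (abs_nonneg x).trans hxy
  exact inv_anti₀ (by positivity) (by nlinarith)

theorem integrable_inv_one_add_mul_sq {c : ℝ} (hc : c ≠ 0) :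
    Integrable fun u : ℝ => (1 + (c * u) ^ 2)⁻¹ :=
  integrable_inv_one_add_sq.comp_mul_left' hc

/-- The tested kernel is bounded uniformly in `N`, `lam` and bounded `w`: the arc spends a time
`O(1 / N)` at distance `1 / N` from `w`. -/
theorem norm_testedKernel_le {B c α β W Θ : ℝ} (harc : IsConormalArc γ e B c α β)
    (hD : ∀ v, ‖η v‖ ≤ D * ((1 + ‖v‖) ^ 2)⁻¹) {θ : ℝ → ℝ} (hθ : ∀ s, |θ s| ≤ Θ)
    (hθs : ∀ s, s ∉ Icc α β → θ s = 0) (hN : 0 < N) {w : EuclideanSpace ℝ (Fin n)}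
    (hw : ‖w‖ ≤ W) :
    ‖testedKernel γ e η θ N lam w‖ ≤ Θ * (D * (2 + W) ^ 2 * volume.real (unitBox n)) *
      ∫ u : ℝ, (1 + (c / 2 * u) ^ 2)⁻¹ := by
  set D' := D * (2 + W) ^ 2 * volume.real (unitBox n) with hD'
  have hD0 : 0 ≤ D' := by
    have := window_const_nonneg hD
    have hW := (norm_nonneg _).trans hw
    positivity
  have hΘ : 0 ≤ Θ := (abs_nonneg _).trans (hθ 0)
  -- compare `‖γ s - w‖` with `|s - s₀|`, where `γ s₀` is a point of the arc closest to `w`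
  obtain ⟨s₀, hs₀, hmin⟩ := isCompact_Icc.exists_isMinOn (nonempty_Icc.2 harc.lt.le)
    (f := fun s => ‖γ s - w‖) ((harc.continuous_curve.sub continuous_const).norm.continuousOn)
  have hc := harc.expansion_pos
  have hpt : ∀ s, ‖(θ s : ℂ) * ∫ z in unitBox n, packetKernel γ e η N lam w s z‖ ≤
      Θ * D' * (1 + (c / 2 * (N * (s - s₀))) ^ 2)⁻¹ := by
    intro s
    by_cases hs : s ∈ Icc α β
    · rw [norm_mul, Complex.norm_real, Real.norm_eq_abs, mul_assoc]
      refine mul_le_mul (hθ s) ((norm_integral_packetKernel_le hD hN.le hw s).trans ?_)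
        (norm_nonneg _) hΘ
      refine mul_le_mul_of_nonneg_left (inv_one_add_sq_le ?_) hD0
      have h1 : ‖γ s₀ - w‖ ≤ ‖γ s - w‖ := hmin hs
      have h2 := harc.expansion s hs s₀ hs₀
      have h3 : ‖γ s - γ s₀‖ ≤ ‖γ s - w‖ + ‖γ s₀ - w‖ := by
        rw [show γ s - γ s₀ = (γ s - w) - (γ s₀ - w) by abel]
        exact norm_sub_le _ _
      rw [abs_mul, abs_mul, abs_of_pos hN, abs_of_pos (by positivity : 0 < c / 2)]
      nlinarith
    · rw [hθs s hs]
      simp only [Complex.ofReal_zero, zero_mul, norm_zero]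
      positivity
  have hint : Integrable fun s : ℝ => Θ * D' * (1 + (c / 2 * (N * (s - s₀))) ^ 2)⁻¹ :=
    (((integrable_inv_one_add_mul_sq (by positivity : c / 2 ≠ 0)).comp_mul_left'
      hN.ne').comp_sub_right s₀).const_mul _
  have h := norm_integral_le_of_norm_le hint (Filter.Eventually.of_forall hpt)
  rw [integral_const_mul, integral_sub_right_eq_self
    (fun s => (1 + (c / 2 * (N * s)) ^ 2)⁻¹) s₀,
    Measure.integral_comp_mul_left (fun s => (1 + (c / 2 * s) ^ 2)⁻¹) N, abs_of_pos (by positivity),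
    smul_eq_mul] at h
  rw [testedKernel, norm_mul, Complex.norm_real, Real.norm_of_nonneg hN.le]
  calc _ ≤ N * _ := mul_le_mul_of_nonneg_left h hN.le
    _ = _ := by field_simp

variable {ι : Type*} {l : Filter ι} {Ns lams : ι → ℝ}

/-- Away from the arc the tested kernel tends to zero. -/
theorem tendsto_testedKernel_of_notMem {B c α β : ℝ} (harc : IsConormalArc γ e B c α β)
    (hD : ∀ v, ‖η v‖ ≤ D * ((1 + ‖v‖) ^ 2)⁻¹) {θ : ℝ → ℝ} {Θ : ℝ} (hθ : ∀ s, |θ s| ≤ Θ)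
    (hθs : ∀ s, s ∉ Icc α β → θ s = 0) (hN : Filter.Tendsto Ns l Filter.atTop)
    {w : EuclideanSpace ℝ (Fin n)} (hw : w ∉ γ '' Icc α β) :
    Filter.Tendsto (fun i => testedKernel γ e η θ (Ns i) (lams i) w) l (nhds 0) := by
  set D' := D * (2 + ‖w‖) ^ 2 * volume.real (unitBox n) with hD'
  have hD0 : 0 ≤ D' := by
    have := window_const_nonneg hD
    positivity
  have hΘ : 0 ≤ Θ := (abs_nonneg _).trans (hθ 0)
  obtain ⟨s₀, hs₀, hmin⟩ := isCompact_Icc.exists_isMinOn (nonempty_Icc.2 harc.lt.le)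
    (f := fun s => ‖γ s - w‖) ((harc.continuous_curve.sub continuous_const).norm.continuousOn)
  set ρ := ‖γ s₀ - w‖ with hρ
  have hρ0 : 0 < ρ := norm_pos_iff.2 fun h => hw ⟨s₀, hs₀, sub_eq_zero.1 h⟩
  have hbound : ∀ᶠ i in l, ‖testedKernel γ e η θ (Ns i) (lams i) w‖ ≤
      Θ * D' * (ρ ^ 2)⁻¹ * (β - α) * (Ns i)⁻¹ := by
    filter_upwards [hN.eventually_gt_atTop 0] with i hi
    have h0 : ∫ s, (θ s : ℂ) * ∫ z in unitBox n, packetKernel γ e η (Ns i) (lams i) w s z =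
        ∫ s in Icc α β, (θ s : ℂ) * ∫ z in unitBox n,
          packetKernel γ e η (Ns i) (lams i) w s z := by
      refine (setIntegral_eq_integral_of_forall_compl_eq_zero fun s hs => ?_).symm
      rw [hθs s hs]; simp
    have h1 := norm_setIntegral_le_of_norm_le_const (μ := volume) (s := Icc α β)
      (f := fun s => (θ s : ℂ) * ∫ z in unitBox n, packetKernel γ e η (Ns i) (lams i) w s z)
      (C := Θ * (D' * ((Ns i * ρ) ^ 2)⁻¹)) (by simp) (fun s hs => by
        rw [norm_mul, Complex.norm_real, Real.norm_eq_abs]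
        refine mul_le_mul (hθ s) ((norm_integral_packetKernel_le hD hi.le le_rfl s).trans ?_)
          (norm_nonneg _) hΘ
        refine mul_le_mul_of_nonneg_left (inv_anti₀ (by positivity) ?_) hD0
        refine pow_le_pow_left₀ (by positivity) ?_ 2
        have : ρ ≤ ‖γ s - w‖ := hmin hs
        nlinarith)
    rw [testedKernel, norm_mul, Complex.norm_real, Real.norm_of_nonneg hi.le, h0]
    rw [Measure.real, Real.volume_Icc, ENNReal.toReal_ofReal (by linarith [harc.lt])] at h1
    calc _ ≤ Ns i * _ := mul_le_mul_of_nonneg_left h1 hi.le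
      _ = _ := by field_simp
  refine squeeze_zero_norm' hbound ?_
  simpa using (tendsto_inv_atTop_zero.comp hN).const_mul (Θ * D' * (ρ ^ 2)⁻¹ * (β - α))

/-- The substitution `s = σ + u / N`. -/
theorem testedKernel_eq_integral_rescaled (θ : ℝ → ℝ) (hN : 0 < N)
    (w : EuclideanSpace ℝ (Fin n)) (σ : ℝ) :
    testedKernel γ e η θ N lam w = ∫ u : ℝ, (θ (σ + N⁻¹ * u) : ℂ) *
      ∫ z in unitBox n, packetKernel γ e η N lam w (σ + N⁻¹ * u) z := by
  have h := Measure.integral_comp_mul_left (fun s => (θ (σ + s) : ℂ) *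
    ∫ z in unitBox n, packetKernel γ e η N lam w (σ + s) z) N⁻¹
  have h2 := integral_add_left_eq_self (μ := volume) (fun s => (θ s : ℂ) *
    ∫ z in unitBox n, packetKernel γ e η N lam w s z) σ
  rw [h, h2, testedKernel, inv_inv, abs_of_pos hN, Complex.real_smul]

/-- Pointwise in `u`, the rescaled kernel converges: the phase disappears because the arc has
contact of order `n` with its conormal hyperplane and `lam / N ^ n → 0`. -/
theorem tendsto_integral_packetKernel [l.IsCountablyGenerated] {B c α β : ℝ}
    (harc : IsConormalArc γ e B c α β)
    (hη : Continuous η) (hD : ∀ v, ‖η v‖ ≤ D * ((1 + ‖v‖) ^ 2)⁻¹)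
    (hN : Filter.Tendsto Ns l Filter.atTop)
    (hlam : Filter.Tendsto (fun i => lams i / Ns i ^ n) l (nhds 0)) {σ : ℝ} (hσ : σ ∈ Icc α β)
    (u : ℝ) :
    Filter.Tendsto (fun i => ∫ z in unitBox n,
      packetKernel γ e η (Ns i) (lams i) (γ σ) (σ + (Ns i)⁻¹ * u) z) l
      (nhds (∫ z in unitBox n, η (u • deriv γ σ + z.1 - z.2 • γ σ))) := by
  have hinv : Filter.Tendsto (fun i => (Ns i)⁻¹) l (nhds 0) := tendsto_inv_atTop_zero.comp hN
  have hsh : Filter.Tendsto (fun i => σ + (Ns i)⁻¹ * u) l (nhds σ) := by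
    simpa using (hinv.mul_const u).const_add σ
  have hdiff : Filter.Tendsto (fun i => Ns i • (γ (σ + (Ns i)⁻¹ * u) - γ σ)) l
      (nhds (u • deriv γ σ)) := by
    have h1 : HasDerivAt (fun t : ℝ => γ (σ + t * u)) (u • deriv γ σ) 0 := by
      have h2 : HasDerivAt (fun t : ℝ => σ + t * u) u 0 := by
        simpa using ((hasDerivAt_id (0 : ℝ)).mul_const u).const_add σ
      exact HasDerivAt.scomp (g₁ := γ) (0 : ℝ) (by simpa using harc.hasDerivAt σ hσ) h2
    rw [hasDerivAt_iff_tendsto_slope_zero] at h1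
    have h3 : Filter.Tendsto (fun i => (Ns i)⁻¹) l (nhdsWithin 0 {0}ᶜ) :=
      tendsto_nhdsWithin_iff.2 ⟨hinv, by
        filter_upwards [hN.eventually_gt_atTop 0] with i hi
        exact inv_ne_zero hi.ne'⟩
    simpa [Function.comp_def] using h1.comp h3
  refine tendsto_integral_filter_of_dominated_convergence (fun _ => D) ?_ ?_ ?_ ?_
  · exact Filter.Eventually.of_forall fun i => Continuous.aestronglyMeasurable
      (continuous_packetKernel harc.continuous_curve harc.continuous_field hη _ _
        continuous_const continuous_const continuous_id)
  · refine Filter.Eventually.of_forall fun i => Filter.Eventually.of_forall fun z => ?_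
    rw [norm_packetKernel]
    exact norm_window_le hD _
  · exact integrable_const D
  · refine Filter.Eventually.of_forall fun z => ?_
    have hphase : Filter.Tendsto (fun i => -(lams i * (1 + z.2 / Ns i) *
        inner ℝ (γ σ - γ (σ + (Ns i)⁻¹ * u)) (e (σ + (Ns i)⁻¹ * u)))) l (nhds 0) := by
      have hb : Filter.Tendsto (fun i => |lams i / Ns i ^ n| * |1 + z.2 * (Ns i)⁻¹| * (B * |u| ^ n))
          l (nhds 0) := by
        have := (hlam.abs.mul ((hinv.const_mul z.2).const_add 1).abs).mul_const (B * |u| ^ n)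
        simpa using this
      refine squeeze_zero_norm' ?_ hb
      filter_upwards [hN.eventually_gt_atTop 0, hsh.eventually (harc.contact σ hσ)] with i hi hc
      rw [norm_neg, norm_mul, norm_mul, Real.norm_eq_abs, Real.norm_eq_abs, Real.norm_eq_abs]
      have h4 : |σ - (σ + (Ns i)⁻¹ * u)| = (Ns i)⁻¹ * |u| := by
        rw [sub_add_cancel_left, abs_neg, abs_mul, abs_of_pos (inv_pos.2 hi)]
      rw [h4] at hc
      calc _ ≤ |lams i| * |1 + z.2 / Ns i| * (B * ((Ns i)⁻¹ * |u|) ^ n) := by gcongr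
        _ = _ := by
          rw [abs_div, abs_of_pos (by positivity : 0 < Ns i ^ n), mul_pow, inv_pow, div_eq_mul_inv,
            div_eq_mul_inv]
          ring
    have hexp : Filter.Tendsto (fun i => Complex.exp (((-(lams i * (1 + z.2 / Ns i) *
        inner ℝ (γ σ - γ (σ + (Ns i)⁻¹ * u)) (e (σ + (Ns i)⁻¹ * u))) : ℝ) : ℂ) * Complex.I)) l
        (nhds 1) := by
      have hcts : Continuous fun t : ℝ => Complex.exp ((t : ℂ) * Complex.I) := by fun_prop
      have := (hcts.tendsto 0).comp hphase
      simpa [Function.comp_def] using this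
    have harg : Filter.Tendsto (fun i => η (Ns i • (γ (σ + (Ns i)⁻¹ * u) - γ σ) + z.1 - z.2 • γ σ))
        l (nhds (η (u • deriv γ σ + z.1 - z.2 • γ σ))) :=
      (hη.tendsto _).comp ((hdiff.add_const z.1).sub_const _)
    have := hexp.mul harg
    rw [one_mul] at this
    exact this

/-- On the arc the tested kernel converges to the weight times the tangent mass. -/
theorem tendsto_testedKernel_of_mem [l.IsCountablyGenerated] {B c α β : ℝ}
    (harc : IsConormalArc γ e B c α β)
    (hη : Continuous η) (hD : ∀ v, ‖η v‖ ≤ D * ((1 + ‖v‖) ^ 2)⁻¹) {θ : ℝ → ℝ} {Θ : ℝ}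
    (hθc : Continuous θ) (hθ : ∀ s, |θ s| ≤ Θ)
    (hθs : ∀ s, s ∉ Icc α β → θ s = 0) (hN : Filter.Tendsto Ns l Filter.atTop)
    (hlam : Filter.Tendsto (fun i => lams i / Ns i ^ n) l (nhds 0)) {σ : ℝ} (hσ : σ ∈ Icc α β) :
    Filter.Tendsto (fun i => testedKernel γ e η θ (Ns i) (lams i) (γ σ)) l
      (nhds (θ σ * tangentMass γ η σ)) := by
  have hc := harc.expansion_pos
  set D' := D * (2 + ‖γ σ‖) ^ 2 * volume.real (unitBox n) with hD'
  have hD0 : 0 ≤ D' := by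
    have := window_const_nonneg hD
    positivity
  have hΘ : 0 ≤ Θ := (abs_nonneg _).trans (hθ 0)
  have hinv : Filter.Tendsto (fun i => (Ns i)⁻¹) l (nhds 0) := tendsto_inv_atTop_zero.comp hN
  have hev : (fun i => ∫ u : ℝ, (θ (σ + (Ns i)⁻¹ * u) : ℂ) *
      ∫ z in unitBox n, packetKernel γ e η (Ns i) (lams i) (γ σ) (σ + (Ns i)⁻¹ * u) z) =ᶠ[l]
      (fun i => testedKernel γ e η θ (Ns i) (lams i) (γ σ)) := by
    filter_upwards [hN.eventually_gt_atTop 0] with i hi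
    exact (testedKernel_eq_integral_rescaled θ hi _ σ).symm
  refine Filter.Tendsto.congr' hev ?_
  rw [tangentMass, ← integral_const_mul]
  refine tendsto_integral_filter_of_dominated_convergence
    (fun u => Θ * (D' * (1 + (c * u) ^ 2)⁻¹)) ?_ ?_ ?_ ?_
  · refine Filter.Eventually.of_forall fun i => Continuous.aestronglyMeasurable ?_
    refine Continuous.mul (by fun_prop) ?_
    exact continuous_parametric_integral_of_continuous
      (f := fun (u : ℝ) z => packetKernel γ e η (Ns i) (lams i) (γ σ) (σ + (Ns i)⁻¹ * u) z)
      (continuous_packetKernel harc.continuous_curve harc.continuous_field hη _ _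
        continuous_const (by fun_prop) continuous_snd)
      (isCompact_unitBox n)
  · filter_upwards [hN.eventually_gt_atTop 0] with i hi
    refine Filter.Eventually.of_forall fun u => ?_
    by_cases hs : σ + (Ns i)⁻¹ * u ∈ Icc α β
    · rw [norm_mul, Complex.norm_real, Real.norm_eq_abs]
      refine mul_le_mul (hθ _) ((norm_integral_packetKernel_le hD hi.le le_rfl _).trans ?_)
        (norm_nonneg _) hΘ
      refine mul_le_mul_of_nonneg_left (inv_one_add_sq_le ?_) hD0
      have h := harc.expansion _ hs σ hσ
      rw [add_sub_cancel_left, abs_mul, abs_of_pos (inv_pos.2 hi)] at h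
      rw [abs_mul, abs_of_pos hc]
      calc c * |u| = Ns i * (c * ((Ns i)⁻¹ * |u|)) := by field_simp
        _ ≤ _ := mul_le_mul_of_nonneg_left h hi.le
    · rw [hθs _ hs]
      simp only [Complex.ofReal_zero, zero_mul, norm_zero]
      positivity
  · exact ((integrable_inv_one_add_mul_sq hc.ne').const_mul _).const_mul _
  · refine Filter.Eventually.of_forall fun u => ?_
    refine Filter.Tendsto.mul ?_
      (tendsto_integral_packetKernel harc hη hD hN hlam hσ u)
    have : Filter.Tendsto (fun i => σ + (Ns i)⁻¹ * u) l (nhds σ) := by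
      simpa using (hinv.mul_const u).const_add σ
    exact ((Complex.continuous_ofReal.comp hθc).tendsto σ).comp this

theorem IsConormalArc.le_norm_deriv {B c α β : ℝ} (harc : IsConormalArc γ e B c α β) {σ : ℝ}
    (hσ : σ ∈ Icc α β) : c ≤ ‖deriv γ σ‖ := by
  have h1 := hasDerivWithinAt_iff_tendsto_slope.1
    ((harc.hasDerivAt σ hσ).hasDerivWithinAt (s := Icc α β))
  have hne : (nhdsWithin σ (Icc α β \ {σ})).NeBot := by
    have := uniqueDiffWithinAt_iff_accPt.1 (uniqueDiffOn_Icc harc.lt σ hσ)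
    rwa [accPt_principal_iff_nhdsWithin] at this
  refine ge_of_tendsto h1.norm ?_
  filter_upwards [self_mem_nhdsWithin] with s hs
  have h2 := harc.expansion s hs.1 σ hσ
  have h3 : 0 < |s - σ| := abs_pos.2 (sub_ne_zero.2 hs.2)
  rw [slope_def_module, norm_smul, norm_inv, Real.norm_eq_abs, inv_mul_eq_div, le_div_iff₀ h3]
  exact h2

/-- For a non-negative window that does not vanish at the origin, the tangent mass is positive. -/
theorem exists_pos_tangentMass {B c α β : ℝ} (harc : IsConormalArc γ e B c α β)
    (hD : ∀ v, ‖η v‖ ≤ D * ((1 + ‖v‖) ^ 2)⁻¹)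
    {f : EuclideanSpace ℝ (Fin n) → ℝ} (hf : Continuous f) (hf0 : ∀ x, 0 ≤ f x)
    (hf1 : f 0 ≠ 0) (hηf : ∀ x, η x = (f x : ℂ)) {σ : ℝ} (hσ : σ ∈ Icc α β) :
    ∃ κ : ℝ, 0 < κ ∧ tangentMass γ η σ = κ := by
  have hc := harc.expansion_pos
  set h : ℝ → ℝ := fun u => ∫ z in unitBox n, f (u • deriv γ σ + z.1 - z.2 • γ σ) with hh
  have hhη : ∀ u, ∫ z in unitBox n, η (u • deriv γ σ + z.1 - z.2 • γ σ) = (h u : ℂ) := fun u => by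
    simp only [hηf, hh]
    exact integral_complex_ofReal
  have hcont : Continuous h := continuous_parametric_integral_of_continuous
    (f := fun (u : ℝ) (z : EuclideanSpace ℝ (Fin n) × ℝ) => f (u • deriv γ σ + z.1 - z.2 • γ σ))
    (by fun_prop) (isCompact_unitBox n)
  have hnn : ∀ u, 0 ≤ h u := fun u => integral_nonneg fun z => hf0 _
  have hint : Integrable h := by
    refine ((integrable_inv_one_add_mul_sq hc.ne').const_mul
      (D * (2 + ‖γ σ‖) ^ 2 * volume.real (unitBox n))).mono' hcont.aestronglyMeasurable
      (Filter.Eventually.of_forall fun u => ?_)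
    have h1 := norm_setIntegral_le_of_norm_le_const (volume_unitBox_ne_top n).lt_top
      (fun z hz => norm_window_shift_le hD le_rfl (w := γ σ) (u • deriv γ σ) hz)
    rw [hhη, Complex.norm_real] at h1
    refine h1.trans ?_
    have h2 : ((1 + ‖u • deriv γ σ‖) ^ 2)⁻¹ ≤ (1 + (c * u) ^ 2)⁻¹ := by
      refine inv_one_add_sq_le ?_
      rw [norm_smul, abs_mul, abs_of_pos hc, mul_comm, Real.norm_eq_abs]
      exact mul_le_mul_of_nonneg_left (harc.le_norm_deriv hσ) (abs_nonneg _)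
    have h3 := window_const_nonneg hD
    calc _ = (D * (2 + ‖γ σ‖) ^ 2 * volume.real (unitBox n)) *
          ((1 + ‖u • deriv γ σ‖) ^ 2)⁻¹ := by ring
      _ ≤ _ := mul_le_mul_of_nonneg_left h2 (by positivity)
  have hpos0 : 0 < h 0 := by
    have hfc : Continuous fun z : EuclideanSpace ℝ (Fin n) × ℝ =>
        f ((0 : ℝ) • deriv γ σ + z.1 - z.2 • γ σ) := by fun_prop
    rw [hh]
    refine (setIntegral_pos_iff_support_of_nonneg_ae (Filter.Eventually.of_forall fun z => hf0 _)
      (hfc.continuousOn.integrableOn_compact (isCompact_unitBox n))).2 ?_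
    refine lt_of_lt_of_le (IsOpen.measure_pos volume
      ((hfc.isOpen_support).inter ((Metric.isOpen_ball (x := (0 : EuclideanSpace ℝ (Fin n)))
        (ε := 1)).prod (isOpen_Ioo (a := (0 : ℝ)) (b := 1)))) ?_)
      (measure_mono (inter_subset_inter_right _
        (prod_mono Metric.ball_subset_closedBall Ioo_subset_Icc_self)))
    have ht : 0 < (2 + ‖γ σ‖)⁻¹ := by positivity
    -- an interior point `(y, τ)` of the region with `y = τ • γ σ`, where the window is evaluated at `0`
    refine ⟨((2 + ‖γ σ‖)⁻¹ • γ σ, (2 + ‖γ σ‖)⁻¹), ?_, ?_, ht, ?_⟩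
    · simpa [Function.mem_support] using hf1
    · rw [mem_ball_zero_iff, norm_smul, Real.norm_of_nonneg ht.le, inv_mul_eq_div,
        div_lt_one (by positivity)]
      linarith
    · exact inv_lt_one_of_one_lt₀ (by linarith [norm_nonneg (γ σ)])
  refine ⟨∫ u, h u, ?_, ?_⟩
  · refine (integral_pos_iff_support_of_nonneg hnn hint).2 ?_
    exact IsOpen.measure_pos volume hcont.isOpen_support ⟨0, hpos0.ne'⟩
  · rw [tangentMass]
    simp only [hhη]
    exact integral_complex_ofReal

end

/-! ### Images of densities on the curve -/

/-- The image under `γ` of the measure with density `max φ 0` on the line. The signed measure with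
density `φ` is represented by the pair `curveMeasure γ φ`, `curveMeasure γ (-φ)`. -/
noncomputable def curveMeasure {n : ℕ} (γ : ℝ → EuclideanSpace ℝ (Fin n)) (φ : ℝ → ℝ) :
    Measure (EuclideanSpace ℝ (Fin n)) :=
  (volume.withDensity fun s => ENNReal.ofReal (φ s)).map γ

section

variable {n : ℕ} {γ : ℝ → EuclideanSpace ℝ (Fin n)} {φ χ : ℝ → ℝ}

theorem isFiniteMeasure_curveMeasure (hφ : Continuous φ)
    (hφs : HasCompactSupport φ) : IsFiniteMeasure (curveMeasure γ φ) := by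
  have h : IsFiniteMeasure (volume.withDensity fun s => ENNReal.ofReal (φ s)) :=
    isFiniteMeasure_withDensity_ofReal (hφ.integrable_of_hasCompactSupport hφs).2
  unfold curveMeasure
  infer_instance

theorem integral_curveMeasure {F : Type*} [NormedAddCommGroup F] [NormedSpace ℝ F]
    (hγ : Continuous γ) (hφ : Continuous φ)
    {f : EuclideanSpace ℝ (Fin n) → F} (hf : StronglyMeasurable f) :
    ∫ w, f w ∂(curveMeasure γ φ) = ∫ s, max (φ s) 0 • f (γ s) := by
  rw [curveMeasure, integral_map hγ.aemeasurable hf.aestronglyMeasurable,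
    integral_withDensity_eq_integral_toReal_smul (by fun_prop)
      (Filter.Eventually.of_forall fun s => ENNReal.ofReal_lt_top)]
  simp [ENNReal.toReal_ofReal']

/-- Integrating against the signed density `χ` is the difference of the integrals against the
images of its positive and negative part. -/
theorem integral_curveMeasure_sub {F : Type*} [NormedAddCommGroup F] [NormedSpace ℝ F]
    (hγ : Continuous γ) (hχ : Continuous χ) (hχs : HasCompactSupport χ)
    {f : EuclideanSpace ℝ (Fin n) → F} (hf : StronglyMeasurable f) {C : ℝ}
    (hC : ∀ s, χ s ≠ 0 → ‖f (γ s)‖ ≤ C) :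
    ∫ w, f w ∂(curveMeasure γ χ) - ∫ w, f w ∂(curveMeasure γ (-χ)) = ∫ s, χ s • f (γ s) := by
  have hint : ∀ φ : ℝ → ℝ, Continuous φ → HasCompactSupport φ → (∀ s, φ s ≠ 0 → χ s ≠ 0) →
      Integrable fun s => max (φ s) 0 • f (γ s) := by
    intro φ hφ hφs hne
    refine ((hφ.integrable_of_hasCompactSupport hφs).norm.const_mul C).mono'
      ((hφ.max continuous_const).aestronglyMeasurable.smul
        (hf.comp_measurable hγ.measurable).aestronglyMeasurable)
      (Filter.Eventually.of_forall fun s => ?_)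
    rw [norm_smul, mul_comm]
    by_cases hs : φ s = 0
    · simp [hs]
    · refine mul_le_mul (hC s (hne s hs)) ?_ (norm_nonneg _)
        ((norm_nonneg _).trans (hC s (hne s hs)))
      rw [Real.norm_eq_abs, Real.norm_eq_abs, abs_of_nonneg (le_max_right _ _)]
      exact max_le (le_abs_self _) (abs_nonneg _)
  rw [integral_curveMeasure hγ hχ hf, integral_curveMeasure hγ hχ.neg hf,
    ← integral_sub (hint χ hχ hχs fun _ h => h)
      (hint (-χ) hχ.neg (by simpa using hχs.neg) fun s h => by simpa using h)]
  refine integral_congr_ae (Filter.Eventually.of_forall fun s => ?_)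
  simp only [Pi.neg_apply]
  rw [← sub_smul]
  congr 1
  rcases le_total 0 (χ s) with h | h
  · rw [max_eq_left h, max_eq_right (by linarith)]; ring
  · rw [max_eq_right h, max_eq_left (by linarith)]; ring

theorem curvePairing_eq_zero_of_curveMeasure_eq (hγ : Continuous γ) (hχ : Continuous χ)
    (hχs : HasCompactSupport χ) (h : curveMeasure γ χ = curveMeasure γ (-χ))
    {g : EuclideanSpace ℝ (Fin n) → ℂ} (hg : Continuous g) : curvePairing γ χ 1 g = 0 := by
  obtain ⟨C, hC⟩ := hχs.isCompact.exists_bound_of_continuousOn (hg.comp hγ).continuousOn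
  have h1 := integral_curveMeasure_sub hγ hχ hχs hg.stronglyMeasurable
    (fun s hs => hC s (subset_tsupport _ hs))
  rw [h, sub_self] at h1
  simp only [curvePairing, one_smul]
  rw [h1]
  refine integral_congr_ae (Filter.Eventually.of_forall fun s => ?_)
  simp only [Complex.real_smul]
  ring

/-- A positive weight does not destroy the signed measure carried by the curve. -/
theorem curveMeasure_eq_of_weighted_integral_eq_zero (hγ : Continuous γ) (hχ : Continuous χ)
    (hχs : HasCompactSupport χ) {M : EuclideanSpace ℝ (Fin n) → ℝ} (hM : Measurable M) {C : ℝ}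
    (hMC : ∀ s, χ s ≠ 0 → |M (γ s)| ≤ C) (hM0 : ∀ s, χ s ≠ 0 → 0 < M (γ s))
    (h : ∀ g : BoundedContinuousFunction (EuclideanSpace ℝ (Fin n)) ℝ,
      ∫ s, χ s * (g (γ s) * M (γ s)) = 0) :
    curveMeasure γ χ = curveMeasure γ (-χ) := by
  have hχn : HasCompactSupport (-χ) := by simpa using hχs.neg
  have hPf : IsFiniteMeasure (curveMeasure γ χ) := isFiniteMeasure_curveMeasure hχ hχs
  have hQf : IsFiniteMeasure (curveMeasure γ (-χ)) := isFiniteMeasure_curveMeasure hχ.neg hχn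
  -- almost every point of either image measure is `γ s` with `χ s ≠ 0`
  have hae : ∀ φ : ℝ → ℝ, Continuous φ → (∀ s, φ s ≠ 0 → χ s ≠ 0) →
      ∀ p : EuclideanSpace ℝ (Fin n) → Prop, MeasurableSet {w | p w} →
      (∀ s, χ s ≠ 0 → p (γ s)) → ∀ᵐ w ∂(curveMeasure γ φ), p w := by
    intro φ hφ hne p hp hps
    rw [curveMeasure, ae_map_iff hγ.aemeasurable hp, ae_withDensity_iff (by fun_prop)]
    refine Filter.Eventually.of_forall fun s hs => hps s (hne s fun h0 => hs ?_)
    simp [h0]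
  have hpm : MeasurableSet {w | 0 < M w ∧ M w ≤ C} :=
    (measurableSet_lt measurable_const hM).inter (measurableSet_le hM measurable_const)
  have hgood : ∀ φ : ℝ → ℝ, Continuous φ → (∀ s, φ s ≠ 0 → χ s ≠ 0) →
      ∀ᵐ w ∂(curveMeasure γ φ), 0 < M w ∧ M w ≤ C := fun φ hφ hne =>
    hae φ hφ hne _ hpm fun s hs => ⟨hM0 s hs, (le_abs_self _).trans (hMC s hs)⟩
  have hP := hgood χ hχ fun _ hs => hs
  have hQ := hgood (-χ) hχ.neg fun s hs => by simpa using hs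
  have hMe : Measurable fun w => ENNReal.ofReal (M w) := hM.ennreal_ofReal
  have hfin : ∀ μ : Measure (EuclideanSpace ℝ (Fin n)), IsFiniteMeasure μ →
      (∀ᵐ w ∂μ, 0 < M w ∧ M w ≤ C) →
      IsFiniteMeasure (μ.withDensity fun w => ENNReal.ofReal (M w)) := by
    intro μ _ hμ
    refine isFiniteMeasure_withDensity ?_
    refine ne_top_of_le_ne_top ?_ (lintegral_mono_ae (g := fun _ => ENNReal.ofReal C) ?_)
    · rw [lintegral_const]
      exact ENNReal.mul_ne_top ENNReal.ofReal_ne_top (measure_ne_top _ _)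
    · filter_upwards [hμ] with w hw using ENNReal.ofReal_le_ofReal hw.2
  have e1 := hfin _ hPf hP
  have e2 := hfin _ hQf hQ
  have heq : (curveMeasure γ χ).withDensity (fun w => ENNReal.ofReal (M w)) =
      (curveMeasure γ (-χ)).withDensity (fun w => ENNReal.ofReal (M w)) := by
    refine ext_of_forall_integral_eq_of_IsFiniteMeasure fun g => ?_
    rw [integral_withDensity_eq_integral_toReal_smul hMe
        (Filter.Eventually.of_forall fun _ => ENNReal.ofReal_lt_top),
      integral_withDensity_eq_integral_toReal_smul hMe
        (Filter.Eventually.of_forall fun _ => ENNReal.ofReal_lt_top), ← sub_eq_zero]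
    have hsm : StronglyMeasurable fun w => (ENNReal.ofReal (M w)).toReal • g w :=
      (hMe.ennreal_toReal.mul g.continuous.measurable).stronglyMeasurable
    rw [integral_curveMeasure_sub hγ hχ hχs hsm (C := C * ‖g‖)]
    · rw [← h g]
      refine integral_congr_ae (Filter.Eventually.of_forall fun s => ?_)
      by_cases hs : χ s = 0
      · simp [hs]
      · simp only [smul_eq_mul]
        rw [ENNReal.toReal_ofReal (hM0 s hs).le]
        ring
    · intro s hs
      rw [ENNReal.toReal_ofReal (hM0 s hs).le, norm_smul, Real.norm_eq_abs]
      exact mul_le_mul (hMC s hs) (g.norm_coe_le_norm _) (norm_nonneg _)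
        ((abs_nonneg _).trans (hMC s hs))
  rw [← withDensity_inv_same hMe (hP.mono fun w hw => by simpa using hw.1)
      (Filter.Eventually.of_forall fun _ => ENNReal.ofReal_ne_top), heq,
    withDensity_inv_same hMe (hQ.mono fun w hw => by simpa using hw.1)
      (Filter.Eventually.of_forall fun _ => ENNReal.ofReal_ne_top)]

end

/-! ### A weight that detects the measure on the curve -/

/-- Every interior parameter of the curve is the centre of a conormal arc. -/
theorem exists_isConormalArc {n : ℕ} {a b B c r : ℝ} {γ e : ℝ → EuclideanSpace ℝ (Fin n)}
    (hγc : Continuous γ) (hγ : IsNondegenerateCurve a b γ) (he : Continuous e)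
    (he1 : ∀ s, ‖e s‖ = 1) (hB : 0 ≤ B)
    (hcon : ∀ s ∈ Icc a b, ∀ σ ∈ Icc a b, |inner ℝ (γ σ - γ s) (e s)| ≤ B * |σ - s| ^ n)
    (hc : 0 < c) (hr : 0 < r)
    (hexp : ∀ s ∈ Icc a b, ∀ s' ∈ Icc a b, |s - s'| ≤ r → c * |s - s'| ≤ ‖γ s - γ s'‖)
    {s₀ : ℝ} (hs₀ : s₀ ∈ Ioo a b) :
    ∃ ρ, 0 < ρ ∧ IsConormalArc γ e B c (s₀ - ρ) (s₀ + ρ) := by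
  set ρ := min (r / 2) (min ((s₀ - a) / 2) ((b - s₀) / 2)) with hρ
  have h1 : ρ ≤ r / 2 := min_le_left _ _
  have h2 : ρ ≤ (s₀ - a) / 2 := (min_le_right _ _).trans (min_le_left _ _)
  have h3 : ρ ≤ (b - s₀) / 2 := (min_le_right _ _).trans (min_le_right _ _)
  have hρ0 : 0 < ρ := by
    have := hs₀.1
    have := hs₀.2
    refine lt_min (by linarith) (lt_min (by linarith) (by linarith))
  have hsub : Icc (s₀ - ρ) (s₀ + ρ) ⊆ Ioo a b := fun s hs =>
    ⟨by linarith [hs.1, hs₀.1], by linarith [hs.2, hs₀.2]⟩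
  refine ⟨ρ, hρ0, hγc, he, he1, by linarith, hc, fun s hs s' hs' => ?_, fun σ hσ =>
    exists_hasDerivAt_of_isNondegenerateCurve hγ (hsub hσ), hB, fun σ hσ => ?_⟩
  · refine hexp s (Ioo_subset_Icc_self (hsub hs)) s' (Ioo_subset_Icc_self (hsub hs')) ?_
    rw [abs_le]
    constructor <;> linarith [hs.1, hs.2, hs'.1, hs'.2]
  · filter_upwards [Icc_mem_nhds (hsub hσ).1 (hsub hσ).2] with s hs
    exact hcon s hs σ (Ioo_subset_Icc_self (hsub hσ))

open Classical in
/-- The limit density on the arc `γ '' [α, β]` of the kernels tested against the weight `ρ`: it is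
`ρ σ` times the tangent mass at the unique parameter `σ` of a point of the arc, and `0` off the
arc. -/
noncomputable def arcDensity {n : ℕ} (γ : ℝ → EuclideanSpace ℝ (Fin n))
    (η : EuclideanSpace ℝ (Fin n) → ℂ) (ρ : ℝ → ℝ) (α β : ℝ) (w : EuclideanSpace ℝ (Fin n)) : ℝ :=
  if h : w ∈ γ '' Icc α β then ρ h.choose * (tangentMass γ η h.choose).re else 0

/-- The tent function of height and radius `r` centred at `s₀`. -/
noncomputable def tent (s₀ r s : ℝ) : ℝ := max 0 (r - |s - s₀|)

theorem continuous_tent (s₀ r : ℝ) : Continuous (tent s₀ r) := by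
  unfold tent
  fun_prop

theorem tent_nonneg (s₀ r s : ℝ) : 0 ≤ tent s₀ r s := le_max_left _ _

theorem tent_le {r : ℝ} (hr : 0 ≤ r) (s₀ s : ℝ) : tent s₀ r s ≤ r :=
  max_le hr (by linarith [abs_nonneg (s - s₀)])

theorem tent_eq_zero {s₀ r s : ℝ} (hs : s ∉ Icc (s₀ - r) (s₀ + r)) : tent s₀ r s = 0 := by
  refine max_eq_left ?_
  by_contra! h
  refine hs ⟨?_, ?_⟩ <;> linarith [neg_abs_le (s - s₀), le_abs_self (s - s₀)]

theorem tent_pos {s₀ r s : ℝ} (hs : |s - s₀| < r) : 0 < tent s₀ r s :=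
  lt_max_of_lt_right (by linarith)

section

variable {n : ℕ} {γ e : ℝ → EuclideanSpace ℝ (Fin n)} {η : EuclideanSpace ℝ (Fin n) → ℂ}
  {D B c α β : ℝ}

theorem IsConormalArc.injOn (harc : IsConormalArc γ e B c α β) : InjOn γ (Icc α β) := by
  intro s hs s' hs' h
  have h1 := harc.expansion s hs s' hs'
  rw [h, sub_self, norm_zero] at h1
  have h2 : |s - s'| ≤ 0 := by
    by_contra! h3
    linarith [mul_pos harc.expansion_pos h3]
  exact sub_eq_zero.1 (abs_nonpos_iff.1 h2)

theorem arcDensity_apply (harc : IsConormalArc γ e B c α β) (ρ : ℝ → ℝ) {σ : ℝ}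
    (hσ : σ ∈ Icc α β) : arcDensity γ η ρ α β (γ σ) = ρ σ * (tangentMass γ η σ).re := by
  have h : γ σ ∈ γ '' Icc α β := mem_image_of_mem γ hσ
  have h2 : h.choose = σ := harc.injOn h.choose_spec.1 hσ h.choose_spec.2
  rw [arcDensity, dif_pos h, h2]

theorem continuous_testedKernel (harc : IsConormalArc γ e B c α β) (hη : Continuous η)
    {θ : ℝ → ℝ} (hθc : Continuous θ) (hθs : ∀ s, s ∉ Icc α β → θ s = 0) (N lam : ℝ) :
    Continuous (testedKernel γ e η θ N lam) := by
  have h0 : testedKernel γ e η θ N lam = fun w => N * ∫ s in Icc α β, (θ s : ℂ) *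
      ∫ z in unitBox n, packetKernel γ e η N lam w s z := by
    funext w
    rw [testedKernel, setIntegral_eq_integral_of_forall_compl_eq_zero fun s hs => ?_]
    rw [hθs s hs]; simp
  rw [h0]
  refine continuous_const.mul (continuous_parametric_integral_of_continuous
    (f := fun w s => (θ s : ℂ) * ∫ z in unitBox n, packetKernel γ e η N lam w s z) ?_
    isCompact_Icc)
  refine Continuous.mul (Complex.continuous_ofReal.comp (hθc.comp continuous_snd)) ?_
  exact continuous_parametric_integral_of_continuous
    (f := fun (q : EuclideanSpace ℝ (Fin n) × ℝ) z => packetKernel γ e η N lam q.1 q.2 z)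
    (continuous_packetKernel harc.continuous_curve harc.continuous_field hη _ _
      (continuous_fst.comp continuous_fst) (continuous_snd.comp continuous_fst) continuous_snd)
    (isCompact_unitBox n)

variable {ι : Type*} {l : Filter ι} [l.IsCountablyGenerated] {Ns lams : ι → ℝ}

/-- The limit of the tested kernels at an arbitrary point `w`, for a weight `g ∘ γ * ρ` with `ρ`
supported on the arc: the function `g` factors out because the limit sees only the parameter at
which the arc passes through `w`. -/
theorem tendsto_testedKernel (harc : IsConormalArc γ e B c α β)
    (hη : Continuous η) (hD : ∀ v, ‖η v‖ ≤ D * ((1 + ‖v‖) ^ 2)⁻¹)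
    {f : EuclideanSpace ℝ (Fin n) → ℝ} (hf : Continuous f) (hf0 : ∀ x, 0 ≤ f x)
    (hf1 : f 0 ≠ 0) (hηf : ∀ x, η x = (f x : ℂ))
    (hN : Filter.Tendsto Ns l Filter.atTop)
    (hlam : Filter.Tendsto (fun i => lams i / Ns i ^ n) l (nhds 0))
    {g : EuclideanSpace ℝ (Fin n) → ℝ} (hg : Continuous g) {ρ : ℝ → ℝ} (hρ : Continuous ρ)
    (hρs : ∀ s, s ∉ Icc α β → ρ s = 0) {Θ : ℝ} (hΘ : ∀ s, |g (γ s) * ρ s| ≤ Θ)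
    (w : EuclideanSpace ℝ (Fin n)) :
    Filter.Tendsto (fun i => testedKernel γ e η (fun s => g (γ s) * ρ s) (Ns i) (lams i) w) l
      (nhds ((g w * arcDensity γ η ρ α β w : ℝ) : ℂ)) := by
  by_cases hw : w ∈ γ '' Icc α β
  · obtain ⟨σ, hσ, rfl⟩ := hw
    obtain ⟨κ, hκ, hκe⟩ := exists_pos_tangentMass harc hD hf hf0 hf1 hηf hσ
    have h := tendsto_testedKernel_of_mem harc hη hD (θ := fun s => g (γ s) * ρ s)
      ((hg.comp harc.continuous_curve).mul hρ) hΘ (fun s hs => by rw [hρs s hs, mul_zero]) hN hlam hσ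
    rw [arcDensity_apply harc ρ hσ, hκe, Complex.ofReal_re]
    rw [hκe] at h
    convert h using 2
    push_cast
    ring
  · rw [arcDensity, dif_neg hw, mul_zero, Complex.ofReal_zero]
    exact tendsto_testedKernel_of_notMem harc hD hΘ (fun s hs => by rw [hρs s hs, mul_zero]) hN hw

/-- If the measure carried by a non-degenerate curve is not zero, then some short arc and some
weight supported in it detect it: the tested kernels, integrated against `χ`, do not tend to zero.
Otherwise the signed measure, multiplied by the positive sum of the limit densities of finitely many
arcs covering the support of `χ`, would vanish. -/
theorem exists_arc_tendsto_ne_zero [l.NeBot] (hn : 2 ≤ n) {a b : ℝ} (hab : a < b)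
    (hγc : Continuous γ) (hγ : IsNondegenerateCurve a b γ)
    {χ : ℝ → ℝ} (hχ : IsCurveCutoff a b γ χ)
    (hη : Continuous η) (hD : ∀ v, ‖η v‖ ≤ D * ((1 + ‖v‖) ^ 2)⁻¹)
    {f : EuclideanSpace ℝ (Fin n) → ℝ} (hf : Continuous f) (hf0 : ∀ x, 0 ≤ f x)
    (hf1 : f 0 ≠ 0) (hηf : ∀ x, η x = (f x : ℂ))
    (hN : Filter.Tendsto Ns l Filter.atTop)
    (hlam : Filter.Tendsto (fun i => lams i / Ns i ^ n) l (nhds 0)) :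
    ∃ (e : ℝ → EuclideanSpace ℝ (Fin n)) (B c α β : ℝ) (θ : ℝ → ℝ) (Θ : ℝ) (L : ℂ),
      IsConormalArc γ e B c α β ∧ Continuous θ ∧ (∀ s, |θ s| ≤ Θ) ∧
      (∀ s, s ∉ Icc α β → θ s = 0) ∧ L ≠ 0 ∧
      Filter.Tendsto (fun i => ∫ s, (χ s : ℂ) * testedKernel γ e η θ (Ns i) (lams i) (γ s)) l
        (nhds L) := by
  obtain ⟨e, B, he, he1, hB, hcon⟩ := exists_conormal hn hab hγ
  obtain ⟨c, r, hc, hr, hexp⟩ := exists_local_expansion hn hab hγ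
  have hsupp : tsupport χ ⊆ Ioo a b := by simpa [interior_Icc] using hχ.support
  have hχc := hχ.smooth.continuous
  have hχs : HasCompactSupport χ :=
    isCompact_Icc.of_isClosed_subset (isClosed_tsupport χ) (hsupp.trans Ioo_subset_Icc_self)
  choose! ρ hρ0 harc using fun s₀ (hs₀ : s₀ ∈ Ioo a b) =>
    exists_isConormalArc hγc hγ he he1 hB hcon hc hr hexp hs₀
  obtain ⟨t, ht, hcover⟩ := hχs.isCompact.elim_nhds_subcover (fun s₀ => Metric.ball s₀ (ρ s₀))
    fun s₀ hs₀ => Metric.ball_mem_nhds _ (hρ0 s₀ (hsupp hs₀))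
  obtain ⟨W, hW⟩ := hχs.isCompact.exists_bound_of_continuousOn hγc.continuousOn
  have hW' : ∀ s, χ s ≠ 0 → ‖γ s‖ ≤ W := fun s hs => hW s (subset_tsupport _ hs)
  have htent : ∀ s₀ ∈ t, ∀ s, |tent s₀ (ρ s₀) s| ≤ ρ s₀ := fun s₀ hs₀ s => by
    rw [abs_of_nonneg (tent_nonneg _ _ _)]
    exact tent_le (hρ0 s₀ (hsupp (ht s₀ hs₀))).le _ _
  set m : ℝ → EuclideanSpace ℝ (Fin n) → ℝ := fun s₀ =>
    arcDensity γ η (tent s₀ (ρ s₀)) (s₀ - ρ s₀) (s₀ + ρ s₀) with hm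
  have hbound : ∀ s₀ ∈ t, ∀ (g : BoundedContinuousFunction (EuclideanSpace ℝ (Fin n)) ℝ) s,
      |g (γ s) * tent s₀ (ρ s₀) s| ≤ ‖g‖ * ρ s₀ := by
    intro s₀ hs₀ g s
    rw [abs_mul]
    exact mul_le_mul (g.norm_coe_le_norm _) (htent s₀ hs₀ s) (abs_nonneg _) (norm_nonneg _)
  have hlim : ∀ s₀ ∈ t, ∀ (g : BoundedContinuousFunction (EuclideanSpace ℝ (Fin n)) ℝ) w,
      Filter.Tendsto (fun i => testedKernel γ e η (fun s => g (γ s) * tent s₀ (ρ s₀) s)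
        (Ns i) (lams i) w) l (nhds ((g w * m s₀ w : ℝ) : ℂ)) := fun s₀ hs₀ g w =>
    tendsto_testedKernel (harc s₀ (hsupp (ht s₀ hs₀))) hη hD hf hf0 hf1 hηf hN hlam g.continuous
      (continuous_tent _ _) (fun s hs => tent_eq_zero hs) (hbound s₀ hs₀ g) w
  have hcont : ∀ s₀ ∈ t, ∀ (g : BoundedContinuousFunction (EuclideanSpace ℝ (Fin n)) ℝ) i,
      Continuous (testedKernel γ e η (fun s => g (γ s) * tent s₀ (ρ s₀) s) (Ns i) (lams i)) :=
    fun s₀ hs₀ g i => continuous_testedKernel (harc s₀ (hsupp (ht s₀ hs₀))) hη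
      ((g.continuous.comp hγc).mul (continuous_tent _ _))
      (fun s hs => by simp [tent_eq_zero hs]) _ _
  have hkb : ∀ s₀ ∈ t, ∀ (g : BoundedContinuousFunction (EuclideanSpace ℝ (Fin n)) ℝ),
      ∃ K, ∀ᶠ i in l, ∀ s, χ s ≠ 0 → ‖testedKernel γ e η (fun s => g (γ s) * tent s₀ (ρ s₀) s)
        (Ns i) (lams i) (γ s)‖ ≤ K := fun s₀ hs₀ g =>
    ⟨_, (hN.eventually_gt_atTop 0).mono fun i hi s hs =>
      norm_testedKernel_le (harc s₀ (hsupp (ht s₀ hs₀))) hD (hbound s₀ hs₀ g)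
        (fun s hs => by simp [tent_eq_zero hs]) hi (hW' s hs)⟩
  have hmlim : ∀ s₀ ∈ t, ∀ w, Filter.Tendsto (fun i => (testedKernel γ e η
      (fun s => (1 : BoundedContinuousFunction (EuclideanSpace ℝ (Fin n)) ℝ) (γ s) *
        tent s₀ (ρ s₀) s) (Ns i) (lams i) w)) l (nhds ((m s₀ w : ℝ) : ℂ)) := fun s₀ hs₀ w => by
    simpa using hlim s₀ hs₀ 1 w
  have hmmeas : ∀ s₀ ∈ t, Measurable (m s₀) := fun s₀ hs₀ => by
    refine measurable_of_tendsto_metrizable' l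
      (fun i => (Complex.continuous_re.comp (hcont s₀ hs₀ 1 i)).measurable)
      (tendsto_pi_nhds.2 fun w => ?_)
    simpa [Function.comp_def] using (Complex.continuous_re.tendsto _).comp (hmlim s₀ hs₀ w)
  have hmb : ∀ s₀ ∈ t, ∃ K, ∀ s, χ s ≠ 0 → |m s₀ (γ s)| ≤ K := fun s₀ hs₀ => by
    obtain ⟨K, hK⟩ := hkb s₀ hs₀ 1
    refine ⟨K, fun s hs => ?_⟩
    have := le_of_tendsto (hmlim s₀ hs₀ (γ s)).norm (hK.mono fun i hi => hi s hs)
    rwa [Complex.norm_real, Real.norm_eq_abs] at this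
  -- passing to the limit under the integral over the curve
  have hint : ∀ s₀ ∈ t, ∀ g : BoundedContinuousFunction (EuclideanSpace ℝ (Fin n)) ℝ,
      Filter.Tendsto (fun i => ∫ s, (χ s : ℂ) * testedKernel γ e η
        (fun s => g (γ s) * tent s₀ (ρ s₀) s) (Ns i) (lams i) (γ s)) l
        (nhds ((∫ s, χ s * (g (γ s) * m s₀ (γ s)) : ℝ) : ℂ)) := by
    intro s₀ hs₀ g
    obtain ⟨K, hK⟩ := hkb s₀ hs₀ g
    rw [← integral_complex_ofReal]
    refine tendsto_integral_filter_of_dominated_convergence (fun s => |χ s| * K) ?_ ?_ ?_ ?_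
    · refine Filter.Eventually.of_forall fun i => Continuous.aestronglyMeasurable ?_
      exact (Complex.continuous_ofReal.comp hχc).mul ((hcont s₀ hs₀ g i).comp hγc)
    · filter_upwards [hK] with i hi
      refine Filter.Eventually.of_forall fun s => ?_
      rw [norm_mul, Complex.norm_real, Real.norm_eq_abs]
      by_cases hs : χ s = 0
      · simp [hs]
      · exact mul_le_mul_of_nonneg_left (hi s hs) (abs_nonneg _)
    · exact (hχc.integrable_of_hasCompactSupport hχs).norm.mul_const K
    · refine Filter.Eventually.of_forall fun s => ?_
      have := (hlim s₀ hs₀ g (γ s)).const_mul (χ s : ℂ)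
      simpa using this
  by_cases hex : ∃ s₀ ∈ t, ∃ g : BoundedContinuousFunction (EuclideanSpace ℝ (Fin n)) ℝ,
      ∫ s, χ s * (g (γ s) * m s₀ (γ s)) ≠ 0
  · obtain ⟨s₀, hs₀, g, hne⟩ := hex
    exact ⟨e, B, c, s₀ - ρ s₀, s₀ + ρ s₀, fun s => g (γ s) * tent s₀ (ρ s₀) s, _, _,
      harc s₀ (hsupp (ht s₀ hs₀)), (g.continuous.comp hγc).mul (continuous_tent _ _),
      hbound s₀ hs₀ g, fun s hs => by simp [tent_eq_zero hs],
      by exact_mod_cast hne, hint s₀ hs₀ g⟩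
  · exfalso
    push Not at hex
    obtain ⟨g₀, hg₀, hg₀'⟩ := hχ.measure_ne_zero
    refine hg₀' (curvePairing_eq_zero_of_curveMeasure_eq hγc hχc hχs ?_ hg₀)
    choose! K hK using hmb
    refine curveMeasure_eq_of_weighted_integral_eq_zero hγc hχc hχs
      (M := fun w => ∑ s₀ ∈ t, m s₀ w) (C := ∑ s₀ ∈ t, K s₀)
      (Finset.measurable_fun_sum t hmmeas) (fun s hs => ?_) (fun s hs => ?_) fun g => ?_
    · exact (Finset.abs_sum_le_sum_abs _ _).trans
        (Finset.sum_le_sum fun s₀ hs₀ => hK s₀ hs₀ s hs)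
    · have hmnn : ∀ s₀ ∈ t, ∀ w, 0 ≤ m s₀ w := fun s₀ hs₀ w => by
        by_cases hw : w ∈ γ '' Icc (s₀ - ρ s₀) (s₀ + ρ s₀)
        · obtain ⟨σ, hσ, rfl⟩ := hw
          obtain ⟨κ, hκ, hκe⟩ := exists_pos_tangentMass (harc s₀ (hsupp (ht s₀ hs₀))) hD hf hf0 hf1
            hηf hσ
          simp only [hm]
          rw [arcDensity_apply (harc s₀ (hsupp (ht s₀ hs₀))) _ hσ, hκe, Complex.ofReal_re]
          exact mul_nonneg (tent_nonneg _ _ _) hκ.le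
        · simp only [hm]
          rw [arcDensity, dif_neg hw]
      obtain ⟨s₀, hs₀, hball⟩ := mem_iUnion₂.1 (hcover (subset_tsupport _ hs))
      rw [Metric.mem_ball, Real.dist_eq] at hball
      refine Finset.sum_pos' (fun s₁ hs₁ => hmnn s₁ hs₁ _) ⟨s₀, hs₀, ?_⟩
      have hσ : s ∈ Icc (s₀ - ρ s₀) (s₀ + ρ s₀) := by
        rw [abs_lt] at hball
        constructor <;> linarith [hball.1, hball.2]
      obtain ⟨κ, hκ, hκe⟩ := exists_pos_tangentMass (harc s₀ (hsupp (ht s₀ hs₀))) hD hf hf0 hf1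
        hηf hσ
      simp only [hm]
      rw [arcDensity_apply (harc s₀ (hsupp (ht s₀ hs₀))) _ hσ, hκe, Complex.ofReal_re]
      exact mul_pos (tent_pos hball) hκ
    · have hi : ∀ s₀ ∈ t, Integrable fun s => χ s * (g (γ s) * m s₀ (γ s)) := fun s₀ hs₀ => by
        refine ((hχc.integrable_of_hasCompactSupport hχs).norm.mul_const (‖g‖ * K s₀)).mono'
          (hχc.aestronglyMeasurable.mul ((g.continuous.comp hγc).aestronglyMeasurable.mul
            ((hmmeas s₀ hs₀).comp hγc.measurable).aestronglyMeasurable))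
          (Filter.Eventually.of_forall fun s => ?_)
        rw [norm_mul, norm_mul]
        by_cases hs : χ s = 0
        · simp [hs]
        · refine mul_le_mul_of_nonneg_left ?_ (norm_nonneg _)
          exact mul_le_mul (g.norm_coe_le_norm _) (hK s₀ hs₀ s hs) (norm_nonneg _) (norm_nonneg _)
      simp only [Finset.mul_sum]
      rw [integral_finsetSum _ hi]
      exact Finset.sum_eq_zero fun s₀ hs₀ => hex s₀ hs₀ g

end

/-! ### Averaging tools -/

/-- A quantitative duality: if `F` correlates with a bounded weight, its `L²` norm is large. -/
theorem le_integral_norm_sq_of_le_norm_integral {Y : Type*} [MeasurableSpace Y] {μ : Measure Y}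
    [IsFiniteMeasure μ] {F : Y → ℂ} {θ : Y → ℂ} {Θ c : ℝ} (hΘ : 0 < Θ) (hc : 0 < c)
    (hθ : ∀ y, ‖θ y‖ ≤ Θ) (hF2 : Integrable (fun y => ‖F y‖ ^ 2) μ)
    (h : c ≤ ‖∫ y, θ y * F y ∂μ‖) :
    c ^ 2 / (Θ ^ 2 * (μ.real univ + 1)) ≤ ∫ y, ‖F y‖ ^ 2 ∂μ := by
  set V := μ.real univ with hV
  have hV0 : 0 ≤ V := measureReal_nonneg
  -- the arithmetic-geometric mean inequality with this `k` loses at most `c / 2`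
  set k := Θ * (V + 1) / c with hk
  have hk0 : 0 < k := by positivity
  have h1 : ∀ y, ‖θ y * F y‖ ≤ Θ * (k / 2 * ‖F y‖ ^ 2 + 1 / (2 * k)) := by
    intro y
    rw [norm_mul]
    refine mul_le_mul (hθ y) ?_ (norm_nonneg _) hΘ.le
    have h2 : 0 ≤ (k * ‖F y‖ - 1) ^ 2 / (2 * k) := by positivity
    have h3 : (k * ‖F y‖ - 1) ^ 2 / (2 * k) = k / 2 * ‖F y‖ ^ 2 + 1 / (2 * k) - ‖F y‖ := by
      field_simp
      ring
    linarith
  have h4 := norm_integral_le_of_norm_le (((hF2.const_mul (k / 2)).add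
    (integrable_const (1 / (2 * k)))).const_mul Θ) (Filter.Eventually.of_forall h1)
  simp only [Pi.add_apply] at h4
  rw [integral_const_mul, integral_add (hF2.const_mul (k / 2)) (integrable_const _),
    integral_const_mul, integral_const, smul_eq_mul, ← hV] at h4
  have h5 := h.trans h4
  set I := ∫ y, ‖F y‖ ^ 2 ∂μ with hI
  have h6 : Θ * (V * (1 / (2 * k))) ≤ c / 2 := by
    have : Θ * (V * (1 / (2 * k))) = c / 2 * (V / (V + 1)) := by
      rw [hk]; field_simp
    rw [this]
    refine mul_le_of_le_one_right (by positivity) ?_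
    rw [div_le_one (by positivity)]
    linarith
  have h7 : c / 2 ≤ Θ * (k / 2 * I) := by linarith
  rw [div_le_iff₀ (by positivity)]
  have h8 : Θ * (k / 2 * I) = Θ ^ 2 * (V + 1) * I / (2 * c) := by
    rw [hk]; field_simp
  rw [h8, le_div_iff₀ (by positivity)] at h7
  nlinarith

/-- Among the translates of a mesh of width `(β - α) / N` there is one on which the Riemann sum
dominates the integral. -/
theorem exists_mesh_integral_le {α β : ℝ} (hαβ : α < β) {G : ℝ → ℝ} (hG : Continuous G) {N : ℕ}
    (hN : 0 < N) :
    ∃ ϑ ∈ Icc (0 : ℝ) 1, ∫ s in Icc α β, G s ≤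
      (β - α) / N * ∑ ν ∈ Finset.range N, G (α + (ν + ϑ) * ((β - α) / N)) := by
  set h := (β - α) / N with hh
  have hN' : (0 : ℝ) < N := by exact_mod_cast hN
  have hh0 : 0 < h := div_pos (by linarith) hN'
  have h1 : ∫ s in Icc α β, G s = ∑ ν ∈ Finset.range N,
      ∫ s in (α + (ν : ℕ) * h)..(α + ((ν + 1 : ℕ) : ℝ) * h), G s := by
    rw [intervalIntegral.sum_integral_adjacent_intervals
      (a := fun ν : ℕ => α + ν * h) (fun k _ => hG.intervalIntegrable _ _),
      integral_Icc_eq_integral_Ioc, ← intervalIntegral.integral_of_le hαβ.le]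
    congr 1
    · simp
    · rw [hh]; field_simp; ring
  have h2 : ∀ ν : ℕ, ∫ s in (α + (ν : ℕ) * h)..(α + ((ν + 1 : ℕ) : ℝ) * h), G s =
      h * ∫ ϑ in (0 : ℝ)..1, G (α + (ν + ϑ) * h) := by
    intro ν
    have := intervalIntegral.integral_comp_mul_add (a := 0) (b := 1) G hh0.ne' (α + ν * h)
    rw [show (fun ϑ : ℝ => G (α + (ν + ϑ) * h)) = fun ϑ => G (h * ϑ + (α + ν * h)) by
      funext ϑ; congr 1; ring, this, smul_eq_mul, ← mul_assoc, mul_inv_cancel₀ hh0.ne', one_mul]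
    congr 1 <;> push_cast <;> ring
  simp only [h2] at h1
  have h3 : ∫ ϑ in (0 : ℝ)..1, ∑ ν ∈ Finset.range N, G (α + (ν + ϑ) * h) =
      ∑ ν ∈ Finset.range N, ∫ ϑ in (0 : ℝ)..1, G (α + (ν + ϑ) * h) :=
    intervalIntegral.integral_finsetSum fun ν _ => (by fun_prop : Continuous fun ϑ : ℝ =>
      G (α + (ν + ϑ) * h)).intervalIntegrable _ _
  rw [← Finset.mul_sum, ← h3] at h1
  have hc : Continuous fun ϑ : ℝ => ∑ ν ∈ Finset.range N, G (α + (ν + ϑ) * h) := by fun_prop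
  obtain ⟨ϑ, hϑ, hmax⟩ := isCompact_Icc.exists_isMaxOn (nonempty_Icc.2 zero_le_one)
    (hc.continuousOn (s := Icc (0 : ℝ) 1))
  refine ⟨ϑ, hϑ, ?_⟩
  rw [h1]
  refine mul_le_mul_of_nonneg_left ?_ hh0.le
  have := intervalIntegral.integral_mono_on (μ := volume) (zero_le_one' ℝ) (hc.intervalIntegrable 0 1)
    (intervalIntegrable_const (c := ∑ ν ∈ Finset.range N, G (α + (ν + ϑ) * h)))
    (fun x hx => hmax hx)
  simpa using this

/-- Signs can be chosen so that the `L²` norm of a signed sum is at least that of an orthogonal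
sum. -/
theorem exists_signs_le_integral_norm_sq {X : Type*} [TopologicalSpace X] [MeasurableSpace X]
    [OpensMeasurableSpace X] [T2Space X] {μ : Measure X} [IsFiniteMeasureOnCompacts μ] {S : Set X}
    (hS : IsCompact S) (F : ℕ → X → ℂ) (hF : ∀ ν, Continuous (F ν)) (N : ℕ) :
    ∃ ε : ℕ → ℂ, (∀ ν, ‖ε ν‖ = 1) ∧ ∑ ν ∈ Finset.range N, ∫ x in S, ‖F ν x‖ ^ 2 ∂μ ≤
      ∫ x in S, ‖∑ ν ∈ Finset.range N, ε ν * F ν x‖ ^ 2 ∂μ := by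
  induction N with
  | zero => exact ⟨fun _ => 1, by simp, by simp⟩
  | succ N ih =>
    obtain ⟨ε, hε, hle⟩ := ih
    set A : X → ℂ := fun x => ∑ ν ∈ Finset.range N, ε ν * F ν x with hA
    have hAc : Continuous A := continuous_finsetSum _ fun ν _ => continuous_const.mul (hF ν)
    have hio : ∀ f : X → ℝ, Continuous f → IntegrableOn f S μ := fun f hf =>
      hf.continuousOn.integrableOn_compact hS
    have hpar : (∫ x in S, ‖A x + F N x‖ ^ 2 ∂μ) + ∫ x in S, ‖A x - F N x‖ ^ 2 ∂μ =
        2 * ((∫ x in S, ‖A x‖ ^ 2 ∂μ) + ∫ x in S, ‖F N x‖ ^ 2 ∂μ) := by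
      rw [← integral_add (hio _ (by fun_prop)) (hio _ (by fun_prop)),
        ← integral_add (hio _ (by fun_prop)) (hio _ (by fun_prop)), ← integral_const_mul]
      refine integral_congr_ae (Filter.Eventually.of_forall fun x => ?_)
      have := parallelogram_law_with_norm ℝ (A x) (F N x)
      simp only [pow_two]
      linarith
    have hext : ∀ δ : ℂ, ‖δ‖ = 1 → (∫ x in S, ‖A x‖ ^ 2 ∂μ) + (∫ x in S, ‖F N x‖ ^ 2 ∂μ) ≤
        ∫ x in S, ‖A x + δ * F N x‖ ^ 2 ∂μ →
        ∃ ε : ℕ → ℂ, (∀ ν, ‖ε ν‖ = 1) ∧ ∑ ν ∈ Finset.range (N + 1), ∫ x in S, ‖F ν x‖ ^ 2 ∂μ ≤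
          ∫ x in S, ‖∑ ν ∈ Finset.range (N + 1), ε ν * F ν x‖ ^ 2 ∂μ := by
      intro δ hδ h
      refine ⟨Function.update ε N δ, fun ν => ?_, ?_⟩
      · by_cases hν : ν = N
        · subst hν; simpa using hδ
        · simpa [Function.update_of_ne hν] using hε ν
      · rw [Finset.sum_range_succ]
        refine (add_le_add hle le_rfl).trans (h.trans (le_of_eq ?_))
        refine integral_congr_ae (Filter.Eventually.of_forall fun x => ?_)
        simp only [Finset.sum_range_succ, Function.update_self, hA]
        congr 3
        refine Finset.sum_congr rfl fun ν hν => ?_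
        rw [Function.update_of_ne (Finset.mem_range.1 hν).ne]
    rcases le_total (∫ x in S, ‖A x - F N x‖ ^ 2 ∂μ) (∫ x in S, ‖A x + F N x‖ ^ 2 ∂μ) with h | h
    · exact hext 1 (by simp) (by simp only [one_mul]; linarith)
    · refine hext (-1) (by simp) ?_
      simp only [neg_mul, one_mul, ← sub_eq_add_neg]
      linarith

/-- The space-time region of side `1 / N` at the focusing point `x = 0`, `t = 1`. -/
def focusBox (n : ℕ) (N : ℝ) : Set (EuclideanSpace ℝ (Fin n) × ℝ) :=
  Metric.closedBall 0 N⁻¹ ×ˢ Icc 1 (1 + N⁻¹)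

theorem isCompact_focusBox (n : ℕ) (N : ℝ) : IsCompact (focusBox n N) :=
  (isCompact_closedBall _ _).prod isCompact_Icc

theorem setIntegral_focusBox {n : ℕ} {N : ℝ} (hN : 0 < N)
    (G : EuclideanSpace ℝ (Fin n) × ℝ → ℝ) :
    ∫ p in focusBox n N, G p =
      (N ^ (n + 1))⁻¹ * ∫ z in unitBox n, G (N⁻¹ • z.1, 1 + z.2 / N) := by
  have hmem : ∀ z : EuclideanSpace ℝ (Fin n) × ℝ,
      N⁻¹ • z + (0, 1) ∈ focusBox n N ↔ z ∈ unitBox n := by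
    intro z
    have hN' : 0 < N⁻¹ := inv_pos.2 hN
    simp only [focusBox, unitBox, mem_prod, mem_closedBall_zero_iff, mem_Icc, Prod.fst_add,
      Prod.snd_add, Prod.smul_fst, Prod.smul_snd, add_zero, norm_smul, smul_eq_mul,
      Real.norm_of_nonneg hN'.le]
    constructor
    · rintro ⟨h1, h2, h3⟩
      refine ⟨?_, ?_, ?_⟩
      · by_contra! h; nlinarith
      · by_contra! h; nlinarith
      · by_contra! h; nlinarith
    · rintro ⟨h1, h2, h3⟩
      refine ⟨?_, ?_, ?_⟩ <;> nlinarith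
  have : (volume : Measure (EuclideanSpace ℝ (Fin n) × ℝ)).IsAddHaarMeasure :=
    inferInstanceAs (Measure.IsAddHaarMeasure (Measure.prod volume volume))
  have h1 := Measure.integral_comp_smul (volume : Measure (EuclideanSpace ℝ (Fin n) × ℝ))
    (fun z => (focusBox n N).indicator G (z + (0, 1))) N⁻¹
  rw [integral_add_right_eq_self (fun z => (focusBox n N).indicator G z) (0, 1),
    integral_indicator (isCompact_focusBox n N).measurableSet] at h1
  have h2 : (fun z : EuclideanSpace ℝ (Fin n) × ℝ =>
      (focusBox n N).indicator G (N⁻¹ • z + (0, 1))) =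
      (unitBox n).indicator fun z => G (N⁻¹ • z.1, 1 + z.2 / N) := by
    funext z
    by_cases hz : z ∈ unitBox n
    · rw [indicator_of_mem hz, indicator_of_mem ((hmem z).2 hz)]
      congr 1
      ext1
      · simp
      · simp only [Prod.snd_add, Prod.smul_snd, smul_eq_mul]; ring
    · rw [indicator_of_notMem hz, indicator_of_notMem fun h => hz ((hmem z).1 h)]
  rw [h2, integral_indicator (isCompact_unitBox n).measurableSet] at h1
  rw [h1, Module.finrank_prod, finrank_euclideanSpace_fin, Module.finrank_self, inv_pow, inv_inv,
    abs_of_pos (by positivity), smul_eq_mul, ← mul_assoc, inv_mul_cancel₀ (by positivity), one_mul]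

theorem volume_focusBox {n : ℕ} {N : ℝ} (hN : 0 < N) :
    volume (focusBox n N) = ENNReal.ofReal ((N ^ (n + 1))⁻¹ * volume.real (unitBox n)) := by
  have h := setIntegral_focusBox (n := n) hN fun _ => 1
  simp only [integral_const, smul_eq_mul, mul_one, measureReal_restrict_apply_univ] at h
  rw [← h, ofReal_measureReal (isCompact_focusBox n N).measure_ne_top]

/-! ### Normalisation -/

theorem curveAverage_sum {n : ℕ} {γ : ℝ → EuclideanSpace ℝ (Fin n)} {χ : ℝ → ℝ}
    (hγ : Continuous γ) (hχ : Continuous χ) (hχs : HasCompactSupport χ) {ι : Type*} (s : Finset ι)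
    (c : ι → ℂ) (f : ι → EuclideanSpace ℝ (Fin n) → ℂ) (hf : ∀ i, Continuous (f i)) (t : ℝ)
    (x : EuclideanSpace ℝ (Fin n)) :
    curveAverage γ χ t (fun y => ∑ i ∈ s, c i * f i y) x =
      ∑ i ∈ s, c i * curveAverage γ χ t (f i) x := by
  simp only [curveAverage, curvePairing]
  simp_rw [← integral_const_mul]
  rw [← integral_finsetSum _ fun i _ => ?_]
  · refine integral_congr_ae (Filter.Eventually.of_forall fun s => ?_)
    simp only [Finset.sum_mul]
    exact Finset.sum_congr rfl fun i _ => by ring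
  · refine Continuous.integrable_of_hasCompactSupport ?_ ?_
    · have := hf i
      fun_prop
    · exact ((hχs.comp_left (g := fun t : ℝ => (t : ℂ)) (by simp)).mul_left).mul_left

theorem continuous_curveAverage {n : ℕ} {γ : ℝ → EuclideanSpace ℝ (Fin n)} {χ : ℝ → ℝ}
    (hγ : Continuous γ) (hχ : Continuous χ) (hχs : HasCompactSupport χ) {X : Type*}
    [TopologicalSpace X] [FirstCountableTopology X] [LocallyCompactSpace X]
    {f : X → EuclideanSpace ℝ (Fin n) → ℂ} (hf : Continuous fun q : X × EuclideanSpace ℝ (Fin n) =>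
      f q.1 q.2) {t : X → ℝ} (ht : Continuous t) {x : X → EuclideanSpace ℝ (Fin n)}
    (hx : Continuous x) : Continuous fun q => curveAverage γ χ (t q) (f q) (x q) := by
  have h0 : (fun q => curveAverage γ χ (t q) (f q) (x q)) =
      fun q => ∫ s in tsupport χ, f q (x q - t q • γ s) * (χ s : ℂ) := by
    funext q
    rw [curveAverage, curvePairing, setIntegral_eq_integral_of_forall_compl_eq_zero fun s hs => ?_]
    rw [image_eq_zero_of_notMem_tsupport hs]
    simp
  rw [h0]
  exact continuous_parametric_integral_of_continuous
    (f := fun q s => f q (x q - t q • γ s) * (χ s : ℂ))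
    ((hf.comp (by fun_prop : Continuous fun p : X × ℝ => (p.1, x p.1 - t p.1 • γ p.2))).mul
      (by fun_prop)) hχs.isCompact

/-- Any band-limited function with the two norm bounds can be normalised to bound the supremum from
below. -/
theorem le_sSup_of_mem_bandLimited {n : ℕ} {γ : ℝ → EuclideanSpace ℝ (Fin n)} {χ : ℝ → ℝ}
    {p : ℝ≥0∞} (hp : p ≠ 0) {lam : ℝ} {f : 𝓢(EuclideanSpace ℝ (Fin n), ℂ)}
    (hf : f ∈ bandLimited n lam) {A K : ℝ} (hA : 0 < A) (hK : 0 < K)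
    (hlow : ENNReal.ofReal A ≤ spaceTimeNorm γ χ p f)
    (hup : eLpNorm f p volume ≤ ENNReal.ofReal K) :
    ENNReal.ofReal (A / K) ≤ sSup {r : ℝ≥0∞ | ∃ f ∈ bandLimited n lam,
          eLpNorm f p volume = 1 ∧ r = spaceTimeNorm γ χ p f} := by
  have hne : eLpNorm f p volume ≠ 0 := by
    intro h0
    rw [eLpNorm_eq_zero_iff f.continuous.aestronglyMeasurable hp] at h0
    have h1 : (f : EuclideanSpace ℝ (Fin n) → ℂ) = 0 :=
      Continuous.ae_eq_iff_eq volume f.continuous continuous_const |>.1 h0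
    have h2 : spaceTimeNorm γ χ p f = 0 := by
      rw [h1]
      simp [spaceTimeNorm, curveAverage, curvePairing]
    rw [h2] at hlow
    simp only [nonpos_iff_eq_zero, ENNReal.ofReal_eq_zero] at hlow
    linarith
  have hfin : eLpNorm f p volume ≠ ⊤ := ne_top_of_le_ne_top ENNReal.ofReal_ne_top hup
  set m := (eLpNorm f p volume).toReal with hm
  have hm0 : 0 < m := ENNReal.toReal_pos hne hfin
  have hmK : m ≤ K := ENNReal.toReal_le_of_le_ofReal hK.le hup
  have hnorm : ‖((m⁻¹ : ℝ) : ℂ)‖ₑ = ENNReal.ofReal m⁻¹ := by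
    rw [← ofReal_norm, Complex.norm_real, Real.norm_of_nonneg (inv_pos.2 hm0).le]
  let g : 𝓢(EuclideanSpace ℝ (Fin n), ℂ) := ((m⁻¹ : ℝ) : ℂ) • f
  have hg : (g : EuclideanSpace ℝ (Fin n) → ℂ) =
      ((m⁻¹ : ℝ) : ℂ) • (f : EuclideanSpace ℝ (Fin n) → ℂ) := rfl
  refine le_sSup_of_le ⟨g, mem_bandLimited fun ζ hζ => ?_, ?_, rfl⟩ ?_
  · have h1 : angularFourier (f : EuclideanSpace ℝ (Fin n) → ℂ) ζ = 0 := by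
      by_contra h
      exact hζ (hf (subset_tsupport _ h))
    have h2 := angularFourier_sum {()} (fun _ => ((m⁻¹ : ℝ) : ℂ)) (fun _ => f) ζ
    simp only [Finset.sum_singleton] at h2
    rw [h2, h1, mul_zero]
  · rw [hg, eLpNorm_const_smul, hnorm, ← ENNReal.ofReal_toReal hfin, ← hm,
      ← ENNReal.ofReal_mul (inv_pos.2 hm0).le, inv_mul_cancel₀ hm0.ne', ENNReal.ofReal_one]
  · have h3 : spaceTimeNorm γ χ p g = ENNReal.ofReal m⁻¹ * spaceTimeNorm γ χ p f := by
      rw [spaceTimeNorm, spaceTimeNorm, ← hnorm, ← eLpNorm_const_smul]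
      congr 1
      funext z
      simp only [hg, curveAverage, curvePairing, Pi.smul_apply, smul_eq_mul, mul_assoc,
        integral_const_mul]
    rw [h3]
    calc ENNReal.ofReal (A / K) ≤ ENNReal.ofReal (m⁻¹ * A) := by
          refine ENNReal.ofReal_le_ofReal ?_
          rw [inv_mul_eq_div]
          gcongr
      _ = ENNReal.ofReal m⁻¹ * ENNReal.ofReal A := ENNReal.ofReal_mul (inv_pos.2 hm0).le
      _ ≤ _ := by gcongr

/-! ### Averages of wave packets -/

section

variable {n : ℕ} {γ e : ℝ → EuclideanSpace ℝ (Fin n)} {η : EuclideanSpace ℝ (Fin n) → ℂ}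
  {χ : ℝ → ℝ} {N lam : ℝ}

/-- Near the focusing point the average of a packet is the integral of `packetKernel` along the
curve, up to a unimodular factor. -/
theorem norm_curveAverage_wavePacket (hN : 0 < N) (s : ℝ) (z : EuclideanSpace ℝ (Fin n) × ℝ) :
    ‖curveAverage γ χ (1 + z.2 / N) (wavePacket η N (γ s) (lam • e s)) (N⁻¹ • z.1)‖ =
      ‖∫ s', (χ s' : ℂ) * packetKernel γ e η N lam (γ s') s z‖ := by
  set a : ℝ := lam * inner ℝ (N⁻¹ • z.1 - (1 + z.2 / N) • γ s) (e s) with ha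
  have h : curveAverage γ χ (1 + z.2 / N) (wavePacket η N (γ s) (lam • e s)) (N⁻¹ • z.1) =
      Complex.exp ((a : ℂ) * Complex.I) *
        ∫ s', (χ s' : ℂ) * packetKernel γ e η N lam (γ s') s z := by
    rw [← integral_const_mul, curveAverage, curvePairing]
    refine integral_congr_ae (Filter.Eventually.of_forall fun s' => ?_)
    simp only [wavePacket, packetKernel]
    have harg : N • (N⁻¹ • z.1 - (1 + z.2 / N) • γ s' + γ s) =
        N • (γ s - γ s') + z.1 - z.2 • γ s' := by
      rw [smul_add, smul_sub, smul_smul, smul_smul, mul_inv_cancel₀ hN.ne', one_smul, mul_add,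
        mul_div_cancel₀ _ hN.ne', mul_one, add_smul, smul_sub]
      abel
    rw [harg, mul_comm (χ s' : ℂ), mul_assoc, mul_assoc, ← mul_assoc (Complex.exp _)
      (Complex.exp _), ← Complex.exp_add]
    congr 2
    rw [ha]
    simp only [inner_sub_left, real_inner_smul_right, real_inner_smul_left]
    push_cast
    ring
  rw [h, norm_mul, Complex.norm_exp_ofReal_mul_I, one_mul]

theorem continuous_uncurry_wavePacket {X : Type*} [TopologicalSpace X] (hη : Continuous η)
    (N : ℝ) {v ξ x : X → EuclideanSpace ℝ (Fin n)} (hv : Continuous v) (hξ : Continuous ξ)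
    (hx : Continuous x) : Continuous fun q => wavePacket η N (v q) (ξ q) (x q) := by
  unfold wavePacket
  fun_prop

/-- Exchange of the integral along the curve with those over the packets and the space-time
region. -/
theorem integral_testedKernel {D Θ B c α β : ℝ} (harc : IsConormalArc γ e B c α β)
    (hη : Continuous η) (hD : ∀ v, ‖η v‖ ≤ D * ((1 + ‖v‖) ^ 2)⁻¹) (hχ : Continuous χ)
    (hχs : HasCompactSupport χ) {θ : ℝ → ℝ} (hθc : Continuous θ) (hθ : ∀ s, |θ s| ≤ Θ)
    (hθs : ∀ s, s ∉ Icc α β → θ s = 0) (N lam : ℝ) :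
    ∫ s', (χ s' : ℂ) * testedKernel γ e η θ N lam (γ s') =
      ∫ y, (θ y.1 : ℂ) * (N * ∫ s', (χ s' : ℂ) * packetKernel γ e η N lam (γ s') y.1 y.2)
        ∂((volume.restrict (Icc α β)).prod (volume.restrict (unitBox n))) := by
  have hγ := harc.continuous_curve
  set ν : Measure (ℝ × (EuclideanSpace ℝ (Fin n) × ℝ)) :=
    (volume.restrict (Icc α β)).prod (volume.restrict (unitBox n)) with hν
  have hfin : IsFiniteMeasure ((volume : Measure ℝ).restrict (tsupport χ)) :=
    ⟨by rw [Measure.restrict_apply_univ]; exact hχs.isCompact.measure_lt_top⟩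
  obtain ⟨X, hX⟩ := hχs.exists_bound_of_continuous hχ
  have hX0 : 0 ≤ X := (norm_nonneg _).trans (hX 0)
  have hker : ∀ {Y : Type} [TopologicalSpace Y] {w : Y → EuclideanSpace ℝ (Fin n)} {s : Y → ℝ}
      {z : Y → EuclideanSpace ℝ (Fin n) × ℝ}, Continuous w → Continuous s → Continuous z →
      Continuous fun y => packetKernel γ e η N lam (w y) (s y) (z y) := fun hw hs hz =>
    continuous_packetKernel hγ harc.continuous_field hη N lam hw hs hz
  have hkb : ∀ w s z, ‖packetKernel γ e η N lam w s z‖ ≤ D := fun w s z => by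
    rw [norm_packetKernel]
    exact norm_window_le hD _
  have hD0 := window_const_nonneg hD
  have hΘ0 : 0 ≤ Θ := (abs_nonneg _).trans (hθ 0)
  have hinner : ∀ w, testedKernel γ e η θ N lam w =
      ∫ y, N * ((θ y.1 : ℂ) * packetKernel γ e η N lam w y.1 y.2) ∂ν := by
    intro w
    have hi : Integrable (fun y : ℝ × (EuclideanSpace ℝ (Fin n) × ℝ) =>
        (θ y.1 : ℂ) * packetKernel γ e η N lam w y.1 y.2) ν := by
      refine Integrable.of_bound (C := Θ * D) (Continuous.aestronglyMeasurable ?_)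
        (Filter.Eventually.of_forall fun y => ?_)
      · exact (Complex.continuous_ofReal.comp (hθc.comp continuous_fst)).mul
          (hker continuous_const continuous_fst continuous_snd)
      · rw [norm_mul, Complex.norm_real]
        exact mul_le_mul (hθ _) (hkb _ _ _) (norm_nonneg _) hΘ0
    rw [integral_const_mul, testedKernel, integral_prod _ hi]
    congr 1
    rw [← setIntegral_eq_integral_of_forall_compl_eq_zero (s := Icc α β) fun s hs => by
      rw [hθs s hs]; simp]
    refine integral_congr_ae (Filter.Eventually.of_forall fun s => ?_)
    simp only [integral_const_mul]
  have hL : ∫ s', (χ s' : ℂ) * testedKernel γ e η θ N lam (γ s') =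
      ∫ s' in tsupport χ, ∫ y, (χ s' : ℂ) *
        (N * ((θ y.1 : ℂ) * packetKernel γ e η N lam (γ s') y.1 y.2)) ∂ν := by
    rw [← setIntegral_eq_integral_of_forall_compl_eq_zero (s := tsupport χ) fun s hs => by
      rw [image_eq_zero_of_notMem_tsupport hs]; simp]
    refine integral_congr_ae (Filter.Eventually.of_forall fun s => ?_)
    simp only [hinner, integral_const_mul]
  rw [hL, integral_integral_swap]
  · refine integral_congr_ae (Filter.Eventually.of_forall fun y => ?_)
    simp only
    rw [setIntegral_eq_integral_of_forall_compl_eq_zero (fun s hs => by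
      rw [image_eq_zero_of_notMem_tsupport hs]; simp), ← integral_const_mul, ← integral_const_mul]
    refine integral_congr_ae (Filter.Eventually.of_forall fun s => ?_)
    simp only
    ring
  · refine Integrable.of_bound (C := X * (|N| * (Θ * D))) (Continuous.aestronglyMeasurable ?_)
      (Filter.Eventually.of_forall fun q => ?_)
    · refine (Complex.continuous_ofReal.comp (hχ.comp continuous_fst)).mul
        (continuous_const.mul ((Complex.continuous_ofReal.comp
          (hθc.comp (continuous_fst.comp continuous_snd))).mul ?_))
      exact hker (hγ.comp continuous_fst) (continuous_fst.comp continuous_snd)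
        (continuous_snd.comp continuous_snd)
    · simp only [Function.uncurry]
      rw [norm_mul, norm_mul, norm_mul, Complex.norm_real, Complex.norm_real, Complex.norm_real]
      refine mul_le_mul (hX _) (mul_le_mul_of_nonneg_left ?_ (norm_nonneg _)) (by positivity) hX0
      exact mul_le_mul (hθ _) (hkb _ _ _) (norm_nonneg _) hΘ0

/-- A lower bound for the tested kernels gives a lower bound for the mean square, over the packets
based on the arc, of the averages near the focusing point. -/
theorem le_integral_integral_focusBox {D Θ B c α β δ : ℝ} (harc : IsConormalArc γ e B c α β)
    (hη : Continuous η) (hD : ∀ v, ‖η v‖ ≤ D * ((1 + ‖v‖) ^ 2)⁻¹) (hχ : Continuous χ)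
    (hχs : HasCompactSupport χ) {θ : ℝ → ℝ} (hθc : Continuous θ) (hΘ : 0 < Θ)
    (hθ : ∀ s, |θ s| ≤ Θ) (hθs : ∀ s, s ∉ Icc α β → θ s = 0) (hN : 0 < N) (hδ : 0 < δ)
    (h : δ ≤ ‖∫ s', (χ s' : ℂ) * testedKernel γ e η θ N lam (γ s')‖) :
    δ ^ 2 / (Θ ^ 2 * (((volume.restrict (Icc α β)).prod
        (volume.restrict (unitBox n))).real univ + 1)) * (N ^ (n + 3))⁻¹ ≤
      ∫ s in Icc α β, ∫ p in focusBox n N,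
        ‖curveAverage γ χ p.2 (wavePacket η N (γ s) (lam • e s)) p.1‖ ^ 2 := by
  have hγ := harc.continuous_curve
  set ν : Measure (ℝ × (EuclideanSpace ℝ (Fin n) × ℝ)) :=
    (volume.restrict (Icc α β)).prod (volume.restrict (unitBox n)) with hν
  set Ψ : ℝ × (EuclideanSpace ℝ (Fin n) × ℝ) → ℂ := fun y =>
    curveAverage γ χ (1 + y.2.2 / N) (wavePacket η N (γ y.1) (lam • e y.1)) (N⁻¹ • y.2.1) with hΨ
  have hΨc : Continuous Ψ := by
    have he := harc.continuous_field
    refine continuous_curveAverage (f := fun y : ℝ × (EuclideanSpace ℝ (Fin n) × ℝ) =>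
      wavePacket η N (γ y.1) (lam • e y.1)) hγ hχ hχs ?_ (by fun_prop) (by fun_prop)
    exact continuous_uncurry_wavePacket hη N (by fun_prop) (by fun_prop) continuous_snd
  set F : ℝ × (EuclideanSpace ℝ (Fin n) × ℝ) → ℂ := fun y =>
    N * ∫ s', (χ s' : ℂ) * packetKernel γ e η N lam (γ s') y.1 y.2 with hF
  have hFΨ : ∀ y, ‖F y‖ ^ 2 = N ^ 2 * ‖Ψ y‖ ^ 2 := fun y => by
    rw [hF, hΨ]
    simp only
    rw [norm_curveAverage_wavePacket hN y.1 y.2, norm_mul, Complex.norm_real,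
      Real.norm_of_nonneg hN.le, mul_pow]
  have hi : Integrable (fun y => ‖Ψ y‖ ^ 2) ν := by
    rw [hν, Measure.prod_restrict]
    exact (by fun_prop : Continuous fun y => ‖Ψ y‖ ^ 2).continuousOn.integrableOn_compact
      (isCompact_Icc.prod (isCompact_unitBox n))
  rw [integral_testedKernel harc hη hD hχ hχs hθc hθ hθs] at h
  have h1 := le_integral_norm_sq_of_le_norm_integral (μ := ν) (F := F)
    (θ := fun y => (θ y.1 : ℂ)) hΘ hδ (fun y => by simpa using hθ y.1)
    (by simpa only [hFΨ] using hi.const_mul (N ^ 2)) h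
  simp only [hFΨ] at h1
  rw [integral_const_mul, integral_prod _ hi] at h1
  have h2 : ∀ s, ∫ p in focusBox n N,
      ‖curveAverage γ χ p.2 (wavePacket η N (γ s) (lam • e s)) p.1‖ ^ 2 =
      (N ^ (n + 1))⁻¹ * ∫ z in unitBox n, ‖Ψ (s, z)‖ ^ 2 := fun s => by
    rw [setIntegral_focusBox hN]
  simp only [h2]
  rw [integral_const_mul]
  set I := ∫ s in Icc α β, ∫ z in unitBox n, ‖Ψ (s, z)‖ ^ 2 with hI
  calc _ ≤ N ^ 2 * I * (N ^ (n + 3))⁻¹ := by gcongr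
    _ = _ := by
      rw [show n + 3 = 2 + (n + 1) by ring, pow_add N 2]
      field_simp

/-! ### Size of a sum of wave packets -/

theorem summable_inv_one_add_mul_sq {c : ℝ} (hc : 0 < c) :
    Summable fun j : ℤ => (1 + (c * (j : ℝ)) ^ 2)⁻¹ := by
  refine Summable.of_norm_bounded_eventually
    (((Real.summable_one_div_int_pow (p := 2)).2 one_lt_two).mul_left (c ^ 2)⁻¹) ?_
  filter_upwards [(Set.finite_singleton (0 : ℤ)).compl_mem_cofinite] with j hj
  have hj' : (j : ℝ) ≠ 0 := by exact_mod_cast hj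
  rw [Real.norm_of_nonneg (by positivity), one_div, ← mul_inv, ← mul_pow]
  exact inv_anti₀ (by positivity) (by linarith)

/-- The packets based at a mesh of width `(β - α) / N` on the arc overlap boundedly. -/
theorem sum_norm_window_le {D B c α β ϑ : ℝ} (harc : IsConormalArc γ e B c α β)
    (hD : ∀ v, ‖η v‖ ≤ D * ((1 + ‖v‖) ^ 2)⁻¹) (hϑ : ϑ ∈ Icc (0 : ℝ) 1) {N : ℕ} (hN : 0 < N)
    (x : EuclideanSpace ℝ (Fin n)) :
    ∑ ν ∈ Finset.range N, ‖η ((N : ℝ) • (x + γ (α + (ν + ϑ) * ((β - α) / N))))‖ ≤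
      D * ∑' j : ℤ, (1 + (c * (β - α) / 2 * (j : ℝ)) ^ 2)⁻¹ := by
  have hN' : (0 : ℝ) < N := by exact_mod_cast hN
  have hc := harc.expansion_pos
  have hβα : 0 < β - α := by linarith [harc.lt]
  have hD0 := window_const_nonneg hD
  set σ : ℕ → ℝ := fun ν => α + (ν + ϑ) * ((β - α) / N) with hσ
  have hmem : ∀ ν ∈ Finset.range N, σ ν ∈ Icc α β := fun ν hν => by
    have h1 : (ν : ℝ) + 1 ≤ N := by exact_mod_cast Finset.mem_range.1 hν
    have h2 : 0 ≤ (ν + ϑ) * ((β - α) / N) := by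
      have := hϑ.1
      positivity
    refine ⟨by simp only [hσ]; linarith, ?_⟩
    have h3 : (ν + ϑ) * ((β - α) / N) ≤ N * ((β - α) / N) := by
      refine mul_le_mul_of_nonneg_right ?_ (by positivity)
      linarith [hϑ.2]
    rw [mul_div_cancel₀ _ hN'.ne'] at h3
    simp only [hσ]
    linarith
  obtain ⟨k, hk, hmin⟩ := Finset.exists_min_image (Finset.range N) (fun ν => ‖x + γ (σ ν)‖)
    ⟨0, Finset.mem_range.2 hN⟩
  have hterm : ∀ ν ∈ Finset.range N, ‖η ((N : ℝ) • (x + γ (σ ν)))‖ ≤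
      D * (1 + (c * (β - α) / 2 * (((ν : ℤ) - (k : ℤ) : ℤ) : ℝ)) ^ 2)⁻¹ := by
    intro ν hν
    refine (hD _).trans (mul_le_mul_of_nonneg_left (inv_one_add_sq_le ?_) hD0)
    have h1 := hmin ν hν
    have h2 := harc.expansion _ (hmem ν hν) _ (hmem k hk)
    have h3 : ‖γ (σ ν) - γ (σ k)‖ ≤ ‖x + γ (σ ν)‖ + ‖x + γ (σ k)‖ := by
      rw [show γ (σ ν) - γ (σ k) = (x + γ (σ ν)) - (x + γ (σ k)) by abel]
      exact norm_sub_le _ _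
    have h4 : σ ν - σ k = ((ν : ℝ) - k) * ((β - α) / N) := by simp only [hσ]; ring
    rw [h4, abs_mul, abs_of_pos (by positivity : 0 < (β - α) / N)] at h2
    rw [norm_smul, Real.norm_of_nonneg hN'.le, abs_mul,
      abs_of_pos (by positivity : 0 < c * (β - α) / 2)]
    push_cast
    have h5 : c * (β - α) / 2 * |(ν : ℝ) - k| =
        N * (c * (|(ν : ℝ) - k| * ((β - α) / N)) / 2) := by field_simp
    rw [h5]
    refine mul_le_mul_of_nonneg_left ?_ hN'.le
    linarith
  refine (Finset.sum_le_sum hterm).trans ?_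
  rw [← Finset.mul_sum]
  refine mul_le_mul_of_nonneg_left ?_ hD0
  have hinj : Function.Injective fun ν : ℕ => (ν : ℤ) - (k : ℤ) := fun a b hab => by
    simpa using hab
  have h := (summable_inv_one_add_mul_sq (by positivity : 0 < c * (β - α) / 2)).sum_le_tsum
    ((Finset.range N).map ⟨fun ν : ℕ => (ν : ℤ) - (k : ℤ), hinj⟩) fun j _ => by positivity
  rw [Finset.sum_map] at h
  exact h

/-- Interpolation between `L¹` and `L^∞`. For `p = ∞` the exponent `1 / p.toReal` is `1 / 0 = 0`, as
it should be. -/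
theorem eLpNorm_le_of_bound_of_integral_le {f : EuclideanSpace ℝ (Fin n) → ℂ} {C M : ℝ}
    (hC : 1 ≤ C) (hM : 0 ≤ M) (hf : Integrable f) (hb : ∀ x, ‖f x‖ ≤ C) (hI : ∫ x, ‖f x‖ ≤ M)
    {p : ℝ≥0∞} (hp : 1 ≤ p) :
    eLpNorm f p volume ≤ ENNReal.ofReal (C * M ^ (1 / p.toReal)) := by
  rcases eq_or_ne p ⊤ with rfl | hpt
  · rw [eLpNorm_exponent_top]
    simp only [ENNReal.toReal_top, div_zero, Real.rpow_zero, mul_one]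
    exact eLpNormEssSup_le_of_ae_bound (Filter.Eventually.of_forall hb)
  · have hp0 : p ≠ 0 := (zero_lt_one.trans_le hp).ne'
    have hp1 : 1 ≤ p.toReal := by
      rw [← ENNReal.toReal_one]
      exact ENNReal.toReal_mono hpt hp
    have hp2 : 0 < p.toReal := by linarith
    rw [eLpNorm_eq_lintegral_rpow_enorm_toReal hp0 hpt]
    have h1 : ∀ x, ‖f x‖ₑ ^ p.toReal ≤ ENNReal.ofReal C ^ p.toReal * ‖f x‖ₑ := by
      intro x
      have hx : ‖f x‖ₑ ≤ ENNReal.ofReal C := by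
        rw [← ofReal_norm]
        exact ENNReal.ofReal_le_ofReal (hb x)
      calc ‖f x‖ₑ ^ p.toReal = ‖f x‖ₑ ^ (p.toReal - 1) * ‖f x‖ₑ := by
            conv_rhs => rw [← ENNReal.rpow_one ‖f x‖ₑ, ← ENNReal.rpow_mul, one_mul]
            rw [← ENNReal.rpow_add_of_nonneg _ _ (by linarith) zero_le_one, sub_add_cancel]
        _ ≤ ENNReal.ofReal C ^ (p.toReal - 1) * ‖f x‖ₑ := by gcongr
        _ ≤ _ := by
          gcongr
          · simpa using hC
          · linarith
    have h2 : ∫⁻ x, ‖f x‖ₑ ^ p.toReal ≤ ENNReal.ofReal C ^ p.toReal * ENNReal.ofReal M := by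
      refine (lintegral_mono h1).trans ?_
      rw [lintegral_const_mul' _ _ (ENNReal.rpow_ne_top_of_nonneg hp2.le ENNReal.ofReal_ne_top)]
      gcongr
      rw [← ofReal_integral_norm_eq_lintegral_enorm hf]
      exact ENNReal.ofReal_le_ofReal hI
    calc _ ≤ (ENNReal.ofReal C ^ p.toReal * ENNReal.ofReal M) ^ (1 / p.toReal) := by gcongr
      _ = ENNReal.ofReal C * ENNReal.ofReal M ^ (1 / p.toReal) := by
        rw [ENNReal.mul_rpow_of_nonneg _ _ (by positivity), ← ENNReal.rpow_mul,
          mul_one_div_cancel hp2.ne', ENNReal.rpow_one]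
      _ = _ := by
        rw [ENNReal.ofReal_mul (by linarith), ENNReal.ofReal_rpow_of_nonneg hM (by positivity)]

end

/-! ### The lower bound at a fixed frequency -/

section

variable {n : ℕ}

theorem eLpNorm_two_eq_sqrt_integral {X : Type*} [TopologicalSpace X] [MeasurableSpace X]
    [OpensMeasurableSpace X] [T2Space X] {μ : Measure X} [IsFiniteMeasureOnCompacts μ] {S : Set X}
    (hS : IsCompact S) {F : X → ℂ} (hF : Continuous F) :
    eLpNorm F 2 (μ.restrict S) = ENNReal.ofReal (√(∫ x in S, ‖F x‖ ^ 2 ∂μ)) := by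
  have hi : IntegrableOn (fun x => ‖F x‖ ^ 2) S μ :=
    (by fun_prop : Continuous fun x => ‖F x‖ ^ 2).continuousOn.integrableOn_compact hS
  rw [eLpNorm_eq_lintegral_rpow_enorm_toReal (by simp) (by simp), Real.sqrt_eq_rpow,
    ← ENNReal.ofReal_rpow_of_nonneg (integral_nonneg fun _ => by positivity) (by positivity),
    ofReal_integral_eq_lintegral_ofReal hi (Filter.Eventually.of_forall fun _ => by positivity)]
  congr 1
  refine lintegral_congr fun x => ?_
  rw [ENNReal.toReal_ofNat, ENNReal.rpow_ofNat, ENNReal.ofReal_pow (norm_nonneg _), ofReal_norm]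

/-- Hölder's inequality on a compact set of small measure, read as a lower bound for `L^p`
norms with `p ≥ 2`. -/
theorem le_eLpNorm_of_le_integral_norm_sq {X : Type*} [TopologicalSpace X] [MeasurableSpace X]
    [OpensMeasurableSpace X] [T2Space X] [SecondCountableTopology X] {μ : Measure X}
    [IsFiniteMeasureOnCompacts μ] {S : Set X} (hS : IsCompact S) {F : X → ℂ} (hF : Continuous F)
    {I V : ℝ} (hV : 0 < V) (hI : I ≤ ∫ x in S, ‖F x‖ ^ 2 ∂μ) (hμ : μ S ≤ ENNReal.ofReal V)
    {p : ℝ≥0∞} (hp : 2 ≤ p) (hq : 1 / p.toReal ≤ 1 / 2) :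
    ENNReal.ofReal (√I / V ^ (1 / 2 - 1 / p.toReal)) ≤ eLpNorm F p (μ.restrict S) := by
  have h1 := eLpNorm_le_eLpNorm_mul_rpow_measure_univ (μ := μ.restrict S) hp
    hF.aestronglyMeasurable
  rw [eLpNorm_two_eq_sqrt_integral hS hF, Measure.restrict_apply_univ, ENNReal.toReal_ofNat] at h1
  rw [ENNReal.ofReal_div_of_pos (by positivity)]
  refine ENNReal.div_le_of_le_mul ((ENNReal.ofReal_le_ofReal (Real.sqrt_le_sqrt hI)).trans
    (h1.trans ?_))
  rw [← ENNReal.ofReal_rpow_of_pos hV]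
  exact mul_le_mul_right (ENNReal.rpow_le_rpow hμ (by linarith)) _

theorem one_div_toReal_le_half {p : ℝ≥0∞} (hp : 2 ≤ p) : 1 / p.toReal ≤ 1 / 2 := by
  rcases eq_or_ne p ⊤ with rfl | hpt
  · simp
  · have : (2 : ℝ) ≤ p.toReal := by
      simpa using ENNReal.toReal_mono hpt hp
    exact one_div_le_one_div_of_le (by norm_num) this

/-- The powers of `N` in Hölder's inequality on a focusing region of measure `≈ N ^ (-m - 1)`. -/
theorem sqrt_div_rpow_focus {c v q : ℝ} (hv : 0 ≤ v) (hq0 : 0 ≤ q)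
    (m : ℕ) {N : ℝ} (hN : 0 < N) :
    √c / (v + 1) * N ^ (-(1 / 2) - (m + 1) * q) ≤
      √(c * (N ^ (m + 2))⁻¹) / ((N ^ (m + 1))⁻¹ * (v + 1)) ^ (1 / 2 - q) := by
  have h1 : √(c * (N ^ (m + 2))⁻¹) = √c * N ^ (-((m + 2 : ℝ) / 2)) := by
    rw [Real.sqrt_mul' _ (by positivity)]
    congr 1
    rw [Real.sqrt_eq_rpow, ← Real.rpow_natCast, ← Real.rpow_neg hN.le, ← Real.rpow_mul hN.le]
    congr 1
    push_cast
    ring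
  have h2 : ((N ^ (m + 1))⁻¹ * (v + 1)) ^ (1 / 2 - q) =
      N ^ (-((m + 1 : ℝ) * (1 / 2 - q))) * (v + 1) ^ (1 / 2 - q) := by
    rw [Real.mul_rpow (by positivity) (by positivity), ← Real.rpow_natCast, ← Real.rpow_neg hN.le,
      ← Real.rpow_mul hN.le]
    congr 2
    push_cast
    ring
  have h3 : (v + 1) ^ (1 / 2 - q) ≤ v + 1 := by
    conv_rhs => rw [← Real.rpow_one (v + 1)]
    exact Real.rpow_le_rpow_of_exponent_le (by linarith) (by linarith)
  have h4 : N ^ (-(1 / 2) - (m + 1) * q) * N ^ (-((m + 1 : ℝ) * (1 / 2 - q))) =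
      N ^ (-((m + 2 : ℝ) / 2)) := by
    rw [← Real.rpow_add hN]
    congr 1
    ring
  rw [h1, h2, le_div_iff₀ (by positivity), ← h4]
  calc √c / (v + 1) * N ^ (-(1 / 2) - (m + 1) * q) *
        (N ^ (-((m + 1 : ℝ) * (1 / 2 - q))) * (v + 1) ^ (1 / 2 - q))
      ≤ √c / (v + 1) * N ^ (-(1 / 2) - (m + 1) * q) *
        (N ^ (-((m + 1 : ℝ) * (1 / 2 - q))) * (v + 1)) := by gcongr
    _ = _ := by field_simp

theorem wavePacket_sum_mem_bandLimited {η : 𝓢(EuclideanSpace ℝ (Fin n), ℂ)} {r : ℝ}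
    (hηr : ∀ ζ, r < ‖ζ‖ → angularFourier (η : EuclideanSpace ℝ (Fin n) → ℂ) ζ = 0) {N lam : ℝ}
    (hN : 0 < N) (hNr : N * r ≤ lam / 2) {ι : Type*} (s : Finset ι) (ε : ι → ℂ)
    {v ξ : ι → EuclideanSpace ℝ (Fin n)} (hξ : ∀ i, ‖ξ i‖ = lam)
    {f : ι → 𝓢(EuclideanSpace ℝ (Fin n), ℂ)} (hf : ∀ i, ⇑(f i) = wavePacket η N (v i) (ξ i)) :
    ∑ i ∈ s, ε i • f i ∈ bandLimited n lam := by
  refine mem_bandLimited fun ζ hζ => ?_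
  rw [angularFourier_sum]
  refine Finset.sum_eq_zero fun i _ => ?_
  rw [hf i, angularFourier_wavePacket _ hN, hηr, mul_zero, smul_zero, mul_zero]
  rw [norm_smul, Real.norm_of_nonneg (inv_pos.2 hN).le, inv_mul_eq_div, lt_div_iff₀ hN]
  by_contra! h
  have h1 : ‖ζ - ξ i‖ ≤ lam / 2 := h.trans (by linarith)
  have h2 := norm_sub_norm_le ζ (ξ i)
  have h3 := norm_sub_norm_le (ξ i) ζ
  rw [norm_sub_rev] at h3
  rw [hξ i] at h2 h3
  exact hζ ⟨by linarith, by linarith [norm_nonneg (ζ - ξ i)]⟩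

/-- Mesh points on the arc and signs for which the averages of the signed sum of packets are large
in mean square near the focusing point. -/
theorem exists_mesh_signs_le_integral {γ e : ℝ → EuclideanSpace ℝ (Fin n)}
    {η : EuclideanSpace ℝ (Fin n) → ℂ} {χ : ℝ → ℝ} {B c α β c₁ lam : ℝ}
    (harc : IsConormalArc γ e B c α β) (hη : Continuous η) (hχ : Continuous χ)
    (hχs : HasCompactSupport χ) {N : ℕ} (hN : 0 < N)
    (hlow : c₁ * ((N : ℝ) ^ (n + 3))⁻¹ ≤ ∫ s in Icc α β, ∫ p in focusBox n N,
      ‖curveAverage γ χ p.2 (wavePacket η N (γ s) (lam • e s)) p.1‖ ^ 2) :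
    ∃ ϑ ∈ Icc (0 : ℝ) 1, ∃ ε : ℕ → ℂ, (∀ ν, ‖ε ν‖ = 1) ∧
      c₁ / (β - α) * ((N : ℝ) ^ (n + 2))⁻¹ ≤
        ∫ p in focusBox n N, ‖∑ ν ∈ Finset.range N, ε ν * curveAverage γ χ p.2
          (wavePacket η N (γ (α + (ν + ϑ) * ((β - α) / N)))
            (lam • e (α + (ν + ϑ) * ((β - α) / N)))) p.1‖ ^ 2 := by
  have hγ := harc.continuous_curve
  have he := harc.continuous_field
  have hβα : 0 < β - α := by linarith [harc.lt]
  have hN' : (0 : ℝ) < N := by exact_mod_cast hN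
  have hcont : Continuous fun y : ℝ × (EuclideanSpace ℝ (Fin n) × ℝ) =>
      curveAverage γ χ y.2.2 (wavePacket η N (γ y.1) (lam • e y.1)) y.2.1 := by
    refine continuous_curveAverage (f := fun y : ℝ × (EuclideanSpace ℝ (Fin n) × ℝ) =>
      wavePacket η N (γ y.1) (lam • e y.1)) hγ hχ hχs ?_ (by fun_prop) (by fun_prop)
    exact continuous_uncurry_wavePacket hη N (by fun_prop) (by fun_prop) continuous_snd
  have hGc : Continuous fun s => ∫ p in focusBox n N,
      ‖curveAverage γ χ p.2 (wavePacket η N (γ s) (lam • e s)) p.1‖ ^ 2 :=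
    continuous_parametric_integral_of_continuous
      (f := fun (s : ℝ) (p : EuclideanSpace ℝ (Fin n) × ℝ) =>
        ‖curveAverage γ χ p.2 (wavePacket η N (γ s) (lam • e s)) p.1‖ ^ 2)
      ((continuous_pow 2).comp hcont.norm) (isCompact_focusBox n N)
  obtain ⟨ϑ, hϑ, hmesh⟩ := exists_mesh_integral_le harc.lt hGc hN
  have hFs : ∀ s : ℝ, Continuous fun p : EuclideanSpace ℝ (Fin n) × ℝ =>
      curveAverage γ χ p.2 (wavePacket η N (γ s) (lam • e s)) p.1 := fun s =>
    continuous_curveAverage (f := fun _ : EuclideanSpace ℝ (Fin n) × ℝ =>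
      wavePacket η N (γ s) (lam • e s)) hγ hχ hχs
      (continuous_uncurry_wavePacket hη N continuous_const continuous_const continuous_snd)
      continuous_snd continuous_fst
  obtain ⟨ε, hε, hsign⟩ := exists_signs_le_integral_norm_sq (μ := volume)
    (isCompact_focusBox n N) (fun (ν : ℕ) (p : EuclideanSpace ℝ (Fin n) × ℝ) =>
      curveAverage γ χ p.2 (wavePacket η N (γ (α + (ν + ϑ) * ((β - α) / N)))
        (lam • e (α + (ν + ϑ) * ((β - α) / N)))) p.1) (fun ν => hFs _) N
  refine ⟨ϑ, hϑ, ε, hε, le_trans ?_ hsign⟩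
  have h1 := hlow.trans hmesh
  rw [div_mul_eq_mul_div, le_div_iff₀ hN'] at h1
  rw [div_mul_eq_mul_div, div_le_iff₀ hβα]
  calc c₁ * ((N : ℝ) ^ (n + 2))⁻¹ = c₁ * ((N : ℝ) ^ (n + 3))⁻¹ * N := by
        rw [pow_succ (N : ℝ) (n + 2)]
        field_simp
    _ ≤ _ := h1
    _ = _ := mul_comm _ _

theorem integrable_norm_window_comp (η : 𝓢(EuclideanSpace ℝ (Fin n), ℂ)) {N : ℝ} (hN : 0 < N)
    (v : EuclideanSpace ℝ (Fin n)) : Integrable fun x => ‖η (N • (x + v))‖ :=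
  ((η.integrable (μ := volume)).norm.comp_smul hN.ne').comp_add_right v

theorem integral_norm_window_comp (η : 𝓢(EuclideanSpace ℝ (Fin n), ℂ)) {N : ℝ} (hN : 0 < N)
    (v : EuclideanSpace ℝ (Fin n)) :
    ∫ x, ‖η (N • (x + v))‖ = (N ^ n)⁻¹ * ∫ x, ‖η x‖ := by
  rw [integral_add_right_eq_self (fun x => ‖η (N • x)‖),
    Measure.integral_comp_smul volume (fun x => ‖η x‖), finrank_euclideanSpace_fin,
    abs_of_pos (by positivity), smul_eq_mul]

/-- The `L^p` norm of a signed sum of the packets based at a mesh is at most that of packets with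
disjoint supports, up to a constant. -/
theorem eLpNorm_packet_sum_le {γ e : ℝ → EuclideanSpace ℝ (Fin n)}
    {η : 𝓢(EuclideanSpace ℝ (Fin n), ℂ)} {D B c α β ϑ lam : ℝ}
    (harc : IsConormalArc γ e B c α β) (hD : ∀ v, ‖η v‖ ≤ D * ((1 + ‖v‖) ^ 2)⁻¹)
    (hϑ : ϑ ∈ Icc (0 : ℝ) 1) {N : ℕ} (hN : 0 < N) {ε : ℕ → ℂ} (hε : ∀ ν, ‖ε ν‖ = 1)
    {f : 𝓢(EuclideanSpace ℝ (Fin n), ℂ)}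
    (hf : ⇑f = fun y => ∑ ν ∈ Finset.range N, ε ν *
      wavePacket η N (γ (α + (ν + ϑ) * ((β - α) / N)))
        (lam • e (α + (ν + ϑ) * ((β - α) / N))) y) {p : ℝ≥0∞} (hp : 1 ≤ p) :
    eLpNorm f p volume ≤ ENNReal.ofReal
      (max 1 (D * ∑' j : ℤ, (1 + (c * (β - α) / 2 * (j : ℝ)) ^ 2)⁻¹) * ((∫ x, ‖η x‖) + 1) *
        (N : ℝ) ^ ((1 - n) * (1 / p.toReal))) := by
  have hN' : (0 : ℝ) < N := by exact_mod_cast hN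
  set K := max 1 (D * ∑' j : ℤ, (1 + (c * (β - α) / 2 * (j : ℝ)) ^ 2)⁻¹) with hK
  have hK1 : 1 ≤ K := le_max_left _ _
  set H := ∫ x, ‖η x‖ with hH
  have hH0 : 0 ≤ H := integral_nonneg fun _ => norm_nonneg _
  have hpk : ∀ x, ‖f x‖ ≤
      ∑ ν ∈ Finset.range N, ‖η ((N : ℝ) • (x + γ (α + (ν + ϑ) * ((β - α) / N))))‖ := fun x => by
    rw [hf]
    refine (norm_sum_le _ _).trans (Finset.sum_le_sum fun ν _ => le_of_eq ?_)
    rw [norm_mul, hε, one_mul, wavePacket, norm_mul, mul_comm Complex.I,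
      Complex.norm_exp_ofReal_mul_I, one_mul]
  have hint : ∫ x, ‖f x‖ ≤ N * (((N : ℝ) ^ n)⁻¹ * H) := by
    refine (integral_mono f.integrable.norm
      (integrable_finsetSum _ fun ν _ => integrable_norm_window_comp η hN' _) hpk).trans
      (le_of_eq ?_)
    rw [integral_finsetSum _ fun ν _ => integrable_norm_window_comp η hN' _]
    simp only [integral_norm_window_comp η hN', Finset.sum_const, Finset.card_range, nsmul_eq_mul,
      hH]
  refine (eLpNorm_le_of_bound_of_integral_le hK1 (M := N * (((N : ℝ) ^ n)⁻¹ * H)) (by positivity)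
    f.integrable (fun x => (hpk x).trans
      ((sum_norm_window_le harc hD hϑ hN x).trans (le_max_right _ _))) hint hp).trans ?_
  refine ENNReal.ofReal_le_ofReal ?_
  rw [mul_assoc]
  refine mul_le_mul_of_nonneg_left ?_ (by linarith)
  have h1 : (N : ℝ) * (((N : ℝ) ^ n)⁻¹ * H) = (N : ℝ) ^ (1 - n : ℝ) * H := by
    rw [Real.rpow_sub hN', Real.rpow_one, Real.rpow_natCast]
    ring
  have hq1 : 1 / p.toReal ≤ 1 := by
    rcases eq_or_ne p ⊤ with rfl | hpt
    · simp
    · have h := ENNReal.toReal_mono hpt hp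
      rw [ENNReal.toReal_one] at h
      rw [div_le_one (by linarith)]
      exact h
  rw [h1, Real.mul_rpow (by positivity) hH0, ← Real.rpow_mul hN'.le, mul_comm]
  refine mul_le_mul_of_nonneg_right ?_ (by positivity)
  calc H ^ (1 / p.toReal) ≤ (H + 1) ^ (1 / p.toReal) :=
        Real.rpow_le_rpow hH0 (by linarith) (by positivity)
    _ ≤ (H + 1) ^ (1 : ℝ) := Real.rpow_le_rpow_of_exponent_le (by linarith) hq1
    _ = H + 1 := Real.rpow_one _

/-- Lower bound for the space-time norm in terms of the mean square near the focusing point. -/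
theorem le_spaceTimeNorm_of_le_integral {γ : ℝ → EuclideanSpace ℝ (Fin n)} {χ : ℝ → ℝ}
    (hγ : Continuous γ) (hχ : Continuous χ) (hχs : HasCompactSupport χ)
    {f : EuclideanSpace ℝ (Fin n) → ℂ} (hf : Continuous f) {N : ℕ} (hN : 0 < N) {c : ℝ}
    (hI : c * ((N : ℝ) ^ (n + 2))⁻¹ ≤ ∫ z in focusBox n N, ‖curveAverage γ χ z.2 f z.1‖ ^ 2)
    {p : ℝ≥0∞} (hp : 2 ≤ p) :
    ENNReal.ofReal (√c / ((volume : Measure (EuclideanSpace ℝ (Fin n) × ℝ)).real (unitBox n) + 1) *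
      (N : ℝ) ^ (-(1 / 2) - (n + 1) * (1 / p.toReal))) ≤ spaceTimeNorm γ χ p f := by
  have hN' : (0 : ℝ) < N := by exact_mod_cast hN
  have hN1 : (1 : ℝ) ≤ N := by exact_mod_cast hN
  set v := (volume : Measure (EuclideanSpace ℝ (Fin n) × ℝ)).real (unitBox n) with hv
  have hv0 : 0 ≤ v := measureReal_nonneg
  have hSc : Continuous fun z : EuclideanSpace ℝ (Fin n) × ℝ => curveAverage γ χ z.2 f z.1 :=
    continuous_curveAverage (f := fun (_ : EuclideanSpace ℝ (Fin n) × ℝ) => f) hγ hχ hχs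
      (hf.comp continuous_snd) continuous_snd continuous_fst
  have h1 := le_eLpNorm_of_le_integral_norm_sq (isCompact_focusBox n N) hSc
    (V := ((N : ℝ) ^ (n + 1))⁻¹ * (v + 1)) (by positivity) hI
    (by
      rw [volume_focusBox hN']
      refine ENNReal.ofReal_le_ofReal ?_
      refine mul_le_mul_of_nonneg_left (by linarith) (by positivity)) hp
    (one_div_toReal_le_half hp)
  refine (ENNReal.ofReal_le_ofReal (sqrt_div_rpow_focus hv0 (by positivity) n hN')).trans
    (h1.trans ?_)
  refine eLpNorm_mono_measure _ (Measure.restrict_mono ?_ le_rfl)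
  refine prod_mono (subset_univ _) (Icc_subset_Icc le_rfl ?_)
  have : (N : ℝ)⁻¹ ≤ 1 := inv_le_one_of_one_le₀ hN1
  linarith

/-- A signed sum of `N` focusing wave packets gives the lower bound `N ^ (-1/2 - 2/p)` for the
space-time norm, as soon as the tested kernel at scale `1 / N` is bounded below. -/
theorem exists_le_sSup_of_le_norm_integral {γ e : ℝ → EuclideanSpace ℝ (Fin n)}
    {η : 𝓢(EuclideanSpace ℝ (Fin n), ℂ)} {χ : ℝ → ℝ} {D Θ B c α β δ r : ℝ}
    (harc : IsConormalArc γ e B c α β)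
    (hD : ∀ v, ‖η v‖ ≤ D * ((1 + ‖v‖) ^ 2)⁻¹)
    (hηr : ∀ ζ, r < ‖ζ‖ → angularFourier (η : EuclideanSpace ℝ (Fin n) → ℂ) ζ = 0)
    (hχ : Continuous χ) (hχs : HasCompactSupport χ) {θ : ℝ → ℝ} (hθc : Continuous θ) (hΘ : 0 < Θ)
    (hθ : ∀ s, |θ s| ≤ Θ) (hθs : ∀ s, s ∉ Icc α β → θ s = 0) (hδ : 0 < δ)
    {p : ℝ≥0∞} (hp : 2 ≤ p) :
    ∃ C : ℝ, 0 < C ∧ ∀ (N : ℕ) (lam : ℝ), 0 < N → 0 < lam → N * r ≤ lam / 2 →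
      δ ≤ ‖∫ s', (χ s' : ℂ) * testedKernel γ e η θ N lam (γ s')‖ →
      ENNReal.ofReal (C * (N : ℝ) ^ (-(1 / 2 : ℝ) - 2 * (1 / p.toReal))) ≤
        sSup {r : ℝ≥0∞ | ∃ f ∈ bandLimited n lam,
          eLpNorm f p volume = 1 ∧ r = spaceTimeNorm γ χ p f} := by
  have hγ := harc.continuous_curve
  have hβα : 0 < β - α := by linarith [harc.lt]
  have hp1 : 1 ≤ p := le_trans (by norm_num) hp
  have hp0 : p ≠ 0 := (zero_lt_one.trans_le hp1).ne'
  obtain ⟨c₁, hc₁0, hc₁⟩ : ∃ c₁ : ℝ, 0 < c₁ ∧ δ ^ 2 / (Θ ^ 2 *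
      (((volume.restrict (Icc α β)).prod (volume.restrict (unitBox n))).real univ + 1)) = c₁ :=
    ⟨_, by have := measureReal_nonneg (μ := (volume.restrict (Icc α β)).prod
            (volume.restrict (unitBox n))) (s := univ); positivity, rfl⟩
  obtain ⟨a, ha0, ha⟩ : ∃ a : ℝ, 0 < a ∧ √(c₁ / (β - α)) /
      ((volume : Measure (EuclideanSpace ℝ (Fin n) × ℝ)).real (unitBox n) + 1) = a :=
    ⟨_, by have := measureReal_nonneg (μ := (volume : Measure (EuclideanSpace ℝ (Fin n) × ℝ)))
            (s := unitBox n); positivity, rfl⟩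
  obtain ⟨K, hK0, hK⟩ : ∃ K : ℝ, 0 < K ∧
      max 1 (D * ∑' j : ℤ, (1 + (c * (β - α) / 2 * (j : ℝ)) ^ 2)⁻¹) * ((∫ x, ‖η x‖) + 1) = K :=
    ⟨_, by have : 0 ≤ ∫ x, ‖η x‖ := integral_nonneg fun _ => norm_nonneg _
           positivity, rfl⟩
  refine ⟨a / K, by positivity, fun N lam hN hlam hNr hδN => ?_⟩
  have hN' : (0 : ℝ) < N := by exact_mod_cast hN
  have hlow := le_integral_integral_focusBox harc η.continuous hD hχ hχs hθc hΘ hθ hθs hN' hδ hδN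
  rw [hc₁] at hlow
  obtain ⟨ϑ, hϑ, ε, hε, hI⟩ := exists_mesh_signs_le_integral harc η.continuous hχ hχs hN hlow
  choose f hf using fun ν : ℕ => exists_schwartz_eq_wavePacket η hN'
    (γ (α + (ν + ϑ) * ((β - α) / N))) (lam • e (α + (ν + ϑ) * ((β - α) / N)))
  have hband : ∑ ν ∈ Finset.range N, ε ν • f ν ∈ bandLimited n lam :=
    wavePacket_sum_mem_bandLimited hηr hN' hNr _ ε (fun ν => by
      rw [norm_smul, harc.norm_field, mul_one, Real.norm_of_nonneg hlam.le]) hf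
  obtain ⟨g, hg⟩ : ∃ g, g = ∑ ν ∈ Finset.range N, ε ν • f ν := ⟨_, rfl⟩
  rw [← hg] at hband
  have hsum : ⇑g = fun y => ∑ ν ∈ Finset.range N,
      ε ν * wavePacket η N (γ (α + (ν + ϑ) * ((β - α) / N)))
        (lam • e (α + (ν + ϑ) * ((β - α) / N))) y := by
    funext y
    simp only [hg, sum_apply, smul_apply, smul_eq_mul, hf]
  have hA := le_spaceTimeNorm_of_le_integral hγ hχ hχs g.continuous hN (c := c₁ / (β - α)) (by
    refine hI.trans (le_of_eq ?_)
    congr 1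
    funext z
    rw [hsum]
    simp only [← hf]
    rw [curveAverage_sum hγ hχ hχs _ _ (fun ν => ⇑(f ν)) fun ν => (f ν).continuous]) hp
  have hB := eLpNorm_packet_sum_le harc hD hϑ hN hε hsum hp1
  rw [ha] at hA
  rw [hK] at hB
  refine le_trans (ENNReal.ofReal_le_ofReal (le_of_eq ?_))
    (le_sSup_of_mem_bandLimited hp0 hband (by positivity) (by positivity) hA hB)
  have h1 : (N : ℝ) ^ (-(1 / 2 : ℝ) - 2 * (1 / p.toReal)) * (N : ℝ) ^ ((1 - n) * (1 / p.toReal)) =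
      (N : ℝ) ^ (-(1 / 2 : ℝ) - (n + 1) * (1 / p.toReal)) := by
    rw [← Real.rpow_add hN']
    congr 1
    ring
  rw [← h1]
  field_simp

end

/-! ### Bounded frequencies -/

theorem exists_norm_le_inv_one_add_norm_sq {n : ℕ} (η : 𝓢(EuclideanSpace ℝ (Fin n), ℂ)) :
    ∃ D : ℝ, ∀ v, ‖η v‖ ≤ D * ((1 + ‖v‖) ^ 2)⁻¹ := by
  refine ⟨2 ^ 2 * (Finset.Iic (2, 0)).sup
    (fun m : ℕ × ℕ => SchwartzMap.seminorm ℝ (F := ℂ) m.1 m.2) η, fun v => ?_⟩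
  rw [← div_eq_mul_inv, le_div_iff₀ (by positivity), mul_comm]
  simpa using SchwartzMap.one_add_le_sup_seminorm_apply (𝕜 := ℝ) (m := (2, 0)) (k := 2) (n := 0)
    le_rfl le_rfl η v

section

variable {n : ℕ} {γ : ℝ → EuclideanSpace ℝ (Fin n)} {χ : ℝ → ℝ}

theorem differentiable_integral_exp_mul {g k : ℝ → ℂ} (hg : Continuous g)
    (hk : Continuous k) (hks : HasCompactSupport k) :
    Differentiable ℂ fun z : ℂ => ∫ s, Complex.exp (z * g s) * k s := by
  intro z₀
  have hi : ∀ f : ℝ → ℂ, Continuous f → Integrable fun s => f s * k s := fun f hf =>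
    (hf.mul hk).integrable_of_hasCompactSupport hks.mul_left
  have hb : Integrable fun s => (‖g s‖ * Real.exp ((‖z₀‖ + 1) * ‖g s‖)) * ‖k s‖ :=
    ((hg.norm.mul (Real.continuous_exp.comp (continuous_const.mul hg.norm))).mul
      hk.norm).integrable_of_hasCompactSupport hks.norm.mul_left
  refine (hasDerivAt_integral_of_dominated_loc_of_deriv_le
    (F := fun (z : ℂ) s => Complex.exp (z * g s) * k s)
    (F' := fun (z : ℂ) s => Complex.exp (z * g s) * (1 * g s) * k s)
    (Metric.ball_mem_nhds z₀ one_pos)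
    (Filter.Eventually.of_forall fun z => ?_) (hi _ (by fun_prop)) ?_
    (Filter.Eventually.of_forall fun s z hz => ?_) hb
    (Filter.Eventually.of_forall fun s z _ => ?_)).2.differentiableAt
  · exact (hi _ (by fun_prop)).aestronglyMeasurable
  · exact (hi (fun s => Complex.exp (z₀ * g s) * (1 * g s)) (by fun_prop)).aestronglyMeasurable
  · rw [norm_mul, norm_mul, one_mul, mul_comm ‖g s‖]
    refine mul_le_mul_of_nonneg_right (mul_le_mul_of_nonneg_right ?_ (norm_nonneg _))
      (norm_nonneg _)
    refine (Complex.norm_exp_le_exp_norm _).trans (Real.exp_le_exp.2 ?_)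
    rw [norm_mul]
    refine mul_le_mul_of_nonneg_right ?_ (norm_nonneg _)
    have := norm_le_norm_add_norm_sub' z z₀
    rw [mem_ball_iff_norm] at hz
    linarith
  · exact (((hasDerivAt_id z).mul_const (g s)).cexp).mul_const (k s)

/-- The Fourier transform of a non-zero compactly supported measure is real-analytic, hence cannot
vanish on a non-empty open set. -/
theorem exists_fourier_curve_ne_zero (hγ : Continuous γ) (hχ : Continuous χ)
    (hχs : HasCompactSupport χ)
    (hne : ∃ g : EuclideanSpace ℝ (Fin n) → ℂ, Continuous g ∧ curvePairing γ χ 1 g ≠ 0)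
    {U : Set (EuclideanSpace ℝ (Fin n))} (hU : IsOpen U) (hUne : U.Nonempty) :
    ∃ ξ ∈ U, ∫ s, Complex.exp (-Complex.I * ((inner ℝ (γ s) ξ : ℝ) : ℂ)) * (χ s : ℂ) ≠ 0 := by
  by_contra! h
  obtain ⟨ξ₀, hξ₀⟩ := hUne
  have hzero : ∀ ξ, ∫ s, Complex.exp (-Complex.I * ((inner ℝ (γ s) ξ : ℝ) : ℂ)) * (χ s : ℂ) = 0 := by
    intro ξ
    -- restrict to the complexified line through `ξ₀` and `ξ`
    let G : ℂ → ℂ := fun z => ∫ s,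
      Complex.exp (z * (-Complex.I * ((inner ℝ (γ s) (ξ - ξ₀) : ℝ) : ℂ))) *
        (Complex.exp (-Complex.I * ((inner ℝ (γ s) ξ₀ : ℝ) : ℂ)) * (χ s : ℂ))
    have hG : Differentiable ℂ G := differentiable_integral_exp_mul (by fun_prop) (by fun_prop)
      (hχs.comp_left (g := fun t : ℝ => (t : ℂ)) (by simp)).mul_left
    have hGr : ∀ τ : ℝ, G τ = ∫ s,
        Complex.exp (-Complex.I * ((inner ℝ (γ s) (ξ₀ + τ • (ξ - ξ₀)) : ℝ) : ℂ)) * (χ s : ℂ) := by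
      intro τ
      refine integral_congr_ae (Filter.Eventually.of_forall fun s => ?_)
      simp only
      rw [← mul_assoc, ← Complex.exp_add, inner_add_right, real_inner_smul_right]
      congr 2
      push_cast
      ring
    have hnear : ∀ᶠ τ : ℝ in nhds 0, G τ = 0 := by
      have hc : ContinuousAt (fun τ : ℝ => ξ₀ + τ • (ξ - ξ₀)) 0 := by fun_prop
      have := hc.eventually (hU.mem_nhds (by simpa using hξ₀))
      exact this.mono fun τ hτ => (hGr τ).trans (h _ hτ)
    have hfreq : ∃ᶠ z : ℂ in nhdsWithin 0 {0}ᶜ, G z = 0 := by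
      have h1 : ∃ᶠ τ : ℝ in nhdsWithin 0 {0}ᶜ, G τ = 0 :=
        (hnear.filter_mono nhdsWithin_le_nhds).frequently
      have h2 : Filter.Tendsto (fun τ : ℝ => (τ : ℂ)) (nhdsWithin 0 {0}ᶜ) (nhdsWithin 0 {0}ᶜ) := by
        refine tendsto_nhdsWithin_of_tendsto_nhds_of_eventually_within _ ?_ ?_
        · exact (Complex.continuous_ofReal.tendsto' 0 0 (by simp)).mono_left nhdsWithin_le_nhds
        · filter_upwards [self_mem_nhdsWithin] with τ hτ
          simpa using hτ
      exact h2.frequently h1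
    have hG0 : G = 0 := AnalyticOnNhd.eq_of_frequently_eq
      (fun z _ => hG.analyticAt z) (fun z _ => analyticAt_const) hfreq
    have h1 := hGr 1
    rw [hG0] at h1
    simpa using h1.symm
  obtain ⟨g, hg, hgne⟩ := hne
  refine hgne (curvePairing_eq_zero_of_curveMeasure_eq hγ hχ hχs ?_ hg)
  have hχn : HasCompactSupport (-χ) := by simpa using hχs.neg
  have := isFiniteMeasure_curveMeasure (γ := γ) hχ hχs
  have := isFiniteMeasure_curveMeasure (γ := γ) hχ.neg hχn
  refine Measure.ext_of_charFun (funext fun t => ?_)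
  rw [← sub_eq_zero, charFun_apply, charFun_apply, integral_curveMeasure_sub hγ hχ hχs
    (f := fun x => Complex.exp (((inner ℝ x t : ℝ) : ℂ) * Complex.I)) (C := 1)
    (by fun_prop : Continuous fun x : EuclideanSpace ℝ (Fin n) =>
      Complex.exp (((inner ℝ x t : ℝ) : ℂ) * Complex.I)).stronglyMeasurable
    (fun s _ => (Complex.norm_exp_ofReal_mul_I _).le), ← hzero (-t)]
  refine integral_congr_ae (Filter.Eventually.of_forall fun s => ?_)
  simp only [inner_neg_right, Complex.real_smul]
  rw [mul_comm]
  congr 2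
  push_cast
  ring

/-- By continuity it is enough that the average does not vanish at one space-time point. -/
theorem spaceTimeNorm_ne_zero (hγ : Continuous γ) (hχ : Continuous χ) (hχs : HasCompactSupport χ)
    {p : ℝ≥0∞} (hp : p ≠ 0) {f : EuclideanSpace ℝ (Fin n) → ℂ} (hf : Continuous f)
    (h : curveAverage γ χ 1 f 0 ≠ 0) : spaceTimeNorm γ χ p f ≠ 0 := by
  have hc : Continuous fun z : EuclideanSpace ℝ (Fin n) × ℝ => curveAverage γ χ z.2 f z.1 :=
    continuous_curveAverage (f := fun (_ : EuclideanSpace ℝ (Fin n) × ℝ) => f) hγ hχ hχs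
      (hf.comp continuous_snd) continuous_snd continuous_fst
  intro h0
  rw [spaceTimeNorm, eLpNorm_eq_zero_iff hc.aestronglyMeasurable hp] at h0
  have hpos : (volume : Measure (EuclideanSpace ℝ (Fin n) × ℝ)).IsOpenPosMeasure :=
    inferInstanceAs (Measure.IsOpenPosMeasure (Measure.prod volume volume))
  have h1 := Measure.eqOn_of_ae_eq h0 hc.continuousOn continuousOn_const (by
    rw [interior_prod_eq, interior_univ, interior_Icc, closure_prod_eq, closure_univ,
      closure_Ioo (by norm_num)])
  exact h (h1 (x := (0, 1)) ⟨mem_univ _, by norm_num, by norm_num⟩)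

/-- A lower bound at frequencies close to `lam₁`, from one packet `exp(i⟨x, ξ⟩) η(δ x)` with `δ` small
and the Fourier transform of the measure not vanishing at `ξ`. -/
theorem eventually_le_sSup_of_frequency_near (hn : 0 < n) (hγ : Continuous γ) (hχ : Continuous χ)
    (hχs : HasCompactSupport χ)
    (hne : ∃ g : EuclideanSpace ℝ (Fin n) → ℂ, Continuous g ∧ curvePairing γ χ 1 g ≠ 0)
    {p : ℝ≥0∞} (hp : p ≠ 0) {lam₁ : ℝ} (hlam₁ : 0 < lam₁) :
    ∃ c : ℝ, 0 < c ∧ ∀ᶠ lam in nhds lam₁, ENNReal.ofReal c ≤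
        sSup {r : ℝ≥0∞ | ∃ f ∈ bandLimited n lam,
          eLpNorm f p volume = 1 ∧ r = spaceTimeNorm γ χ p f} := by
  obtain ⟨ψ, η, r, hr, hψ0, hη, hηr⟩ := exists_window n
  have hUo : IsOpen {ξ : EuclideanSpace ℝ (Fin n) | lam₁ / 2 < ‖ξ‖ ∧ ‖ξ‖ < 2 * lam₁} :=
    (isOpen_lt continuous_const continuous_norm).inter (isOpen_lt continuous_norm continuous_const)
  obtain ⟨ξ, ⟨hξ1, hξ2⟩, hξ⟩ := exists_fourier_curve_ne_zero hγ hχ hχs hne hUo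
    ⟨EuclideanSpace.single ⟨0, hn⟩ lam₁, by
      simp only [mem_ofPred_eq, PiLp.norm_single, Real.norm_of_nonneg hlam₁.le]
      constructor <;> linarith⟩
  have hcont : Continuous fun δ : ℝ => curveAverage γ χ 1 (wavePacket η δ 0 ξ) 0 := by
    refine continuous_curveAverage (f := fun δ : ℝ => wavePacket η δ 0 ξ) hγ hχ hχs ?_
      continuous_const continuous_const
    have := η.continuous
    unfold wavePacket
    fun_prop
  have h0 : curveAverage γ χ 1 (wavePacket η 0 0 ξ) 0 ≠ 0 := by
    have : curveAverage γ χ 1 (wavePacket η 0 0 ξ) 0 = η 0 *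
        ∫ s, Complex.exp (-Complex.I * ((inner ℝ (γ s) ξ : ℝ) : ℂ)) * (χ s : ℂ) := by
      rw [curveAverage, curvePairing, ← integral_const_mul]
      refine integral_congr_ae (Filter.Eventually.of_forall fun s => ?_)
      simp only [wavePacket, zero_smul, one_smul, zero_sub, inner_neg_left]
      push_cast
      ring_nf
    rw [this]
    refine mul_ne_zero ?_ hξ
    rw [hη]
    exact_mod_cast pow_ne_zero 2 (norm_ne_zero_iff.2 hψ0)
  set m := min (‖ξ‖ - lam₁ / 2) (2 * lam₁ - ‖ξ‖) / 2 with hm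
  have hm0 : 0 < m := by
    have := lt_min (sub_pos.2 hξ1) (sub_pos.2 hξ2)
    positivity
  have hm1 : m < ‖ξ‖ - lam₁ / 2 := by
    have := min_le_left (‖ξ‖ - lam₁ / 2) (2 * lam₁ - ‖ξ‖)
    linarith
  have hm2 : m < 2 * lam₁ - ‖ξ‖ := by
    have := min_le_right (‖ξ‖ - lam₁ / 2) (2 * lam₁ - ‖ξ‖)
    linarith
  obtain ⟨δ, ⟨hδne, hδm⟩, hδ0⟩ : ∃ δ : ℝ, (curveAverage γ χ 1 (wavePacket η δ 0 ξ) 0 ≠ 0 ∧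
      δ * r < m) ∧ 0 < δ := by
    have h1 := hcont.continuousAt.eventually_ne h0
    have h2 : ∀ᶠ δ : ℝ in nhds 0, δ * r < m :=
      ((continuous_id.mul continuous_const).tendsto' (0 : ℝ) (0 : ℝ) (by simp)).eventually_lt_const
        hm0
    have h3 : ∀ᶠ δ : ℝ in nhdsWithin 0 (Ioi 0), 0 < δ := self_mem_nhdsWithin
    exact (((h1.and h2).filter_mono nhdsWithin_le_nhds).and h3).exists
  obtain ⟨f, hf⟩ := exists_schwartz_eq_wavePacket η hδ0 0 ξ
  have hS := spaceTimeNorm_ne_zero hγ hχ hχs hp f.continuous (by rwa [hf])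
  have hSt : min (spaceTimeNorm γ χ p f) 1 ≠ ⊤ := ne_top_of_le_ne_top ENNReal.one_ne_top
    (min_le_right _ _)
  have hA : 0 < (min (spaceTimeNorm γ χ p f) 1).toReal :=
    ENNReal.toReal_pos (lt_min (pos_iff_ne_zero.2 hS) zero_lt_one).ne' hSt
  have hft : eLpNorm f p volume ≠ ⊤ := (f.memLp p volume).2.ne
  have hK : 0 < (eLpNorm f p volume).toReal + 1 := by positivity
  refine ⟨_, div_pos hA hK, ?_⟩
  have hl1 : ∀ᶠ lam : ℝ in nhds lam₁, lam / 2 < ‖ξ‖ - m :=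
    ((continuous_id.div_const 2).tendsto lam₁).eventually_lt_const (by simp; linarith)
  have hl2 : ∀ᶠ lam : ℝ in nhds lam₁, ‖ξ‖ + m < 2 * lam :=
    ((continuous_const.mul continuous_id).tendsto lam₁).eventually_const_lt (by simp; linarith)
  filter_upwards [hl1, hl2] with lam h1 h2
  refine le_sSup_of_mem_bandLimited (f := f) hp (mem_bandLimited fun ζ hζ => ?_) hA hK ?_ ?_
  · rw [hf, angularFourier_wavePacket _ hδ0, hηr, mul_zero, smul_zero]
    by_contra! hle
    refine hζ ?_
    rw [norm_smul, norm_inv, Real.norm_of_nonneg hδ0.le, inv_mul_le_iff₀ hδ0] at hle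
    have h3 := abs_le.1 ((abs_norm_sub_norm_le ζ ξ).trans (hle.trans hδm.le))
    constructor <;> linarith
  · rw [ENNReal.ofReal_toReal hSt]
    exact min_le_left _ _
  · rw [ENNReal.ofReal_add ENNReal.toReal_nonneg zero_le_one, ENNReal.ofReal_toReal hft]
    exact le_self_add

/-- On a compact range of frequencies the space-time norm is bounded below, because the Fourier
transform of the measure does not vanish identically on any annulus. -/
theorem exists_le_sSup_of_frequency_le (hn : 0 < n) (hγ : Continuous γ) (hχ : Continuous χ)
    (hχs : HasCompactSupport χ)
    (hne : ∃ g : EuclideanSpace ℝ (Fin n) → ℂ, Continuous g ∧ curvePairing γ χ 1 g ≠ 0)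
    {p : ℝ≥0∞} (hp : p ≠ 0) (Lam : ℝ) :
    ∃ c : ℝ, 0 < c ∧ ∀ lam ∈ Icc 1 Lam, ENNReal.ofReal c ≤
        sSup {r : ℝ≥0∞ | ∃ f ∈ bandLimited n lam,
          eLpNorm f p volume = 1 ∧ r = spaceTimeNorm γ χ p f} := by
  refine (isCompact_Icc (a := (1 : ℝ)) (b := Lam)).induction_on
    (p := fun S => ∃ c : ℝ, 0 < c ∧ ∀ lam ∈ S, ENNReal.ofReal c ≤
        sSup {r : ℝ≥0∞ | ∃ f ∈ bandLimited n lam,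
          eLpNorm f p volume = 1 ∧ r = spaceTimeNorm γ χ p f})
    ⟨1, one_pos, by simp⟩ ?_ ?_ ?_
  · rintro S T hST ⟨c, hc, h⟩
    exact ⟨c, hc, fun lam hlam => h lam (hST hlam)⟩
  · rintro S T ⟨c, hc, h⟩ ⟨d, hd, h'⟩
    refine ⟨min c d, lt_min hc hd, ?_⟩
    rintro lam (hlam | hlam)
    · exact (ENNReal.ofReal_le_ofReal (min_le_left _ _)).trans (h lam hlam)
    · exact (ENNReal.ofReal_le_ofReal (min_le_right _ _)).trans (h' lam hlam)
  · intro lam hlam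
    obtain ⟨c, hc, h⟩ := eventually_le_sSup_of_frequency_near hn hγ hχ hχs hne hp (zero_lt_one.trans_le hlam.1)
    exact ⟨_, mem_nhdsWithin_of_mem_nhds h, c, hc, fun _ h => h⟩

end

/-! ### Choice of scale and conclusion -/

theorem exists_le_sSup_of_continuous {n : ℕ} (hn : 2 ≤ n) {a b : ℝ} (hab : a < b)
    {γ : ℝ → EuclideanSpace ℝ (Fin n)} (hγc : Continuous γ) (hγ : IsNondegenerateCurve a b γ)
    {χ : ℝ → ℝ} (hχ : IsCurveCutoff a b γ χ) {p : ℝ≥0∞} (hp : 2 ≤ p) {ε : ℝ} (hε : 0 < ε) :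
    ∃ C : ℝ, 0 < C ∧ ∀ lam : ℝ, 1 ≤ lam →
      ENNReal.ofReal (C * lam ^ (-(1 / (n : ℝ)) * (1 / 2 + (2 / p).toReal) - ε)) ≤
        sSup {r : ℝ≥0∞ | ∃ f ∈ bandLimited n lam,
          eLpNorm f p volume = 1 ∧ r = spaceTimeNorm γ χ p f} := by
  have hsupp : tsupport χ ⊆ Ioo a b := by simpa [interior_Icc] using hχ.support
  have hχc := hχ.smooth.continuous
  have hχs : HasCompactSupport χ :=
    isCompact_Icc.of_isClosed_subset (isClosed_tsupport χ) (hsupp.trans Ioo_subset_Icc_self)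
  obtain ⟨ψ, η, r, hr, hψ0, hη, hηr⟩ := exists_window n
  obtain ⟨D, hD⟩ := exists_norm_le_inv_one_add_norm_sq η
  have hn0 : (0 : ℝ) < n := by exact_mod_cast (by omega : 0 < n)
  have hn2 : 1 / (n : ℝ) ≤ 1 / 2 :=
    one_div_le_one_div_of_le two_pos (by exact_mod_cast hn)
  -- `q = 1 / p`, also for `p = ∞`, where `p.toReal = 0` and `1 / 0 = 0`
  obtain ⟨q, hq⟩ : ∃ q, 1 / p.toReal = q := ⟨_, rfl⟩
  have hq0 : 0 ≤ q := hq ▸ by positivity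
  have hq1 : q ≤ 1 / 2 := hq ▸ one_div_toReal_le_half hp
  have hpq : (2 / p).toReal = 2 * q := by
    rw [ENNReal.toReal_div, ← hq]
    simp [div_eq_mul_inv]
  -- the scale `1 / N` with `N ≈ lam ^ κ` lies just below the critical scale `lam ^ (-1 / n)`
  obtain ⟨κ', hκ'0, hκ'ε, hκ'4⟩ : ∃ κ' : ℝ, 0 < κ' ∧ κ' ≤ ε / 2 ∧ κ' ≤ 1 / 4 :=
    ⟨min (ε / 2) (1 / 4), by positivity, min_le_left _ _, min_le_right _ _⟩
  obtain ⟨κ, hκ⟩ : ∃ κ, κ = 1 / (n : ℝ) + κ' := ⟨_, rfl⟩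
  have hκ0 : 0 < κ := by rw [hκ]; positivity
  have hκ1 : 0 < 1 - κ := by rw [hκ]; linarith
  have hNle : ∀ lam : ℝ, lam ^ κ ≤ (⌈lam ^ κ⌉₊ : ℝ) := fun lam => Nat.le_ceil _
  have hNt : Filter.Tendsto (fun lam : ℝ => (⌈lam ^ κ⌉₊ : ℝ)) Filter.atTop Filter.atTop :=
    Filter.tendsto_atTop_mono hNle (tendsto_rpow_atTop hκ0)
  have hlamt : Filter.Tendsto (fun lam : ℝ => lam / (⌈lam ^ κ⌉₊ : ℝ) ^ n) Filter.atTop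
      (nhds 0) := by
    refine squeeze_zero' (g := fun lam : ℝ => lam ^ (-(κ' * n))) ?_ ?_
      (tendsto_rpow_neg_atTop (by positivity))
    · filter_upwards [Filter.eventually_ge_atTop 0] with lam hlam
      positivity
    · filter_upwards [Filter.eventually_gt_atTop 0] with lam hlam
      have h1 : (lam ^ κ) ^ n = lam * lam ^ (κ' * n) := by
        rw [← Real.rpow_natCast, ← Real.rpow_mul hlam.le, hκ, add_mul, one_div,
          inv_mul_cancel₀ hn0.ne', Real.rpow_add hlam, Real.rpow_one]
      have h2 : lam * lam ^ (κ' * n) ≤ (⌈lam ^ κ⌉₊ : ℝ) ^ n :=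
        h1 ▸ pow_le_pow_left₀ (by positivity) (hNle lam) n
      calc lam / (⌈lam ^ κ⌉₊ : ℝ) ^ n ≤ lam / (lam * lam ^ (κ' * n)) := by gcongr
        _ = lam ^ (-(κ' * n)) := by
          rw [Real.rpow_neg hlam.le]
          field_simp
  obtain ⟨e, B, c, α, β, θ, Θ, L, harc, hθc, hθ, hθs, hL, hlim⟩ :=
    exists_arc_tendsto_ne_zero hn hab hγc hγ hχ η.continuous hD
      (f := fun x => ‖ψ x‖ ^ 2) (by have := ψ.continuous; fun_prop) (fun x => by positivity)
      (pow_ne_zero 2 (norm_ne_zero_iff.2 hψ0)) hη hNt hlamt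
  have hL0 : 0 < ‖L‖ := norm_pos_iff.2 hL
  obtain ⟨C₁, hC₁, hlow⟩ := exists_le_sSup_of_le_norm_integral harc hD hηr hχc hχs hθc
    (Θ := |Θ| + 1) (by positivity) (fun s => (hθ s).trans (by linarith [le_abs_self Θ])) hθs
    (δ := ‖L‖ / 2) (by positivity) hp
  have hbig : ∀ᶠ lam : ℝ in Filter.atTop, ‖L‖ / 2 ≤ ‖∫ s, (χ s : ℂ) *
      testedKernel γ e η θ (⌈lam ^ κ⌉₊ : ℝ) lam (γ s)‖ :=
    (hlim.norm.eventually_const_lt (by linarith)).mono fun _ h => h.le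
  have hband : ∀ᶠ lam : ℝ in Filter.atTop, 4 * r ≤ lam ^ (1 - κ) :=
    (tendsto_rpow_atTop hκ1).eventually_ge_atTop _
  obtain ⟨Lam, hLam⟩ := Filter.eventually_atTop.1 (hbig.and hband)
  obtain ⟨C₂, hC₂, hsmall⟩ := exists_le_sSup_of_frequency_le (by omega) hγc hχc hχs hχ.measure_ne_zero
    (p := p) (zero_lt_two.trans_le hp).ne' Lam
  obtain ⟨m, hm⟩ : ∃ m, 1 / 2 + 2 * q = m := ⟨_, rfl⟩
  refine ⟨min C₂ (C₁ * 2 ^ (-m)), lt_min hC₂ (by positivity), fun lam hlam => ?_⟩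
  have hlam0 : 0 < lam := zero_lt_one.trans_le hlam
  rw [hpq, hm]
  have hm0 : 0 < m := by linarith
  rcases le_total lam Lam with h | h
  · refine (ENNReal.ofReal_le_ofReal ?_).trans (hsmall lam ⟨hlam, h⟩)
    have h1 : lam ^ (-(1 / (n : ℝ)) * m - ε) ≤ 1 := Real.rpow_le_one_of_one_le_of_nonpos hlam (by
      have : 0 ≤ 1 / (n : ℝ) * m := by positivity
      linarith)
    calc min C₂ (C₁ * 2 ^ (-m)) * lam ^ (-(1 / (n : ℝ)) * m - ε) ≤ C₂ * 1 := by
          gcongr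
          exact min_le_left _ _
      _ = C₂ := mul_one _
  · obtain ⟨h1, h2⟩ := hLam lam h
    have hlk : 1 ≤ lam ^ κ := Real.one_le_rpow hlam hκ0.le
    have hNpos : 0 < ⌈lam ^ κ⌉₊ := Nat.ceil_pos.2 (by linarith)
    have hN2 : (⌈lam ^ κ⌉₊ : ℝ) ≤ 2 * lam ^ κ := by
      have := Nat.ceil_lt_add_one (zero_le_one.trans hlk)
      linarith
    refine (ENNReal.ofReal_le_ofReal ?_).trans (hlow ⌈lam ^ κ⌉₊ lam hNpos hlam0 ?_ h1)
    · rw [hq, show -(1 / 2 : ℝ) - 2 * q = -m by rw [← hm]; ring]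
      have h3 : (2 * lam ^ κ) ^ (-m) ≤ (⌈lam ^ κ⌉₊ : ℝ) ^ (-m) :=
        Real.rpow_le_rpow_of_nonpos (by exact_mod_cast hNpos) hN2 (by linarith)
      have h4 : lam ^ (-(1 / (n : ℝ)) * m - ε) ≤ lam ^ (κ * -m) := by
        refine Real.rpow_le_rpow_of_exponent_le hlam ?_
        rw [hκ]
        have : κ' * m ≤ ε / 2 * (3 / 2) := mul_le_mul hκ'ε (by linarith) hm0.le (by positivity)
        linarith
      calc min C₂ (C₁ * 2 ^ (-m)) * lam ^ (-(1 / (n : ℝ)) * m - ε)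
          ≤ C₁ * 2 ^ (-m) * lam ^ (κ * -m) := by
            gcongr
            exact min_le_right _ _
        _ = C₁ * (2 * lam ^ κ) ^ (-m) := by
            rw [Real.mul_rpow two_pos.le (by positivity), ← Real.rpow_mul hlam0.le, mul_assoc]
        _ ≤ _ := by gcongr
    · have h3 : lam = lam ^ κ * lam ^ (1 - κ) := by
        rw [← Real.rpow_add hlam0, add_sub_cancel, Real.rpow_one]
      calc (⌈lam ^ κ⌉₊ : ℝ) * r ≤ 2 * lam ^ κ * r := by gcongr
        _ = lam ^ κ * (4 * r) / 2 := by ring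
        _ ≤ lam ^ κ * lam ^ (1 - κ) / 2 := by gcongr
        _ = lam / 2 := by rw [← h3]

theorem curvePairing_congr {n : ℕ} {γ γ' : ℝ → EuclideanSpace ℝ (Fin n)} {χ : ℝ → ℝ}
    (h : ∀ s, χ s ≠ 0 → γ s = γ' s) : curvePairing γ χ = curvePairing γ' χ := by
  funext t g
  refine integral_congr_ae (Filter.Eventually.of_forall fun s => ?_)
  by_cases hs : χ s = 0
  · simp [hs]
  · simp only [h s hs]

theorem proposition3p1 {n : ℕ} (hn : 2 ≤ n) (a b : ℝ) (hab : a < b)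
    (γ : ℝ → EuclideanSpace ℝ (Fin n)) (hγ : IsNondegenerateCurve a b γ)
    (χ : ℝ → ℝ) (hχ : IsCurveCutoff a b γ χ)
    (p : ℝ≥0∞) (hp : 2 ≤ p) (ε : ℝ) (hε : 0 < ε) :
    ∃ C : ℝ, 0 < C ∧ ∀ lam : ℝ, 1 ≤ lam →
      ENNReal.ofReal (C * lam ^ (-(1 / (n : ℝ)) * (1 / 2 + (2 / p).toReal) - ε)) ≤
        sSup {r : ℝ≥0∞ | ∃ f ∈ bandLimited n lam,
          eLpNorm f p volume = 1 ∧ r = spaceTimeNorm γ χ p f} := by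
  -- only the values of `γ` on `[a, b]` matter, so `γ` may be taken continuous on the line
  obtain ⟨γ', hγ'⟩ : ∃ γ', γ' = IccExtend hab.le ((Icc a b).domRestrict γ) := ⟨_, rfl⟩
  have heq : EqOn γ' γ (Icc a b) := fun s hs => by
    rw [hγ', IccExtend_of_mem hab.le _ hs, domRestrict_apply]
  have hγ'c : Continuous γ' := by
    rw [hγ']
    exact (continuousOn_iff_continuous_domRestrict.1 hγ.smooth.continuousOn).Icc_extend'
  have hpair : curvePairing γ χ = curvePairing γ' χ := curvePairing_congr fun s hs =>
    (heq (interior_subset (hχ.support (subset_tsupport _ hs)))).symm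
  have hnorm : spaceTimeNorm γ χ p = spaceTimeNorm γ' χ p := by
    funext f
    simp only [spaceTimeNorm, curveAverage, hpair]
  rw [hnorm]
  refine exists_le_sSup_of_continuous hn hab hγ'c ⟨hγ.smooth.congr heq, ?_⟩
    ⟨hχ.smooth, hχ.support, hpair ▸ hχ.measure_ne_zero⟩ hp hε
  obtain ⟨c₀, hc₀, h⟩ := hγ.nondegenerate
  refine ⟨c₀, hc₀, fun s hs => ?_⟩
  simp only [iteratedDerivWithin_congr heq hs]
  exact h s hs
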